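/- **Setting.** Let $a<b$ be integers, $N\ge 0$ an integer, $\beta>0$, $\mathbf I=\{a,\dots,b\}$, $\mathbf I^*=\{a+\frac12,\dots,b-\frac12\}$, $\mathbf J=\{0,\dots,N\}$, $\alpha=e^{-2\beta}$, $\lambda=e^{i\pi/4}$. On the space with basis $(\mathbf e_\sigma)_{\sigma\in\{\pm1\}^{\mathbf I}}$ let $V=(V^{\mathrm h})^{1/2}V^{\mathrm v}(V^{\mathrm h})^{1/2}$, where $(V^{\mathrm h})^{1/2}$ is diagonal with entries $\exp(\frac\beta2\sum_{i=a}^{b-1}\sigma_i\sigma_{i+1})$, and $V^{\mathrm v}_{\sigma\rho}=\exp(\beta\sum_{i=a}^b\sigma_i\rho_i)$ if $\sigma_a=\rho_a$ and $\sigma_b=\rho_b$, and $V^{\mathrm v}_{\sigma\rho}=0$ otherwise. For $k\in\mathbf I^*$ let $p_k\mathbf e_\sigma=\sigma_{k+1/2}\mathbf e_\tau$ and $q_k\mathbf e_\sigma=i\,\sigma_{k-1/2}\mathbf e_\tau$, where $\tau$ is $\sigma$ with all spins at $x<k$ flipped; let $\psi_k=\frac{i}{\sqrt2}(p_k+q_k)$,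 $\bar\psi_k=\frac1{\sqrt2}(p_k-q_k)$. For a horizontal edge with midpoint $z=k+iy\in\mathbf I^*\times\mathbf J$ let $\psi(z)=V^{-y}\psi_kV^y$, $\bar\psi(z)=V^{-y}\bar\psi_kV^y$, and $$\psi^\uparrow(z)=\tfrac12(\bar\psi(z)-\psi(z)),\qquad \psi^\downarrow(z)=\tfrac i2(\psi(z)+\bar\psi(z)).$$ Let $\mathbf e_{(+)}$ be the basis vector of the all-plus configuration and $\langle A\rangle=\dfrac{\langle\mathbf e_{(+)}|V^NA|\mathbf e_{(+)}\rangle}{\langle\mathbf e_{(+)}|V^N|\mathbf e_{(+)}\rangle}$. **Observable.** Let $\mathbf I^*\times(\mathbf J+\frac12)$, with $\mathbf J+\frac12=\{\frac12,\dots,N-\frac12\}$, be the set of faces of the box and $\mathcal E^*$ the set of dual edges, i.e. of pairs of faces at distance $1$. Let $z_1,\dots,z_{2m}$ be distinct edges with orientations $o_j$ of their dual edges and square roots $\varepsilon_j^2=o_j$. Let $\mathcal C^\varepsilon$ be the set of configurations $\gamma$ that consist of the half-edges $\langle z_j,z_j+\frac{o_j}2\rangle$ (which have to lead to faces of the box)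 and of edges of $\mathcal E^*$ other than the full dual edges through the $z_j$, such that each face belongs to an even number of edges and half-edges of $\gamma$. Let $L(\gamma)$ be the number of full dual edges in $\gamma$ plus $m$. Choose $m$ edge-disjoint paths $\pi_1,\dots,\pi_m$ in $\gamma$ linking the $z_j$ pairwise, each turning left or right at every face where four edges or half-edges of $\gamma$ meet, and orient $\pi_j$ from $z_{s_j}$ to $z_{d_j}$ with $s_j<d_j$. Put $$w^\varepsilon(\gamma)=(-1)^{\#\{(j,k):\,s_j<s_k<d_j<d_k\}}\prod_{j=1}^m\frac{\varepsilon_{d_j}}{\varepsilon_{s_j}}e^{-\frac i2\mathbf W(\pi_j)},\qquad f^\varepsilon(z_1,\dots,z_{2m})=\frac1{\mathcal Z}\sum_{\gamma\in\mathcal C^\varepsilon}\alpha^{L(\gamma)}w^\varepsilon(\gamma),$$ where $\mathbf W$ is the total (counterclockwise) turning angle and $\mathcal Z=\sum_\omega\alpha^{|\omega|}$ is the sum over all $\omega\subset\mathcal E^*$ with an even number of edges at every face. **Theorem.** Let $m\ge0$, let $z_1,\dots,z_{2m}\in\mathbf I^*\times\mathbf J$ be distinct horizontal edges, and let $\updownarrow_1,\dots,\updownarrow_{2m}\in\{\uparrow,\downarrow\}$.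 Let $\varepsilon_j=\lambda$ (so $o_j=i$) if $\updownarrow_j=\uparrow$, and $\varepsilon_j=\lambda^{-1}$ (so $o_j=-i$) if $\updownarrow_j=\downarrow$. Then every $\gamma\in\mathcal C^\varepsilon$ admits a choice of paths as above, $w^\varepsilon(\gamma)$ does not depend on this choice, and the time-ordered correlation of the fermions is the multipoint observable up to the sign $(-1)^m$: for every permutation $\tau$ of $\{1,\dots,2m\}$ such that $\operatorname{Im}z_{\tau(1)}\le\dots\le\operatorname{Im}z_{\tau(2m)}$, $$\operatorname{sgn}(\tau)\,\bigl\langle\psi^{\updownarrow_{\tau(2m)}}(z_{\tau(2m)})\cdots\psi^{\updownarrow_{\tau(1)}}(z_{\tau(1)})\bigr\rangle=(-1)^m f^\varepsilon(z_1,\dots,z_{2m}).$$ In particular $\langle\psi^{\updownarrow_{2m}}(z_{2m})\cdots\psi^{\updownarrow_1}(z_1)\rangle=(-1)^mf^\varepsilon(z_1,\dots,z_{2m})$ whenever $\operatorname{Im}z_1\le\dots\le\operatorname{Im}z_{2m}$. -/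

import Mathlib

noncomputable section

namespace IsingFermion

open Matrix

/-! ### Transfer matrix and fermion operators on the row `I = {a, …, b}` -/

/-- The sites of the row `I = {a, a+1, …, b}`. -/
abbrev Site (a b : ℤ) : Type := ↥(Finset.Icc a b)

/-- The dual row `I* = {a + 1/2, …, b - 1/2}`; the integer `k` stands for the point `k + 1/2`. -/
abbrev DualSite (a b : ℤ) : Type := ↥(Finset.Ico a b)

/-- The site `k` immediately to the left of `k + 1/2`. -/
def DualSite.left {a b : ℤ} (k : DualSite a b) : Site a b :=
  ⟨k.1, Finset.mem_Icc.mpr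
    ⟨(Finset.mem_Ico.mp k.2).1, (Finset.mem_Ico.mp k.2).2.le⟩⟩

/-- The site `k + 1` immediately to the right of `k + 1/2`. -/
def DualSite.right {a b : ℤ} (k : DualSite a b) : Site a b :=
  ⟨k.1 + 1, Finset.mem_Icc.mpr
    ⟨(Finset.mem_Ico.mp k.2).1.trans (Int.lt_succ _).le,
      Int.add_one_le_of_lt (Finset.mem_Ico.mp k.2).2⟩⟩

/-- Spin configurations of a row; `ℤˣ = {1, -1}`. -/
abbrev RowConfig (a b : ℤ) : Type := Site a b → ℤˣ

/-- Operators on the state space with basis `(e_σ)`, as matrices: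
the operator `A` maps `e_σ` to `∑ τ, A τ σ • e_τ`. -/
abbrev RowOp (a b : ℤ) : Type := Matrix (RowConfig a b) (RowConfig a b) ℂ

/-- The value `±1` of a spin as a complex number. -/
def spinVal (s : ℤˣ) : ℂ := ((s : ℤ) : ℂ)

/-- The value `±1` of a spin as a real number. -/
def spinValR (s : ℤˣ) : ℝ := ((s : ℤ) : ℝ)

/-- The vertical interactions, with the spins at both ends of the row kept fixed. -/
def Vvert (a b : ℤ) (β : ℝ) : RowOp a b :=
  Matrix.of fun σ ρ =>
    if ∀ x : Site a b, ((x : ℤ) = a ∨ (x : ℤ) = b) → σ x = ρ x then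
      (Real.exp (β * ∑ x : Site a b, spinValR (σ x) * spinValR (ρ x)) : ℂ)
    else 0

/-- The (positive) square root of the diagonal matrix of horizontal interactions. -/
def VhorHalf (a b : ℤ) (β : ℝ) : RowOp a b :=
  Matrix.diagonal fun σ =>
    (Real.exp (β / 2 * ∑ k : DualSite a b, spinValR (σ k.left) * spinValR (σ k.right)) : ℂ)

/-- The Ising transfer matrix `V = (V^h)^{1/2} V^v (V^h)^{1/2}`. -/
def transferMatrix (a b : ℤ) (β : ℝ) : RowOp a b :=
  VhorHalf a b β * Vvert a b β * VhorHalf a b β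

/-- Flip all the spins to the left of `k + 1/2`. -/
def flipLeft {a b : ℤ} (k : DualSite a b) (σ : RowConfig a b) : RowConfig a b :=
  fun x => if (x : ℤ) ≤ (k : ℤ) then -σ x else σ x

/-- The operator `p_k : e_σ ↦ σ_{k + 1/2} e_τ`, where `τ = flipLeft k σ`. -/
def opP {a b : ℤ} (k : DualSite a b) : RowOp a b :=
  Matrix.of fun τ σ => if τ = flipLeft k σ then spinVal (σ k.right) else 0

/-- The operator `q_k : e_σ ↦ i σ_{k - 1/2} e_τ`, where `τ = flipLeft k σ`. -/
def opQ {a b : ℤ} (k : DualSite a b) : RowOp a b :=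
  Matrix.of fun τ σ => if τ = flipLeft k σ then Complex.I * spinVal (σ k.left) else 0

/-- `ψ_k = (i / √2) (p_k + q_k)`. -/
def psiRow {a b : ℤ} (k : DualSite a b) : RowOp a b :=
  (Complex.I / (Real.sqrt 2 : ℂ)) • (opP k + opQ k)

/-- `ψ̄_k = (1 / √2) (p_k - q_k)`. -/
def psiBarRow {a b : ℤ} (k : DualSite a b) : RowOp a b :=
  (1 / (Real.sqrt 2 : ℂ)) • (opP k - opQ k)

/-- Horizontal edges of the box `I × {0, …, N}`: the pair `(k, y)` is the edge with
midpoint `(k + 1/2) + i y`. -/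
abbrev HEdge (a b : ℤ) (N : ℕ) : Type := DualSite a b × Fin (N + 1)

/-- The time evolution `V^{-y} A V^y` of an operator `A` of the row. -/
def evolve {a b : ℤ} (β : ℝ) (y : ℕ) (A : RowOp a b) : RowOp a b :=
  (transferMatrix a b β)⁻¹ ^ y * A * transferMatrix a b β ^ y

/-- The holomorphic fermion `ψ(z) = V^{-y} ψ_k V^y`. -/
def psi {a b : ℤ} {N : ℕ} (β : ℝ) (z : HEdge a b N) : RowOp a b :=
  evolve β z.2 (psiRow z.1)

/-- The antiholomorphic fermion `ψ̄(z) = V^{-y} ψ̄_k V^y`. -/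
def psiBar {a b : ℤ} {N : ℕ} (β : ℝ) (z : HEdge a b N) : RowOp a b :=
  evolve β z.2 (psiBarRow z.1)

/-- The two arrows `↑`, `↓`. -/
inductive Arrow : Type
  | up
  | down

/-- `ψ^↑ = (ψ̄ - ψ) / 2` and `ψ^↓ = (i / 2) (ψ + ψ̄)`. -/
def psiArrow {a b : ℤ} {N : ℕ} (β : ℝ) : Arrow → HEdge a b N → RowOp a b
  | Arrow.up, z => (1 / 2 : ℂ) • (psiBar β z - psi β z)
  | Arrow.down, z => (Complex.I / 2) • (psi β z + psiBar β z)

/-- The basis vector `e_(+)` of the row configuration with all spins `+1`. -/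
def plusState (a b : ℤ) : RowConfig a b → ℂ := Pi.single (fun _ => 1) 1

/-- The correlation `⟨A⟩ = ⟨e_(+)| V^N A |e_(+)⟩ / ⟨e_(+)| V^N |e_(+)⟩` in the box
`I × {0, …, N}` with plus boundary conditions. -/
def correlation {a b : ℤ} (N : ℕ) (β : ℝ) (A : RowOp a b) : ℂ :=
  (plusState a b ⬝ᵥ ((transferMatrix a b β ^ N * A) *ᵥ plusState a b)) /
    (plusState a b ⬝ᵥ ((transferMatrix a b β ^ N) *ᵥ plusState a b))

/-! ### Multipoint parafermionic observables

All points of the (half-integer) lattice are written in doubled coordinates: the pair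
`(u, v)` stands for the complex number `(u + i v) / 2`. Thus faces have both coordinates odd,
midpoints of horizontal edges have first coordinate odd and second coordinate even, and so on.
An edge and its dual edge are both identified with their common midpoint. -/

/-- Points of the lattice, in doubled coordinates. -/
abbrev Pt : Type := ℤ × ℤ

/-- The four directions `i ^ d`: `0` is east, `1` north, `2` west and `3` south. -/
abbrev Dir : Type := Fin 4

/-- The vector `i ^ d / 2`, in doubled coordinates. -/
def halfStep (d : Dir) : Pt := ![(1, 0), (0, 1), (-1, 0), (0, -1)] d

/-- An orientation `o ∈ {±1, ±i}` together with a choice `ε` of a square root of it. -/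
structure Root where
  /-- the direction `d`, with `o = i ^ d` -/
  dir : Dir
  /-- the square root `ε` -/
  val : ℂ
  sq : val ^ 2 = Complex.I ^ (dir : ℕ)

/-- `exp (i π / 4)` -/
def lam : ℂ := Complex.exp (Complex.I * (Real.pi / 4))

lemma lam_sq : lam ^ 2 = Complex.I := by
  have h : ((2 : ℕ) : ℂ) * (Complex.I * (Real.pi / 4)) = Real.pi / 2 * Complex.I := by
    push_cast
    ring
  rw [lam, ← Complex.exp_nat_mul, h, Complex.exp_pi_div_two_mul_I]

/-- The root `λ` of `o = i` for `↑`, and the root `λ⁻¹` of `o = -i` for `↓`. -/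
def arrowRoot : Arrow → Root
  | Arrow.up => ⟨1, lam, by rw [lam_sq]; simp⟩
  | Arrow.down => ⟨3, lam⁻¹, by
      rw [inv_pow, lam_sq, Complex.inv_I]
      exact Complex.I_pow_three.symm⟩

/-- The dual edges (identified with their midpoints) of a domain with set of faces `F`:
those with a face of the domain on both sides. -/
def dualEdges (F : Finset Pt) : Finset Pt :=
  ((F ×ˢ (Finset.univ : Finset Dir)).filter
    fun x => x.1 + halfStep x.2 + halfStep x.2 ∈ F).image fun x => x.1 + halfStep x.2

/-- The number of edges of `γ` and half-edges `⟨z_j, z_j + o_j / 2⟩` at the face `p`. -/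
def degAt {n : ℕ} (z : Fin n → Pt) (ε : Fin n → Root) (γ : Finset Pt) (p : Pt) : ℕ :=
  (Finset.univ.filter fun d : Dir => p + halfStep d ∈ γ).card +
    (Finset.univ.filter fun j : Fin n => z j + halfStep (ε j).dir = p).card

/-- The contour configurations with half-edges `⟨z_j, z_j + o_j / 2⟩`. A configuration is
recorded through its set `γ` of full dual edges. The half-edges lead to faces of the domain,
the full dual edge through `z_j` is not used in addition to its half, and every face belongs
to an even number of edges and half-edges. -/
def contours (F : Finset Pt) {n : ℕ} (z : Fin n → Pt) (ε : Fin n → Root) :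
    Finset (Finset Pt) :=
  (dualEdges F).powerset.filter fun γ =>
    (∀ j, z j + halfStep (ε j).dir ∈ F) ∧ (∀ j, z j ∉ γ) ∧ ∀ p ∈ F, Even (degAt z ε γ p)

/-- The turn from direction `d` to direction `d'`, in counterclockwise quarter turns
(backtracking does not occur on the paths below). -/
def turn (d d' : Dir) : ℤ := ![0, 1, 0, -1] (d' - d)

/-- A path in the configuration `γ` from `z s` to `z t`. It starts along the half-edge at
`z s`, runs through edges of `γ`, and ends along the half-edge at `z t`. It passes through the
midpoints `edge 0, edge 1, …` in the directions `dir 0, dir 1, …`; no edge is used twice, and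
it does not go straight through a face where two strands of the configuration meet. -/
structure Strand {n : ℕ} (z : Fin n → Pt) (ε : Fin n → Root) (γ : Finset Pt) (s t : Fin n) where
  /-- the number of full edges on the path -/
  len : ℕ
  edge : Fin (len + 2) → Pt
  dir : Fin (len + 2) → Dir
  edge_zero : edge 0 = z s
  dir_zero : dir 0 = (ε s).dir
  edge_last : edge (Fin.last _) = z t
  dir_last : dir (Fin.last _) = (ε t).dir + 2
  step : ∀ i : Fin (len + 1),
    edge i.succ = edge i.castSucc + halfStep (dir i.castSucc) + halfStep (dir i.succ)
  inner : ∀ i, i ≠ 0 → i ≠ Fin.last _ → edge i ∈ γ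
  simple : Function.Injective edge
  noStraight : ∀ i : Fin (len + 1),
    degAt z ε γ (edge i.castSucc + halfStep (dir i.castSucc)) = 4 → dir i.succ ≠ dir i.castSucc

/-- The winding (total turning angle) of a path. -/
def Strand.winding {n : ℕ} {z : Fin n → Pt} {ε : Fin n → Root} {γ : Finset Pt} {s t : Fin n}
    (π : Strand z ε γ s t) : ℝ :=
  Real.pi / 2 * ((∑ i : Fin (π.len + 1), turn (π.dir i.castSucc) (π.dir i.succ) : ℤ) : ℝ)

/-- A choice of `m` edge-disjoint paths in the configuration `γ` that link the points
`z_1, …, z_{2m}` pairwise, each oriented from the smaller to the greater index. -/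
structure PathSystem {m : ℕ} (z : Fin (2 * m) → Pt) (ε : Fin (2 * m) → Root) (γ : Finset Pt)
    where
  s : Fin m → Fin (2 * m)
  d : Fin m → Fin (2 * m)
  lt : ∀ j, s j < d j
  pairing : Function.Bijective (Sum.elim s d)
  path : ∀ j, Strand z ε γ (s j) (d j)
  disjoint : ∀ j k, j ≠ k → Disjoint (Set.range (path j).edge) (Set.range (path k).edge)

/-- The number of crossings of the pair partition `{{s_j, d_j}}` of the indices. -/
def PathSystem.crossings {m : ℕ} {z : Fin (2 * m) → Pt} {ε : Fin (2 * m) → Root}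
    {γ : Finset Pt} (P : PathSystem z ε γ) : ℕ :=
  (Finset.univ.filter fun x : Fin m × Fin m =>
    P.s x.1 < P.s x.2 ∧ P.s x.2 < P.d x.1 ∧ P.d x.1 < P.d x.2).card

/-- `(-1) ^ #crossings * ∏ (ε_{d_j} / ε_{s_j}) exp (- i W(π_j) / 2)`. -/
def PathSystem.phase {m : ℕ} {z : Fin (2 * m) → Pt} {ε : Fin (2 * m) → Root}
    {γ : Finset Pt} (P : PathSystem z ε γ) : ℂ :=
  (-1) ^ P.crossings *
    ∏ j, (ε (P.d j)).val / (ε (P.s j)).val *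
      Complex.exp (-(Complex.I / 2) * ((P.path j).winding : ℂ))

open Classical in
/-- The phase of a configuration: that of an arbitrary choice of paths. -/
def phaseOf {m : ℕ} (z : Fin (2 * m) → Pt) (ε : Fin (2 * m) → Root) (γ : Finset Pt) : ℂ :=
  if h : Nonempty (PathSystem z ε γ) then h.some.phase else 0

/-- The low-temperature partition function `∑ α ^ |ω|` over collections of loops `ω`. -/
def loopPartition (F : Finset Pt) (α : ℝ) : ℝ :=
  ∑ ω ∈ contours F (Fin.elim0 : Fin 0 → Pt) Fin.elim0, α ^ ω.card

/-- The multipoint parafermionic observable `f^ε(z_1, …, z_{2m})` of the domain with set of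
faces `F`. The length of a configuration is its number of full dual edges plus `m`. -/
def observable (F : Finset Pt) (α : ℝ) {m : ℕ} (z : Fin (2 * m) → Pt)
    (ε : Fin (2 * m) → Root) : ℂ :=
  (∑ γ ∈ contours F z ε, (α : ℂ) ^ (γ.card + m) * phaseOf z ε γ) / (loopPartition F α : ℂ)

/-- The faces of the box `{a, …, b} × {0, …, N}`, in doubled coordinates. -/
def boxFaces (a b : ℤ) (N : ℕ) : Finset Pt :=
  (Finset.Ico a b ×ˢ Finset.Ico (0 : ℤ) N).image fun x => (2 * x.1 + 1, 2 * x.2 + 1)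

/-- The midpoint of a horizontal edge of the box, in doubled coordinates. -/
def HEdge.pt {a b : ℤ} {N : ℕ} (z : HEdge a b N) : Pt :=
  (2 * (z.1 : ℤ) + 1, 2 * ((z.2 : ℕ) : ℤ))

/-- The points `z_1, …, z_{2m}` in doubled coordinates. -/
abbrev pts {a b : ℤ} {N n : ℕ} (z : Fin n → HEdge a b N) : Fin n → Pt := fun j => (z j).pt

/-- The square roots `ε_1, …, ε_{2m}` that belong to a family of arrows. -/
abbrev roots {n : ℕ} (arr : Fin n → Arrow) : Fin n → Root := fun j => arrowRoot (arr j)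

end IsingFermion

end

open IsingFermion

noncomputable section

namespace IsingFermion

/-! Both sides are rewritten as one sum over contour configurations, with a sign that refers neither
to paths nor to a time-ordering.

The sign of a configuration. Its edges are cut into darts, and the boundary of this set of darts
modulo two consists of the marked points. `signExp` adds the inversions of the marked points,
ordered by height and then from right to left, to the crossings of the darts with the rays that run
from the marked points to the right. The central claim is `PathSystem.phase_eq`: for every choice of
paths, the phase is `sgn` of this exponent times `I ^ m` and the signs of the arrows. For the proof
a starting point slides along its strand and the darts behind it are erased. By `Config.step`, each
step changes the exponent by a term in the two erased darts and by interactions `ell` with the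
remaining ones. The interactions vanish unless two darts share a face or form one edge
(`ell_eq_zero`), and at a face the even degree and the rule against going straight make them cancel
(`sum_tab`). What is left depends on directions only, and it reproduces the half-angle of the turn
(`sgn_base_mul`). Once every starting point has reached its end point, the rays cancel in pairs and
the inversions count crossings of the pairing (`PathSystem.keyInv_eq_crossings`). Paths exist
because the darts carry two involutions, one pairing them at faces and one along edges; alternating
them traces the strands (`nonempty_pathSystem`).

The correlation. The time evolutions telescope (`pow_mul_timeProd`), and the numerator becomes a sum
over histories of row configurations. The fermion of an arrow flips the spins to its left, projects
onto equal (`up`) or opposite (`down`) neighbouring spins, and contributes a constant times the spin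
to its right (`arrowRow_apply`). The domain walls of a history form a contour configuration with
half a dual edge at each insertion, and every configuration arises once (`valid_histOf`,
`histOf_injOn`, `histOf_contourOf`). Each dart costs `Real.exp (-β)`. As the right end of the row is
plus, the spin next to an insertion is the parity of the crossings with its ray (`sgnU_sum_ray`),
while the sign of the permutation and the order within rows give the inversions
(`sign_mul_prod_ties`). The constants `lam⁻¹` multiply to `(-I) ^ m` against `I ^ m` in the phase,
whence the sign `(-1) ^ m`. -/

open Finset

/-! ### Darts, their local interactions and the sign exponent -/

/-- A half of a dual edge: a face together with a direction. -/
abbrev Dart : Type := Pt × Dir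

/-- The outer end of a dart. -/
def mid (x : Dart) : Pt := x.1 + halfStep x.2

/-- The other half of the dual edge that contains a dart. -/
def opp (x : Dart) : Dart := (x.1 + halfStep x.2 + halfStep x.2, x.2 + 2)

/-- The indicator, modulo two, of the lexicographic comparison of points by height and then
from right to left. -/
def key (q r : Pt) : ZMod 2 := if q.2 < r.2 ∨ (q.2 = r.2 ∧ r.1 < q.1) then 1 else 0

/-- The number of crossings of a dart with the ray that starts at `q` and runs to the right,
infinitesimally tilted upwards. -/
def ray (q : Pt) (x : Dart) : ZMod 2 :=
  if q.1 < x.1.1 ∧ (x.2 = 1 ∧ x.1.2 = q.2 ∨ x.2 = 3 ∧ x.1.2 = q.2 + 1) then 1 else 0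

/-- The interaction of two darts. -/
def ell (y x : Dart) : ZMod 2 :=
  (key y.1 x.1 + key y.1 (mid x) + ray y.1 x) +
    (key (mid y) x.1 + key (mid y) (mid x) + ray (mid y) x) + (ray x.1 y + ray (mid x) y)

/-- The crossings of a dart with the ray to the left of `v`. -/
def leftRay (v : Pt) (x : Dart) : ZMod 2 :=
  if (x.2 = 0 ∧ v = mid x) ∨ (x.2 = 1 ∧ (v = x.1 ∨ v.2 = x.1.2 + 1 ∧ x.1.1 < v.1)) ∨
    (x.2 = 2 ∧ v = x.1) ∨ (x.2 = 3 ∧ (v = mid x ∨ v.2 = x.1.2 ∧ x.1.1 < v.1)) then 1 else 0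

/-- `key v` records on which side of the slightly tilted line through `v` a point lies, so its
values at the two ends of a dart differ when the dart crosses that line. Removing the right half of
the line leaves the left half. -/
lemma key_add_key_add_ray (v : Pt) (x : Dart) :
    key v x.1 + key v (mid x) + ray v x = leftRay v x := by
  obtain ⟨v1, v2⟩ := v
  obtain ⟨⟨p1, p2⟩, d⟩ := x
  fin_cases d <;> simp [key, ray, leftRay, mid, halfStep] <;> split_ifs <;>
    first | omega | rfl

lemma ell_eq (y x : Dart) :
    ell y x = leftRay y.1 x + leftRay (mid y) x + (ray x.1 y + ray (mid x) y) := by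
  rw [ell, key_add_key_add_ray, key_add_key_add_ray]

/-- The interaction of two distinct darts of the same face. -/
def tab : Dir → Dir → ZMod 2 :=
  ![![1, 1, 1, 1], ![0, 1, 0, 0], ![0, 1, 1, 0], ![0, 1, 1, 1]]

/-- The interaction of the two halves of an edge. -/
def tOpp : Dir → ZMod 2 := ![1, 0, 0, 1]

lemma ell_same (p : Pt) (e d : Dir) : ell (p, e) (p, d) = tab e d := by
  obtain ⟨p1, p2⟩ := p
  have h11 : (1 : ZMod 2) + 1 = 0 := rfl
  rw [ell_eq]
  fin_cases d <;> fin_cases e <;> simp [leftRay, ray, mid, halfStep, tab, h11]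

lemma ell_opp (x : Dart) : ell (opp x) x = tOpp x.2 := by
  obtain ⟨⟨p1, p2⟩, d⟩ := x
  rw [ell_eq]
  fin_cases d <;> simp [leftRay, ray, mid, opp, halfStep, tOpp] <;> omega

/-- Sweep `y` to the left. The crossings of `x` with the boundary of the swept strip, that is with
`y` and the left rays of its ends, have the parity of the number of ends of `x` inside the strip,
that is of right rays from these ends that meet `y`. Here `x` and `y` are disjoint, so the two kinds
of ray crossings cancel. -/
lemma ell_eq_zero {y x : Dart} (hy : Odd y.1.1 ∧ Odd y.1.2) (hx : Odd x.1.1 ∧ Odd x.1.2)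
    (h : y.1 ≠ x.1) (ho : y ≠ opp x) : ell y x = 0 := by
  obtain ⟨⟨y1, y2⟩, e⟩ := y
  obtain ⟨⟨x1, x2⟩, d⟩ := x
  obtain ⟨⟨r, hr⟩, ⟨s, hs⟩⟩ := hy
  obtain ⟨⟨r', hr'⟩, ⟨s', hs'⟩⟩ := hx
  have h11 : (1 : ZMod 2) + 1 = 0 := rfl
  rw [ell_eq]
  simp only at hr hs hr' hs'
  subst hr hs hr' hs'
  fin_cases d <;> fin_cases e <;>
    simp [leftRay, ray, mid, opp, halfStep] at h ho ⊢ <;>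
    (try split_ifs) <;> first | omega | simp [h11]

/-- A set of darts whose boundary, modulo two, consists of the points `z j`. -/
structure Config {n : ℕ} (D : Finset Dart) (z : Fin n → Pt) : Prop where
  odd : ∀ x ∈ D, Odd x.1.1 ∧ Odd x.1.2
  even : ∀ p : Pt, Even (univ.filter fun d : Dir => (p, d) ∈ D).card
  chain : ∀ f : Pt → ZMod 2, ∑ x ∈ D, (f x.1 + f (mid x)) = ∑ j, f (z j)

/-- The number of pairs of points whose order is not that of the keys. -/
def keyInv {n : ℕ} (z : Fin n → Pt) : ZMod 2 :=
  ∑ i, ∑ j, if i < j then key (z j) (z i) else 0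

/-- The exponent of the sign of a configuration. -/
def signExp {n : ℕ} (D : Finset Dart) (z : Fin n → Pt) : ZMod 2 :=
  keyInv z + ∑ j, ∑ x ∈ D, ray (z j) x

lemma zmod_two_add_self (a : ZMod 2) : a + a = 0 := CharTwo.add_self_eq_zero a

lemma key_self (q : Pt) : key q q = 0 := by simp [key]

lemma key_add_key {q r : Pt} (h : q ≠ r) : key q r + key r q = 1 := by
  obtain ⟨a, b⟩ := q
  obtain ⟨c, d⟩ := r
  simp only [ne_eq, Prod.mk.injEq] at h
  simp only [key]
  split_ifs <;> first | omega | rfl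

lemma sum_sum_eq_cross {n : ℕ} (s : Fin n) (f : Fin n → Fin n → ZMod 2)
    (h : ∀ i j, i ≠ s → j ≠ s → f i j = 0) (hs : f s s = 0) :
    ∑ i, ∑ j, f i j = ∑ j, (f s j + f j s) := by
  rw [Finset.sum_add_distrib, ← Finset.add_sum_erase univ _ (mem_univ s),
    ← Finset.add_sum_erase univ (fun j => f j s) (mem_univ s), hs, zero_add]
  congr 1
  refine Finset.sum_congr rfl fun i hi => ?_
  rw [← Finset.add_sum_erase univ _ (mem_univ s)]
  rw [Finset.sum_eq_zero, add_zero]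
  intro j hj
  exact h i j (Finset.ne_of_mem_erase hi) (Finset.ne_of_mem_erase hj)

/-- For `j < s` the arguments of `key` occur in the other order, and two uses of `key_add_key`
restore it; this needs distinct points. Points of larger index may coincide with `q`, which lets a
strand be contracted onto its end point. The last term compensates for the summand `j = s`. -/
lemma keyInv_update {n : ℕ} (z : Fin n → Pt) (s : Fin n) (q : Pt)
    (hlt : ∀ j < s, z j ≠ z s ∧ z j ≠ q) :
    keyInv z = keyInv (Function.update z s q) +
      ∑ j, (key (Function.update z s q j) (z s) + key (Function.update z s q j) q) +
      key q (z s) := by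
  have key1 : keyInv z + keyInv (Function.update z s q) =
      ∑ j, if j = s then 0 else key (z j) (z s) + key (z j) q := by
    rw [keyInv, keyInv, ← Finset.sum_add_distrib]
    simp_rw [← Finset.sum_add_distrib]
    rw [sum_sum_eq_cross s]
    · refine Finset.sum_congr rfl fun j _ => ?_
      by_cases hj : j = s
      · subst hj; simp
      · rw [if_neg hj]
        rcases lt_or_gt_of_ne hj with h | h
        · have e1 := key_add_key (hlt j h).1
          have e2 := key_add_key (hlt j h).2
          simp only [h, h.not_gt, if_true, if_false, Function.update_self, ne_eq, hj,
            not_false_eq_true, Function.update_of_ne]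
          rw [← sub_eq_zero] at e1 e2 ⊢
          have h2 : (2 : ZMod 2) = 0 := rfl
          linear_combination e1 + e2 + h2 - (key (z j) (z s) + key (z j) q) * h2
        · simp only [h, h.not_gt, if_true, if_false, Function.update_self, ne_eq, hj,
            not_false_eq_true, Function.update_of_ne]
          ring
    · intro i j hi hj
      simp [Function.update_of_ne hi, Function.update_of_ne hj, zmod_two_add_self]
    · simp
  have key2 : ∑ j, (key (Function.update z s q j) (z s) + key (Function.update z s q j) q) =
      (∑ j, if j = s then 0 else key (z j) (z s) + key (z j) q) + key q (z s) := by
    rw [← Finset.add_sum_erase univ _ (mem_univ s),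
      ← Finset.add_sum_erase univ (fun j => if j = s then 0 else _) (mem_univ s)]
    simp only [Function.update_self, key_self, if_true, zero_add, add_zero]
    rw [add_comm]
    congr 1
    refine Finset.sum_congr rfl fun j hj => ?_
    have := Finset.ne_of_mem_erase hj
    simp [this]
  rw [key2, ← key1]
  have h2 : (2 : ZMod 2) = 0 := rfl
  linear_combination -(keyInv (Function.update z s q) + key q (z s)) * h2

lemma sum_update {n : ℕ} (z : Fin n → Pt) (s : Fin n) (q : Pt) (f : Pt → ZMod 2) :
    ∑ j, f (z j) = ∑ j, f (Function.update z s q j) + f (z s) + f q := by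
  rw [← Finset.add_sum_erase univ _ (mem_univ s),
    ← Finset.add_sum_erase univ (fun j => f (Function.update z s q j)) (mem_univ s)]
  have : ∑ j ∈ univ.erase s, f (Function.update z s q j) = ∑ j ∈ univ.erase s, f (z j) :=
    Finset.sum_congr rfl fun j hj => by rw [Function.update_of_ne (Finset.ne_of_mem_erase hj)]
  rw [this, Function.update_self]
  have h2 : (2 : ZMod 2) = 0 := rfl
  linear_combination - f q * h2

/-! ### Contraction of a strand, face by face -/

/-- The local contribution of the two darts that are removed in a step. -/
def base : Dir → Dir → ZMod 2 := fun d e =>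
  key (0 + halfStep e) (0 + halfStep d) +
    (ray (0 + halfStep d) (0, d) + ray (0 + halfStep d) (0, e) + ray (0 + halfStep e) (0, d) +
      ray (0 + halfStep e) (0, e))

lemma key_translate (p q r : Pt) : key (p + q) (p + r) = key q r := by
  simp [key]

lemma ray_translate (p q r : Pt) (d : Dir) : ray (p + q) (p + r, d) = ray q (r, d) := by
  simp [ray, add_assoc]

lemma base_eq (p : Pt) (d e : Dir) :
    base d e = key (mid (p, e)) (mid (p, d)) +
      (ray (mid (p, d)) (p, d) + ray (mid (p, d)) (p, e) + ray (mid (p, e)) (p, d) +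
        ray (mid (p, e)) (p, e)) := by
  have h : ∀ d' : Dir, ((p, d') : Dart) = (p + 0, d') := by simp
  have hm : ∀ d' : Dir, mid (p, d') = p + (0 + halfStep d') := by simp [mid]
  rw [hm, hm, h d, h e]
  simp only [key_translate, ray_translate, base]

/-- Other directions are present only if all four are. Two turning strands touch without crossing
and their interactions cancel; two straight strands would give `1`, hence the last hypothesis. -/
lemma sum_tab (X : Finset Dir) (d e : Dir) (hX : Even X.card) (hd : d ∈ X) (he : e ∈ X)
    (hde : d ≠ e) (hX' : X = univ → e ≠ d + 2) :
    ∑ c ∈ (X.erase d).erase e, (tab c d + tab c e) = 0 := by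
  revert X d e
  decide

lemma sum_ell {D : Finset Dart} (hD : ∀ x ∈ D, Odd x.1.1 ∧ Odd x.1.2) (x : Dart)
    (hx : Odd x.1.1 ∧ Odd x.1.2) :
    ∑ y ∈ D, ell y x = ∑ c ∈ univ.filter (fun c : Dir => (x.1, c) ∈ D), tab c x.2 +
      if opp x ∈ D then tOpp x.2 else 0 := by
  have hne : (opp x).1 ≠ x.1 := by
    obtain ⟨⟨p1, p2⟩, d⟩ := x
    fin_cases d <;> simp [opp, halfStep] <;> omega
  have h1 : ∑ y ∈ D, ell y x = ∑ y ∈ D, ((if y.1 = x.1 then tab y.2 x.2 else 0) +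
      if y = opp x then tOpp x.2 else 0) := by
    refine Finset.sum_congr rfl fun y hy => ?_
    by_cases hyx : y.1 = x.1
    · have hy' : y ≠ opp x := fun h => hne (h ▸ hyx)
      rw [if_pos hyx, if_neg hy', add_zero, ← ell_same x.1, ← hyx]
      congr 1
      rw [hyx]
    · rw [if_neg hyx, zero_add]
      by_cases ho : y = opp x
      · rw [if_pos ho, ho, ell_opp]
      · rw [if_neg ho, ell_eq_zero (hD y hy) hx hyx ho]
  rw [h1, Finset.sum_add_distrib, Finset.sum_ite_eq', ← Finset.sum_filter]
  congr 1
  refine Finset.sum_bij' (fun y _ => y.2) (fun c _ => (x.1, c)) ?_ ?_ ?_ ?_ ?_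
  · rintro ⟨p, c⟩ h
    simp only [mem_filter] at h
    simpa [← h.2] using h.1
  · intro c h
    simpa using h
  · rintro ⟨p, c⟩ h
    simp only [mem_filter] at h
    simp [h.2]
  · simp
  · simp

lemma sum_erase_erase {D : Finset Dart} {x y : Dart} (hx : x ∈ D) (hy : y ∈ D) (hxy : x ≠ y)
    {M : Type*} [AddCommMonoid M] (f : Dart → M) :
    ∑ w ∈ D, f w = f x + (f y + ∑ w ∈ (D.erase x).erase y, f w) := by
  rw [Finset.add_sum_erase _ _ (Finset.mem_erase.mpr ⟨hxy.symm, hy⟩), Finset.add_sum_erase _ _ hx]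

lemma mid_opp (x : Dart) : mid (opp x) = mid x := by
  obtain ⟨⟨p1, p2⟩, d⟩ := x
  fin_cases d <;> simp [mid, opp, halfStep]

lemma opp_opp (x : Dart) : opp (opp x) = x := by
  obtain ⟨⟨p1, p2⟩, d⟩ := x
  fin_cases d <;> simp [opp, halfStep]

/-- The two darts interact with each other and with the moving point (`base`), with the other marked
points, and with the remaining darts. Through `Config.chain` the marked points are replaced by the
darts that they bound, and only the local interactions `ell` survive. -/
theorem Config.step {n : ℕ} {D : Finset Dart} {z : Fin n → Pt} (hC : Config D z) (s : Fin n)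
    (p : Pt) (d e : Dir) (hd : (p, d) ∈ D) (he : (p, e) ∈ D) (hde : d ≠ e)
    (hs : z s = mid (p, d)) (hlt : ∀ j < s, z j ≠ mid (p, d) ∧ z j ≠ mid (p, e))
    (hns : (∀ c, (p, c) ∈ D) → e ≠ d + 2) (hopp : opp (p, d) ∉ D) :
    Config ((D.erase (p, d)).erase (p, e)) (Function.update z s (mid (p, e))) ∧
      signExp D z =
        signExp ((D.erase (p, d)).erase (p, e)) (Function.update z s (mid (p, e))) +
          (base d e + if opp (p, e) ∈ D then tOpp e else 0) := by
  have h2 : (2 : ZMod 2) = 0 := rfl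
  have hne : ((p, d) : Dart) ≠ (p, e) := by simpa using hde
  set D' := (D.erase (p, d)).erase (p, e) with hD'
  set z' := Function.update z s (mid (p, e)) with hz'
  have hodd : ∀ x ∈ D', Odd x.1.1 ∧ Odd x.1.2 := fun x hx =>
    hC.odd x (Finset.mem_of_mem_erase (Finset.mem_of_mem_erase hx))
  have hfilter : univ.filter (fun c : Dir => (p, c) ∈ D') =
      ((univ.filter (fun c : Dir => (p, c) ∈ D)).erase d).erase e := by
    ext c
    simp [hD']
  have hdX : d ∈ univ.filter (fun c : Dir => (p, c) ∈ D) := by simpa using hd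
  have heX : e ∈ univ.filter (fun c : Dir => (p, c) ∈ D) := by simpa using he
  have hchain : ∀ f : Pt → ZMod 2, ∑ x ∈ D', (f x.1 + f (mid x)) = ∑ j, f (z' j) := by
    intro f
    have := hC.chain f
    rw [sum_erase_erase hd he hne, sum_update z s (mid (p, e)), hs] at this
    linear_combination this - f p * h2
  have hC' : Config D' z' := by
    refine ⟨hodd, fun q => ?_, hchain⟩
    by_cases hq : q = p
    · subst hq
      rw [hfilter, Finset.card_erase_of_mem (Finset.mem_erase.mpr ⟨hde.symm, heX⟩),
        Finset.card_erase_of_mem hdX]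
      obtain ⟨r, hr⟩ := hC.even q
      exact ⟨r - 1, by omega⟩
    · have : univ.filter (fun c : Dir => (q, c) ∈ D') =
          univ.filter (fun c : Dir => (q, c) ∈ D) := by
        ext c
        simp [hD', hq]
      rw [this]
      exact hC.even q
  refine ⟨hC', ?_⟩
  have hK := keyInv_update z s (mid (p, e)) (by rw [hs]; exact hlt)
  have hR : ∑ j, ∑ x ∈ D, ray (z j) x = ∑ j, ∑ x ∈ D', ray (z' j) x +
      ∑ y ∈ D', (ray (mid (p, d)) y + ray (mid (p, e)) y) +
      ∑ j, (ray (z' j) (p, d) + ray (z' j) (p, e)) +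
      (ray (mid (p, d)) (p, d) + ray (mid (p, d)) (p, e) + ray (mid (p, e)) (p, d) +
        ray (mid (p, e)) (p, e)) := by
    have e1 : ∀ j, ∑ x ∈ D, ray (z j) x =
        (ray (z j) (p, d) + ray (z j) (p, e)) + ∑ x ∈ D', ray (z j) x := by
      intro j
      rw [sum_erase_erase hd he hne]
      ring
    simp_rw [e1]
    rw [sum_update z s (mid (p, e))
      (fun v => (ray v (p, d) + ray v (p, e)) + ∑ x ∈ D', ray v x), hs]
    simp only [Finset.sum_add_distrib]
    ring
  have hT : ∑ j, (key (z' j) (mid (p, d)) + key (z' j) (mid (p, e))) +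
      ∑ j, (ray (z' j) (p, d) + ray (z' j) (p, e)) +
      ∑ y ∈ D', (ray (mid (p, d)) y + ray (mid (p, e)) y) =
      ∑ y ∈ D', ell y (p, d) + ∑ y ∈ D', ell y (p, e) := by
    rw [← Finset.sum_add_distrib, ← Finset.sum_add_distrib]
    -- The test function collects the terms of `ell` that see one end `v` of `y`; `key v p` occurs
    -- for both erased darts and drops out.
    rw [← hchain (fun v => key v (mid (p, d)) + key v (mid (p, e)) +
      (ray v (p, d) + ray v (p, e))), ← Finset.sum_add_distrib]
    refine Finset.sum_congr rfl fun y _ => ?_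
    simp only [ell]
    linear_combination -(key y.1 p + key (mid y) p + ray p y) * h2
  have hp := hC.odd _ hd
  have ho1 : opp (p, d) ∉ D' := fun h =>
    hopp (Finset.mem_of_mem_erase (Finset.mem_of_mem_erase h))
  have ho2 : opp (p, e) ∈ D' ↔ opp (p, e) ∈ D := by
    have hne' : ∀ c, opp (p, e) ≠ (p, c) := by
      intro c h
      have := congrArg Prod.fst h
      obtain ⟨p1, p2⟩ := p
      fin_cases e <;> simp [opp, halfStep] at this <;> omega
    simp [hD', hne']
  have hL : ∑ y ∈ D', ell y (p, d) + ∑ y ∈ D', ell y (p, e) =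
      if opp (p, e) ∈ D then tOpp e else 0 := by
    rw [sum_ell hodd (p, d) hp, sum_ell hodd (p, e) hp, if_neg ho1, add_zero, ← add_assoc,
      ← Finset.sum_add_distrib]
    simp only [hfilter]
    rw [sum_tab _ d e (hC.even p) hdX heX hde, zero_add]
    · simp only [ho2]
    · intro h
      refine hns fun c => ?_
      have : c ∈ univ.filter (fun c : Dir => (p, c) ∈ D) := by rw [h]; exact mem_univ c
      simpa using this
  rw [signExp, signExp, hK, hR, base_eq p, hs]
  rw [hs] at hK
  linear_combination hT + hL

/-- The sign that belongs to a residue modulo two. -/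
def sgn (x : ZMod 2) : ℂ := if x = 0 then 1 else -1

lemma sgn_add (x y : ZMod 2) : sgn (x + y) = sgn x * sgn y := by
  have : ∀ x : ZMod 2, x = 0 ∨ x = 1 := by decide
  have h11 : (1 : ZMod 2) + 1 = 0 := rfl
  rcases this x with rfl | rfl <;> rcases this y with rfl | rfl <;> simp [sgn, h11]

lemma sgn_mul_self (x : ZMod 2) : sgn x * sgn x = 1 := by
  rw [← sgn_add, zmod_two_add_self, sgn, if_pos rfl]

lemma lam_ne_zero : lam ≠ 0 := Complex.exp_ne_zero _

lemma lam_pow_four : lam ^ 4 = -1 := by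
  have : lam ^ 4 = (lam ^ 2) ^ 2 := by ring
  rw [this, lam_sq, Complex.I_sq]

/-- A choice of square roots of the directions. -/
def phi : Dir → ℂ := ![1, -lam, -lam ^ 2, -lam ^ 3]

/-- `phi d` is a square root of `I ^ d`, so a quarter turn multiplies it by `lam` or its inverse up
to a sign. The sign picked up at the face is exactly the one that keeps to the chosen branch. -/
lemma sgn_base_mul (d e : Dir) (h : e ≠ d + 2) :
    sgn (base (d + 2) e + tOpp e) * lam ^ (turn d e) * phi d = phi e := by
  have h4 := lam_pow_four
  have h0 := lam_ne_zero
  have h11 : (1 : ZMod 2) + 1 = 0 := rfl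
  fin_cases d <;> fin_cases e <;> first | (exfalso; revert h; decide) |
    (simp [sgn, base, key, ray, halfStep, tOpp, turn, phi, h11] <;> field_simp <;>
      first | rfl | linear_combination h4 | linear_combination -h4)

lemma halfStep_add_two (d : Dir) : halfStep (d + 2) = -halfStep d := by
  fin_cases d <;> simp [halfStep]

lemma mid_arrive (q : Pt) (d : Dir) : mid (q + halfStep d, d + 2) = q := by
  simp [mid, halfStep_add_two]

lemma add_two_add_two (d : Dir) : d + 2 + 2 = d := by
  revert d; decide

/-- Induction on the number of full edges, with one `Config.step` per face: the strand enters
through the dart of direction `dr i + 2` and leaves through that of direction `dr (i + 1)`. The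
identities `sgn_base_mul` telescope. At the last face the opposite dart is missing, so a factor
`tOpp` is left on the right-hand side. -/
theorem Config.contract {n : ℕ} (s t : Fin n) (hst : s < t) :
    ∀ (len : ℕ) (e : ℕ → Pt) (dr : ℕ → Dir) (D : Finset Dart) (z : Fin n → Pt), Config D z →
    z s = e 0 → z t = e (len + 1) →
    (∀ j, j ≠ s → j ≠ t → ∀ i ≤ len + 1, z j ≠ e i) →
    (∀ i ≤ len, e (i + 1) = e i + halfStep (dr i) + halfStep (dr (i + 1))) →
    (∀ i ≤ len + 1, ∀ j ≤ len + 1, e i = e j → i = j) →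
    (∀ i ≤ len, (e i + halfStep (dr i), dr i + 2) ∈ D) →
    (∀ i ≤ len, (e i + halfStep (dr i), dr (i + 1)) ∈ D) →
    opp (e 0 + halfStep (dr 0), dr 0 + 2) ∉ D →
    opp (e len + halfStep (dr len), dr (len + 1)) ∉ D →
    (∀ i ≤ len, (∀ c, (e i + halfStep (dr i), c) ∈ D) → dr (i + 1) ≠ dr i) →
    ∃ D' ⊆ D, Config D' (Function.update z s (z t)) ∧
      (∀ x ∈ D, (∀ i ≤ len + 1, mid x ≠ e i) → x ∈ D') ∧
      sgn (signExp D z) * lam ^ (∑ i ∈ range (len + 1), turn (dr i) (dr (i + 1))) * phi (dr 0) =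
        sgn (signExp D' (Function.update z s (z t))) *
          (sgn (tOpp (dr (len + 1))) * phi (dr (len + 1))) := by
  intro len
  induction len with
  | zero =>
    intro e dr D z hC hs ht hz hstep hinj hin hout hfirst hlast hns
    have hm0 := mid_arrive (e 0) (dr 0)
    have hm1 : mid (e 0 + halfStep (dr 0), dr 1) = e 1 := (hstep 0 le_rfl).symm
    have hback : dr 0 + 2 ≠ dr 1 := by
      intro h
      rw [← h, hm0] at hm1
      have := hinj 0 (by omega) 1 (by omega) hm1
      omega
    obtain ⟨hC', hE⟩ := hC.step s (e 0 + halfStep (dr 0)) (dr 0 + 2) (dr 1) (hin 0 le_rfl)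
      (hout 0 le_rfl) hback (by rw [hm0, hs]) (by
        intro j hj
        rw [hm0, hm1]
        have h1 : j ≠ s := hj.ne
        have h2 : j ≠ t := (hj.trans hst).ne
        exact ⟨hz j h1 h2 0 (by omega), hz j h1 h2 1 (by omega)⟩)
      (by rw [add_two_add_two]; exact hns 0 le_rfl) hfirst
    rw [hm1] at hC' hE
    rw [zero_add] at ht
    refine ⟨_, (Finset.erase_subset _ _).trans (Finset.erase_subset _ _), ht ▸ hC', ?_, ?_⟩
    · intro x hx h
      refine Finset.mem_erase.mpr ⟨?_, Finset.mem_erase.mpr ⟨?_, hx⟩⟩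
      · rintro rfl
        exact h 1 (by omega) hm1
      · rintro rfl
        exact h 0 (by omega) hm0
    · rw [hE, ht, if_neg hlast, add_zero]
      have h := sgn_base_mul (dr 0) (dr 1) (fun h => hback h.symm)
      rw [sgn_add] at h
      simp only [zero_add, range_one, sum_singleton, sgn_add]
      have h1 := sgn_mul_self (tOpp (dr 1))
      linear_combination sgn (signExp
        ((D.erase (e 0 + halfStep (dr 0), dr 0 + 2)).erase (e 0 + halfStep (dr 0), dr 1))
        (Function.update z s (e 1))) * (sgn (tOpp (dr 1)) * h - sgn (base (dr 0 + 2) (dr 1)) *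
          lam ^ turn (dr 0) (dr 1) * phi (dr 0) * h1)
  | succ len ih =>
    intro e dr D z hC hs ht hz hstep hinj hin hout hfirst hlast hns
    have hm0 := mid_arrive (e 0) (dr 0)
    have hm1 : mid (e 0 + halfStep (dr 0), dr 1) = e 1 := (hstep 0 (by omega)).symm
    have hback : dr 0 + 2 ≠ dr 1 := by
      intro h
      rw [← h, hm0] at hm1
      have := hinj 0 (by omega) 1 (by omega) hm1
      omega
    obtain ⟨hC', hE⟩ := hC.step s (e 0 + halfStep (dr 0)) (dr 0 + 2) (dr 1) (hin 0 (by omega))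
      (hout 0 (by omega)) hback (by rw [hm0, hs]) (by
        intro j hj
        rw [hm0, hm1]
        have h1 : j ≠ s := hj.ne
        have h2 : j ≠ t := (hj.trans hst).ne
        exact ⟨hz j h1 h2 0 (by omega), hz j h1 h2 1 (by omega)⟩)
      (by rw [add_two_add_two]; exact hns 0 (by omega)) hfirst
    rw [hm1] at hC' hE
    have hopp : opp (e 0 + halfStep (dr 0), dr 1) = (e 1 + halfStep (dr 1), dr 1 + 2) := by
      rw [← hm1]; rfl
    have hoppD : opp (e 0 + halfStep (dr 0), dr 1) ∈ D := by
      rw [hopp]; exact hin 1 (by omega)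
    set D' := (D.erase (e 0 + halfStep (dr 0), dr 0 + 2)).erase (e 0 + halfStep (dr 0), dr 1)
      with hD'
    have hsub : D' ⊆ D := (Finset.erase_subset _ _).trans (Finset.erase_subset _ _)
    have hmem : ∀ x ∈ D, mid x ≠ e 0 → mid x ≠ e 1 → x ∈ D' := by
      intro x hx h0 h1
      refine Finset.mem_erase.mpr ⟨?_, Finset.mem_erase.mpr ⟨?_, hx⟩⟩
      · rintro rfl
        exact h1 hm1
      · rintro rfl
        exact h0 hm0
    have hts : t ≠ s := hst.ne'
    obtain ⟨D'', hD'', hC'', hmem'', hE''⟩ := ih (fun i => e (i + 1)) (fun i => dr (i + 1)) D'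
      (Function.update z s (e 1)) hC' (by simp) (by simpa [Function.update_of_ne hts] using ht)
      (by
        intro j hj hjt i hi
        rw [Function.update_of_ne hj]
        exact hz j hj hjt _ (by omega))
      (fun i hi => hstep (i + 1) (by omega))
      (fun i hi j hj h => by
        have := hinj (i + 1) (by omega) (j + 1) (by omega) h
        omega)
      (by
        intro i hi
        have hm := mid_arrive (e (i + 1)) (dr (i + 1))
        rcases Nat.eq_zero_or_pos i with rfl | hpos
        · refine Finset.mem_erase.mpr ⟨?_, Finset.mem_erase.mpr ⟨?_, hin 1 (by omega)⟩⟩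
          · rw [zero_add, ← hopp]
            intro h
            have h := congrArg Prod.snd h
            simp only [opp] at h
            generalize dr 1 = c at h
            revert h; revert c; decide
          · intro h
            rw [h] at hm
            have := hinj _ (by omega) _ (by omega) (hm.symm.trans hm0)
            omega
        · refine hmem _ (hin (i + 1) (by omega)) ?_ ?_ <;> rw [hm] <;> intro h <;>
            have := hinj _ (by omega) _ (by omega) h <;> omega)
      (by
        intro i hi
        have hm : mid (e (i + 1) + halfStep (dr (i + 1)), dr (i + 2)) = e (i + 2) :=
          (hstep (i + 1) (by omega)).symm
        refine hmem _ (hout (i + 1) (by omega)) ?_ ?_ <;> rw [hm] <;> intro h <;>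
          have := hinj _ (by omega) _ (by omega) h <;> omega)
      (by
        -- The opposite half of the first dart of the tail has just been erased.
        rw [zero_add, ← hopp, opp_opp]
        exact Finset.notMem_erase _ _)
      (fun h => hlast (hsub h))
      (fun i hi h => hns (i + 1) (by omega) fun c => hsub (h c))
    rw [Function.update_of_ne hts, Function.update_idem] at hC'' hE''
    refine ⟨D'', hD''.trans hsub, hC'', ?_, ?_⟩
    · intro x hx h
      exact hmem'' x (hmem x hx (h 0 (by omega)) (h 1 (by omega))) fun i hi => h _ (by omega)
    · rw [hE, if_pos hoppD, ← hE'', Finset.sum_range_succ' _ (len + 1), zpow_add₀ lam_ne_zero,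
        sgn_add]
      have h := sgn_base_mul (dr 0) (dr 1) (fun h => hback h.symm)
      simp only [zero_add] at h ⊢
      linear_combination sgn (signExp D' (Function.update z s (e 1))) *
        lam ^ (∑ i ∈ range (len + 1), turn (dr (i + 1)) (dr (i + 1 + 1))) * h

/-! ### The darts of a contour configuration -/

section

lemma opp_ne (x : Dart) : opp x ≠ x := by
  obtain ⟨p, d⟩ := x
  intro h
  exact absurd (congrArg Prod.snd h) ((by decide : ∀ d : Dir, d + 2 ≠ d) d)

lemma eq_or_eq_opp {x y : Dart} (hx : Odd x.1.1 ∧ Odd x.1.2) (hy : Odd y.1.1 ∧ Odd y.1.2)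
    (h : mid x = mid y) : x = y ∨ x = opp y := by
  obtain ⟨⟨y1, y2⟩, e⟩ := y
  obtain ⟨⟨x1, x2⟩, d⟩ := x
  obtain ⟨⟨r, hr⟩, ⟨s, hs⟩⟩ := hy
  obtain ⟨⟨r', hr'⟩, ⟨s', hs'⟩⟩ := hx
  simp only at hr hs hr' hs'
  fin_cases d <;> fin_cases e <;> simp [mid, opp, halfStep] at h ⊢ <;> omega

variable {F : Finset Pt} {n : ℕ} {z : Fin n → Pt} {ε : Fin n → Root} {γ : Finset Pt}

/-- The dart of the half-edge at the point `z j`. -/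
def endDart (z : Fin n → Pt) (ε : Fin n → Root) (j : Fin n) : Dart :=
  (z j + halfStep (ε j).dir, (ε j).dir + 2)

lemma mid_endDart (j : Fin n) : mid (endDart z ε j) = z j := mid_arrive _ _

/-- The darts of a configuration. -/
def contourDarts (F : Finset Pt) (z : Fin n → Pt) (ε : Fin n → Root) (γ : Finset Pt) :
    Finset Dart :=
  (F ×ˢ (univ : Finset Dir)).filter fun x => mid x ∈ γ ∨ ∃ j, x = endDart z ε j

lemma mem_contourDarts {x : Dart} :
    x ∈ contourDarts F z ε γ ↔ x.1 ∈ F ∧ (mid x ∈ γ ∨ ∃ j, x = endDart z ε j) := by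
  simp [contourDarts]

lemma mem_contours : γ ∈ contours F z ε ↔ γ ⊆ dualEdges F ∧
    (∀ j, z j + halfStep (ε j).dir ∈ F) ∧ (∀ j, z j ∉ γ) ∧ ∀ p ∈ F, Even (degAt z ε γ p) := by
  simp [contours]

lemma mem_dualEdges {q : Pt} :
    q ∈ dualEdges F ↔ ∃ x : Dart, x.1 ∈ F ∧ (opp x).1 ∈ F ∧ mid x = q := by
  simp only [dualEdges, mem_image, mem_filter, mem_product, mem_univ, and_true, mid, opp]
  tauto

lemma opp_fst_mem (hF : ∀ p ∈ F, Odd p.1 ∧ Odd p.2) (hγ : γ ∈ contours F z ε) {x : Dart}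
    (hx : Odd x.1.1 ∧ Odd x.1.2) (h : mid x ∈ γ) : x.1 ∈ F ∧ (opp x).1 ∈ F := by
  obtain ⟨y, hy, hy', hq⟩ := mem_dualEdges.mp ((mem_contours.mp hγ).1 h)
  rcases eq_or_eq_opp hx (hF _ hy) hq.symm with rfl | rfl
  · exact ⟨hy, hy'⟩
  · rw [opp_opp]; exact ⟨hy', hy⟩

lemma endDart_injective (hz : Function.Injective z) : Function.Injective (endDart z ε) := by
  intro i j h
  apply hz
  rw [← mid_endDart (z := z) (ε := ε) i, h, mid_endDart]

lemma endDart_mem (hγ : γ ∈ contours F z ε) (j : Fin n) :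
    endDart z ε j ∈ contourDarts F z ε γ :=
  mem_contourDarts.mpr ⟨(mem_contours.mp hγ).2.1 j, Or.inr ⟨j, rfl⟩⟩

/-- Since `z j` is not in `γ`, a dart ending there can only come from a half-edge, and the marked
points are distinct. -/
lemma eq_endDart (hz : Function.Injective z) (hγ : γ ∈ contours F z ε) {x : Dart} {j : Fin n}
    (hx : x ∈ contourDarts F z ε γ) (h : mid x = z j) : x = endDart z ε j := by
  rcases (mem_contourDarts.mp hx).2 with h' | ⟨i, rfl⟩
  · exact absurd (h ▸ h') ((mem_contours.mp hγ).2.2.1 j)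
  · rw [mid_endDart] at h
    rw [hz h]

lemma card_contourDarts_face (hz : Function.Injective z) (hzγ : ∀ j, z j ∉ γ) {p : Pt}
    (hp : p ∈ F) :
    (univ.filter fun d : Dir => (p, d) ∈ contourDarts F z ε γ).card = degAt z ε γ p := by
  have h1 : (univ.filter fun d : Dir => (p, d) ∈ contourDarts F z ε γ) =
      (univ.filter fun d : Dir => p + halfStep d ∈ γ) ∪
        (univ.filter fun j : Fin n => z j + halfStep (ε j).dir = p).image
          fun j => (ε j).dir + 2 := by
    ext d
    simp only [mem_filter, mem_univ, true_and, mem_contourDarts, hp, mem_union, mem_image, mid,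
      endDart, Prod.mk.injEq]
    refine or_congr Iff.rfl (exists_congr fun j => ?_)
    constructor <;> rintro ⟨rfl, rfl⟩ <;> exact ⟨rfl, rfl⟩
  rw [h1, Finset.card_union_of_disjoint, degAt, Finset.card_image_of_injOn]
  · intro i hi j hj hij
    simp only [coe_filter, mem_univ, true_and, Set.mem_ofPred_eq] at hi hj hij
    apply endDart_injective (ε := ε) hz
    simp only [endDart, hi, hj, hij]
  · rw [Finset.disjoint_left]
    intro d hd hd'
    simp only [mem_filter, mem_univ, true_and, mem_image] at hd hd'
    obtain ⟨j, hj, rfl⟩ := hd'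
    refine hzγ j ?_
    rw [halfStep_add_two, ← hj] at hd
    simpa using hd

/-- A full edge has two darts with the same midpoint, a half-edge has one. -/
lemma sum_contourDarts_mid (hF : ∀ p ∈ F, Odd p.1 ∧ Odd p.2) (hz : Function.Injective z)
    (hγ : γ ∈ contours F z ε) {M : Type*} [AddCommMonoid M] (f : Pt → M) :
    ∑ x ∈ contourDarts F z ε γ, f (mid x) = ∑ q ∈ γ, 2 • f q + ∑ j, f (z j) := by
  have h1 : contourDarts F z ε γ = ((F ×ˢ (univ : Finset Dir)).filter fun x => mid x ∈ γ) ∪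
      univ.image (endDart z ε) := by
    ext x
    simp only [mem_contourDarts, mem_union, mem_filter, mem_product, mem_univ, and_true,
      mem_image, true_and]
    constructor
    · rintro ⟨h, h' | ⟨j, hj⟩⟩
      · exact Or.inl ⟨h, h'⟩
      · exact Or.inr ⟨j, hj.symm⟩
    · rintro (⟨h, h'⟩ | ⟨j, rfl⟩)
      · exact ⟨h, Or.inl h'⟩
      · exact ⟨(mem_contours.mp hγ).2.1 j, Or.inr ⟨j, rfl⟩⟩
  rw [h1, Finset.sum_union, Finset.sum_image (endDart_injective hz).injOn]
  · congr 1
    · rw [← Finset.sum_fiberwise_of_maps_to (t := γ) (g := mid)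
        (fun x hx => (mem_filter.mp hx).2)]
      refine Finset.sum_congr rfl fun q hq => ?_
      obtain ⟨x, hx, hx', rfl⟩ := mem_dualEdges.mp ((mem_contours.mp hγ).1 hq)
      have : ((F ×ˢ (univ : Finset Dir)).filter fun x => mid x ∈ γ).filter
          (fun y => mid y = mid x) = {x, opp x} := by
        ext y
        simp only [mem_filter, mem_product, mem_univ, and_true, mem_insert, mem_singleton]
        constructor
        · rintro ⟨⟨h, -⟩, h'⟩
          exact eq_or_eq_opp (hF _ h) (hF _ hx) h'
        · rintro (rfl | rfl)
          · exact ⟨⟨hx, hq⟩, rfl⟩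
          · rw [mid_opp]; exact ⟨⟨hx', hq⟩, rfl⟩
      rw [this, Finset.sum_pair (opp_ne x).symm, mid_opp, two_nsmul]
    · simp only [mid_endDart]
  · rw [Finset.disjoint_left]
    intro x hx hx'
    obtain ⟨j, -, rfl⟩ := mem_image.mp hx'
    have := (mem_filter.mp hx).2
    rw [mid_endDart] at this
    exact (mem_contours.mp hγ).2.2.1 j this

lemma card_contourDarts (hF : ∀ p ∈ F, Odd p.1 ∧ Odd p.2) (hz : Function.Injective z)
    (hγ : γ ∈ contours F z ε) : (contourDarts F z ε γ).card = 2 * γ.card + n := by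
  have := sum_contourDarts_mid hF hz hγ (fun _ => 1)
  simp only [sum_const, smul_eq_mul, card_univ, Fintype.card_fin, mul_one] at this
  rw [this]; ring

lemma sum_contourDarts {M : Type*} [AddCommMonoid M] (f : Dart → M) :
    ∑ x ∈ contourDarts F z ε γ, f x =
      ∑ p ∈ F, ∑ d, if (p, d) ∈ contourDarts F z ε γ then f (p, d) else 0 := by
  rw [← Finset.sum_product' (f := fun p d =>
    if (p, d) ∈ contourDarts F z ε γ then f (p, d) else 0), ← Finset.sum_filter]
  refine Finset.sum_congr ?_ fun _ _ => rfl
  ext x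
  simp only [mem_filter, mem_product, mem_univ, and_true, mem_contourDarts]
  tauto

/-- In the boundary, faces cancel because their degrees are even and full edges because they count
twice; the marked points remain. -/
theorem config_contourDarts (hF : ∀ p ∈ F, Odd p.1 ∧ Odd p.2) (hz : Function.Injective z)
    (hγ : γ ∈ contours F z ε) : Config (contourDarts F z ε γ) z where
  odd x hx := hF _ (mem_contourDarts.mp hx).1
  even p := by
    by_cases hp : p ∈ F
    · rw [card_contourDarts_face hz (mem_contours.mp hγ).2.2.1 hp]
      exact (mem_contours.mp hγ).2.2.2 p hp
    · simp [mem_contourDarts, hp]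
  chain f := by
    rw [Finset.sum_add_distrib, sum_contourDarts_mid hF hz hγ, sum_contourDarts,
      Finset.sum_eq_zero, zero_add, Finset.sum_eq_zero, zero_add]
    · intro q _
      rw [two_nsmul, zmod_two_add_self]
    · intro p hp
      dsimp only
      rw [← Finset.sum_filter, Finset.sum_const, card_contourDarts_face hz (mem_contours.mp hγ).2.2.1 hp]
      obtain ⟨r, hr⟩ := (mem_contours.mp hγ).2.2.2 p hp
      rw [hr, add_nsmul, zmod_two_add_self]

end

/-! ### Contraction of all strands of a path system -/

section

section

variable {F : Finset Pt} {n : ℕ} {z : Fin n → Pt} {ε : Fin n → Root} {γ : Finset Pt}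

/-- The midpoints of a strand as a sequence. -/
def Strand.edgeSeq {s t : Fin n} (π : Strand z ε γ s t) (i : ℕ) : Pt :=
  if h : i < π.len + 2 then π.edge ⟨i, h⟩ else 0

/-- The directions of a strand as a sequence. -/
def Strand.dirSeq {s t : Fin n} (π : Strand z ε γ s t) (i : ℕ) : Dir :=
  if h : i < π.len + 2 then π.dir ⟨i, h⟩ else 0

/-- The set `D` is what earlier contractions have left. Only the darts of this strand have to be
intact, and only the other marked points have to stay off it. -/
theorem Strand.contract (hF : ∀ p ∈ F, Odd p.1 ∧ Odd p.2) (hz : Function.Injective z)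
    (hγ : γ ∈ contours F z ε) {s t : Fin n} (hst : s < t) (π : Strand z ε γ s t)
    {D : Finset Dart} (hD : D ⊆ contourDarts F z ε γ)
    (hDπ : ∀ x ∈ contourDarts F z ε γ, mid x ∈ Set.range π.edge → x ∈ D)
    {w : Fin n → Pt} (hC : Config D w) (hws : w s = z s) (hwt : w t = z t)
    (hw : ∀ j, j ≠ s → j ≠ t → w j ∉ Set.range π.edge) :
    ∃ D' ⊆ D, Config D' (Function.update w s (w t)) ∧
      (∀ x ∈ D, mid x ∉ Set.range π.edge → x ∈ D') ∧
      sgn (signExp D w) *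
          (lam ^ (∑ i : Fin (π.len + 1), turn (π.dir i.castSucc) (π.dir i.succ)) *
            phi (ε s).dir) =
        sgn (signExp D' (Function.update w s (w t))) *
          (sgn (tOpp ((ε t).dir + 2)) * phi ((ε t).dir + 2)) := by
  have he : ∀ i (h : i < π.len + 2), π.edgeSeq i = π.edge ⟨i, h⟩ := fun i h => dif_pos h
  have hd : ∀ i (h : i < π.len + 2), π.dirSeq i = π.dir ⟨i, h⟩ := fun i h => dif_pos h
  have he0 : π.edgeSeq 0 = z s := (he 0 (by omega)).trans π.edge_zero
  have hd0 : π.dirSeq 0 = (ε s).dir := (hd 0 (by omega)).trans π.dir_zero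
  have hel : π.edgeSeq (π.len + 1) = z t := (he _ (by omega)).trans π.edge_last
  have hdl : π.dirSeq (π.len + 1) = (ε t).dir + 2 := (hd _ (by omega)).trans π.dir_last
  have hrange : ∀ q, q ∈ Set.range π.edge ↔ ∃ i ≤ π.len + 1, q = π.edgeSeq i := by
    intro q
    constructor
    · rintro ⟨i, rfl⟩
      exact ⟨i.1, by omega, (he _ i.2).symm⟩
    · rintro ⟨i, hi, rfl⟩
      exact ⟨⟨i, by omega⟩, (he _ _).symm⟩
  have hstep : ∀ i ≤ π.len, π.edgeSeq (i + 1) =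
      π.edgeSeq i + halfStep (π.dirSeq i) + halfStep (π.dirSeq (i + 1)) := by
    intro i hi
    rw [he i (by omega), he (i + 1) (by omega), hd i (by omega), hd (i + 1) (by omega)]
    exact π.step ⟨i, by omega⟩
  have hinner : ∀ i, 0 < i → i ≤ π.len → π.edgeSeq i ∈ γ := by
    intro i hi hi'
    rw [he i (by omega)]
    refine π.inner _ ?_ ?_ <;> simp only [ne_eq, Fin.ext_iff, Fin.val_zero, Fin.val_last] <;> omega
  have hinj : ∀ i ≤ π.len + 1, ∀ j ≤ π.len + 1, π.edgeSeq i = π.edgeSeq j → i = j := by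
    intro i hi j hj h
    rw [he i (by omega), he j (by omega)] at h
    exact congrArg Fin.val (π.simple h)
  -- The faces stay in the domain because an edge of `γ` has a face of the domain on both sides.
  have hface : ∀ i ≤ π.len, π.edgeSeq i + halfStep (π.dirSeq i) ∈ F := by
    intro i
    induction i with
    | zero =>
      intro _
      rw [he0, hd0]
      exact (mem_contours.mp hγ).2.1 s
    | succ i ih =>
      intro hi
      have h1 := ih (by omega)
      have h2 : mid (π.edgeSeq i + halfStep (π.dirSeq i), π.dirSeq (i + 1)) =
        π.edgeSeq (i + 1) := (hstep i (by omega)).symm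
      have h3 := (opp_fst_mem hF hγ
        (x := (π.edgeSeq i + halfStep (π.dirSeq i), π.dirSeq (i + 1))) (hF _ h1)
        (by rw [h2]; exact hinner _ (by omega) hi)).2
      rw [← h2]
      exact h3
  have hin : ∀ i ≤ π.len, (π.edgeSeq i + halfStep (π.dirSeq i), π.dirSeq i + 2) ∈
      contourDarts F z ε γ := by
    intro i hi
    refine mem_contourDarts.mpr ⟨hface i hi, ?_⟩
    rcases Nat.eq_zero_or_pos i with rfl | hpos
    · right
      exact ⟨s, by rw [he0, hd0]; rfl⟩
    · left
      rw [mid_arrive]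
      exact hinner i hpos hi
  have hout : ∀ i ≤ π.len, (π.edgeSeq i + halfStep (π.dirSeq i), π.dirSeq (i + 1)) ∈
      contourDarts F z ε γ := by
    intro i hi
    refine mem_contourDarts.mpr ⟨hface i hi, ?_⟩
    have h2 : mid (π.edgeSeq i + halfStep (π.dirSeq i), π.dirSeq (i + 1)) =
        π.edgeSeq (i + 1) := (hstep i (by omega)).symm
    rcases Nat.lt_or_ge i π.len with h | h
    · left
      rw [h2]
      exact hinner _ (by omega) (by omega)
    · right
      obtain rfl : i = π.len := by omega
      refine ⟨t, ?_⟩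
      rw [hel, hdl] at h2
      rw [hdl, endDart, ← h2]
      simp [mid, halfStep_add_two]
  have hedge : ∀ i ≤ π.len + 1, π.edgeSeq i ∈ Set.range π.edge := fun i hi =>
    (hrange _).mpr ⟨i, hi, rfl⟩
  have hsum : ∑ i : Fin (π.len + 1), turn (π.dir i.castSucc) (π.dir i.succ) =
      ∑ i ∈ range (π.len + 1), turn (π.dirSeq i) (π.dirSeq (i + 1)) := by
    rw [Finset.sum_range]
    refine Finset.sum_congr rfl fun i _ => ?_
    rw [hd i.1 (by omega), hd (i.1 + 1) (by omega)]
    rfl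
  -- A half-edge has no opposite dart in the configuration, so neither end of the strand does.
  have hend : ∀ x ∈ contourDarts F z ε γ, ∀ j, mid x = z j → opp x ∉ D := by
    intro x hx j hj ho
    have h1 := eq_endDart hz hγ hx hj
    have h2 := eq_endDart hz hγ (hD ho) ((mid_opp x).trans hj)
    exact opp_ne x (h2.trans h1.symm)
  obtain ⟨D', hD', hC', hmem, hE⟩ := Config.contract s t hst π.len π.edgeSeq π.dirSeq D w hC
    (hws.trans he0.symm) (hwt.trans hel.symm)
    (fun j hj hj' i hi h => hw j hj hj' (h ▸ hedge i hi)) hstep hinj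
    (fun i hi => hDπ _ (hin i hi) (by rw [mid_arrive]; exact hedge i (by omega)))
    (fun i hi => hDπ _ (hout i hi) (by
      have h2 : mid (π.edgeSeq i + halfStep (π.dirSeq i), π.dirSeq (i + 1)) =
        π.edgeSeq (i + 1) := (hstep i (by omega)).symm
      rw [h2]; exact hedge (i + 1) (by omega)))
    (hend _ (hin 0 (by omega)) s (by rw [mid_arrive, he0]))
    (hend _ (hout π.len le_rfl) t (by
      have h2 : mid (π.edgeSeq π.len + halfStep (π.dirSeq π.len), π.dirSeq (π.len + 1)) =
        π.edgeSeq (π.len + 1) := (hstep π.len le_rfl).symm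
      rw [h2, hel]))
    (by
      intro i hi hall
      have h1 : degAt z ε γ (π.edgeSeq i + halfStep (π.dirSeq i)) = 4 := by
        rw [← card_contourDarts_face hz (mem_contours.mp hγ).2.2.1 (hface i hi)]
        rw [Finset.filter_true_of_mem fun c _ => hD (hall c)]
        rfl
      rw [he i (by omega), hd i (by omega)] at h1
      rw [hd i (by omega), hd (i + 1) (by omega)]
      exact π.noStraight ⟨i, by omega⟩ h1)
  refine ⟨D', hD', hC', ?_, ?_⟩
  · intro x hx h
    exact hmem x hx fun i hi h' => h (h' ▸ hedge i hi)
  · rw [hsum, ← hd0, ← hdl, ← hE]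
    ring

end

section

variable {F : Finset Pt} {m : ℕ} {z : Fin (2 * m) → Pt} {ε : Fin (2 * m) → Root} {γ : Finset Pt}

lemma PathSystem.sum_eq (P : PathSystem z ε γ) {M : Type*} [AddCommMonoid M]
    (f : Fin (2 * m) → M) : ∑ i, f i = ∑ k, (f (P.s k) + f (P.d k)) := by
  rw [← (Equiv.ofBijective _ P.pairing).sum_comp f, Fintype.sum_sum_type,
    Finset.sum_add_distrib]
  rfl

lemma PathSystem.prod_eq (P : PathSystem z ε γ) {M : Type*} [CommMonoid M]
    (f : Fin (2 * m) → M) : ∏ i, f i = ∏ k, (f (P.s k) * f (P.d k)) :=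
  P.sum_eq (M := Additive M) f

lemma PathSystem.s_injective (P : PathSystem z ε γ) : Function.Injective P.s := fun i j h =>
  Sum.inl_injective (P.pairing.1 (a₁ := Sum.inl i) (a₂ := Sum.inl j) h)

lemma PathSystem.d_injective (P : PathSystem z ε γ) : Function.Injective P.d := fun i j h =>
  Sum.inr_injective (P.pairing.1 (a₁ := Sum.inr i) (a₂ := Sum.inr j) h)

lemma PathSystem.s_ne_d (P : PathSystem z ε γ) (i j : Fin m) : P.s i ≠ P.d j := fun h =>
  Sum.inl_ne_inr (P.pairing.1 (a₁ := Sum.inl i) (a₂ := Sum.inr j) h)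

lemma PathSystem.eq_s_or_d (P : PathSystem z ε γ) (j : Fin (2 * m)) :
    ∃ k, j = P.s k ∨ j = P.d k := by
  obtain ⟨k | k, hk⟩ := P.pairing.2 j
  · exact ⟨k, Or.inl hk.symm⟩
  · exact ⟨k, Or.inr hk.symm⟩

lemma PathSystem.s_mem_range (P : PathSystem z ε γ) (k : Fin m) :
    z (P.s k) ∈ Set.range (P.path k).edge := ⟨0, (P.path k).edge_zero⟩

lemma PathSystem.d_mem_range (P : PathSystem z ε γ) (k : Fin m) :
    z (P.d k) ∈ Set.range (P.path k).edge := ⟨Fin.last _, (P.path k).edge_last⟩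

/-- The strands are disjoint, so those outside `S` keep all their darts and can be contracted next.
-/
theorem PathSystem.contract_all (hF : ∀ p ∈ F, Odd p.1 ∧ Odd p.2) (hz : Function.Injective z)
    (hγ : γ ∈ contours F z ε) (P : PathSystem z ε γ) (S : Finset (Fin m)) :
    ∃ D ⊆ contourDarts F z ε γ, ∃ w : Fin (2 * m) → Pt, Config D w ∧
      (∀ k, w (P.s k) = if k ∈ S then z (P.d k) else z (P.s k)) ∧
      (∀ k, w (P.d k) = z (P.d k)) ∧
      (∀ x ∈ contourDarts F z ε γ, (∀ k ∈ S, mid x ∉ Set.range (P.path k).edge) → x ∈ D) ∧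
      sgn (signExp (contourDarts F z ε γ) z) * ∏ k ∈ S,
          (lam ^ (∑ i : Fin ((P.path k).len + 1),
            turn ((P.path k).dir i.castSucc) ((P.path k).dir i.succ)) *
              phi (ε (P.s k)).dir) =
        sgn (signExp D w) *
          ∏ k ∈ S, (sgn (tOpp ((ε (P.d k)).dir + 2)) * phi ((ε (P.d k)).dir + 2)) := by
  induction S using Finset.induction_on with
  | empty =>
    exact ⟨_, subset_rfl, z, config_contourDarts hF hz hγ, by simp, by simp, by simp, by simp⟩
  | insert k S hk ih =>
    obtain ⟨D, hD, w, hC, hws, hwd, hmem, hE⟩ := ih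
    have hdisj : ∀ l, l ≠ k → ∀ q, q ∈ Set.range (P.path l).edge →
        q ∉ Set.range (P.path k).edge := fun l hl q hq =>
      Set.disjoint_left.mp (P.disjoint l k hl) hq
    obtain ⟨D', hD', hC', hmem', hE'⟩ := (P.path k).contract hF hz hγ (P.lt k) hD
      (fun x hx h => hmem x hx fun l hl h' => hdisj l (by rintro rfl; exact hk hl) _ h' h) hC
      (by rw [hws, if_neg hk]) (hwd k) (by
        intro j hj hj'
        obtain ⟨l, rfl | rfl⟩ := P.eq_s_or_d j
        · have hl : l ≠ k := by rintro rfl; exact hj rfl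
          rw [hws]
          split_ifs
          · exact hdisj l hl _ (P.d_mem_range l)
          · exact hdisj l hl _ (P.s_mem_range l)
        · have hl : l ≠ k := by rintro rfl; exact hj' rfl
          rw [hwd]
          exact hdisj l hl _ (P.d_mem_range l))
    refine ⟨D', hD'.trans hD, _, hC', ?_, ?_, ?_, ?_⟩
    · intro l
      by_cases hl : l = k
      · subst hl
        simp [hwd]
      · rw [Function.update_of_ne (fun h => hl (P.s_injective h)), hws]
        simp [hl]
    · intro l
      rw [Function.update_of_ne (P.s_ne_d k l).symm, hwd]
    · intro x hx h
      exact hmem' x (hmem x hx fun l hl => h l (mem_insert_of_mem hl)) (h k (mem_insert_self _ _))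
    · rw [Finset.prod_insert hk, Finset.prod_insert hk]
      linear_combination (lam ^ (∑ i : Fin ((P.path k).len + 1),
            turn ((P.path k).dir i.castSucc) ((P.path k).dir i.succ)) *
              phi (ε (P.s k)).dir) * hE +
        (∏ k ∈ S, (sgn (tOpp ((ε (P.d k)).dir + 2)) * phi ((ε (P.d k)).dir + 2))) * hE'

end

end

/-! ### The phase in terms of ray crossings -/

section

variable {F : Finset Pt} {m : ℕ} {z : Fin (2 * m) → Pt} {ε : Fin (2 * m) → Root} {γ : Finset Pt}

/-- For two pairs of indices, the number of `i < j` with `i` in the first pair and `j` in the second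
is odd exactly when the pairs cross. Each crossing then contributes `key` of the two end points in
both orders, which is `1` by `key_add_key`. -/
lemma PathSystem.keyInv_eq_crossings (P : PathSystem z ε γ) (hz : Function.Injective z)
    {w : Fin (2 * m) → Pt} (hs : ∀ k, w (P.s k) = z (P.d k)) (hd : ∀ k, w (P.d k) = z (P.d k)) :
    keyInv w = (P.crossings : ZMod 2) := by
  let χ : Fin m → Fin m → ZMod 2 := fun k l =>
    if P.s k < P.s l ∧ P.s l < P.d k ∧ P.d k < P.d l then 1 else 0
  have h1 : keyInv w = ∑ k, ∑ l, key (z (P.d l)) (z (P.d k)) * (χ k l + χ l k) := by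
    rw [keyInv, P.sum_eq]
    refine Finset.sum_congr rfl fun k _ => ?_
    rw [← Finset.sum_add_distrib, P.sum_eq]
    refine Finset.sum_congr rfl fun l _ => ?_
    simp only [hs, hd]
    by_cases hkl : k = l
    · subst hkl
      simp [key_self]
    · have hss : P.s k ≠ P.s l := fun h => hkl (P.s_injective h)
      have hdd : P.d k ≠ P.d l := fun h => hkl (P.d_injective h)
      have hsd := P.s_ne_d k l
      have hds := P.s_ne_d l k
      have hk := P.lt k
      have hl := P.lt l
      generalize key (z (P.d l)) (z (P.d k)) = x
      have hx := zmod_two_add_self x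
      simp only [χ]
      split_ifs <;> first | (exfalso; omega) | simp [hx]
  have h2 : keyInv w = ∑ k, ∑ l, χ k l *
      (key (z (P.d l)) (z (P.d k)) + key (z (P.d k)) (z (P.d l))) := by
    rw [h1]
    simp only [mul_add, Finset.sum_add_distrib]
    congr 1
    · exact Finset.sum_congr rfl fun k _ => Finset.sum_congr rfl fun l _ => mul_comm _ _
    · rw [Finset.sum_comm]
      exact Finset.sum_congr rfl fun k _ => Finset.sum_congr rfl fun l _ => mul_comm _ _
  rw [h2, PathSystem.crossings, Finset.card_filter, Nat.cast_sum, Fintype.sum_prod_type]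
  refine Finset.sum_congr rfl fun k _ => Finset.sum_congr rfl fun l _ => ?_
  by_cases hkl : k = l
  · subst hkl
    simp [χ]
  · rw [key_add_key fun h => hkl (P.d_injective (hz h)).symm]
    simp [χ]

lemma sgn_natCast (c : ℕ) : sgn (c : ZMod 2) = (-1) ^ c := by
  induction c with
  | zero => simp [sgn]
  | succ c ih =>
    have : sgn (1 : ZMod 2) = -1 := if_neg (by decide)
    rw [Nat.cast_succ, sgn_add, ih, pow_succ, this]

lemma exp_winding {s t : Fin (2 * m)} (π : Strand z ε γ s t) :
    Complex.exp (-(Complex.I / 2) * (π.winding : ℂ)) =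
      (lam ^ (∑ i : Fin (π.len + 1), turn (π.dir i.castSucc) (π.dir i.succ)))⁻¹ := by
  rw [lam, ← Complex.exp_int_mul, ← Complex.exp_neg, Strand.winding]
  congr 1
  push_cast
  ring

/-- The sign `+1` of `↑` and `-1` of `↓`. -/
def arrowSign : Arrow → ℂ
  | Arrow.up => 1
  | Arrow.down => -1

/-- The roots are compared with the branch `phi`. A strand leaves its start along the orientation
but arrives at its end against it; this reversal accounts for the factor `I`. -/
lemma arrow_factor (u v : Arrow) :
    (arrowRoot v).val / (arrowRoot u).val * phi (arrowRoot u).dir =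
      Complex.I * (arrowSign u * arrowSign v) *
        (sgn (tOpp ((arrowRoot v).dir + 2)) * phi ((arrowRoot v).dir + 2)) := by
  have h4 := lam_pow_four
  have h0 := lam_ne_zero
  have h13 : (1 : Fin 4) + 2 = 3 := rfl
  have h31 : (3 : Fin 4) + 2 = 1 := rfl
  rw [← lam_sq]
  cases u <;> cases v <;> simp [arrowRoot, arrowSign, sgn, tOpp, phi, h13, h31] <;> field_simp <;>
    simp [h4]

lemma phi_ne_zero (d : Dir) : phi d ≠ 0 := by
  have h0 := lam_ne_zero
  fin_cases d <;> simp [phi, h0]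

lemma sgn_ne_zero (x : ZMod 2) : sgn x ≠ 0 := by
  unfold sgn; split_ifs <;> norm_num

/-- The phase of a configuration in terms of ray crossings; in particular it does not depend
on the choice of paths. -/
theorem PathSystem.phase_eq {arr : Fin (2 * m) → Arrow} (hF : ∀ p ∈ F, Odd p.1 ∧ Odd p.2)
    (hz : Function.Injective z) (hγ : γ ∈ contours F z (roots arr))
    (P : PathSystem z (roots arr) γ) :
    P.phase = sgn (signExp (contourDarts F z (roots arr) γ) z) * Complex.I ^ m *
      ∏ j, arrowSign (arr j) := by
  obtain ⟨D, hD, w, hC, hws, hwd, -, hE⟩ := P.contract_all hF hz hγ univ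
  simp only [mem_univ, if_true] at hws
  -- Starting points now coincide with end points, so their rays cancel in pairs.
  have hw : signExp D w = (P.crossings : ZMod 2) := by
    rw [signExp, P.keyInv_eq_crossings hz hws hwd, P.sum_eq, Finset.sum_eq_zero, add_zero]
    intro k _
    rw [hws, hwd, zmod_two_add_self]
  rw [hw, sgn_natCast] at hE
  rw [P.prod_eq, PathSystem.phase]
  simp only [exp_winding]
  set W : Fin m → ℤ := fun k => ∑ i : Fin ((P.path k).len + 1),
    turn ((P.path k).dir i.castSucc) ((P.path k).dir i.succ) with hW
  have hfac : (∏ k, (((roots arr) (P.d k)).val / ((roots arr) (P.s k)).val * (lam ^ W k)⁻¹)) *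
      (∏ k, (lam ^ W k * phi ((roots arr) (P.s k)).dir)) =
      Complex.I ^ m * (∏ k, (arrowSign (arr (P.s k)) * arrowSign (arr (P.d k)))) *
        ∏ k, (sgn (tOpp (((roots arr) (P.d k)).dir + 2)) *
          phi (((roots arr) (P.d k)).dir + 2)) := by
    have hI : Complex.I ^ m = ∏ _k : Fin m, Complex.I := by simp
    rw [hI, ← Finset.prod_mul_distrib, ← Finset.prod_mul_distrib, ← Finset.prod_mul_distrib]
    refine Finset.prod_congr rfl fun k _ => ?_
    have h0 : lam ^ W k ≠ 0 := zpow_ne_zero _ lam_ne_zero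
    rw [← arrow_factor]
    field_simp
  have hT : ∏ k, (sgn (tOpp (((roots arr) (P.d k)).dir + 2)) *
      phi (((roots arr) (P.d k)).dir + 2)) ≠ 0 :=
    Finset.prod_ne_zero_iff.mpr fun k _ => mul_ne_zero (sgn_ne_zero _) (phi_ne_zero _)
  have hs := sgn_mul_self (signExp (contourDarts F z (roots arr) γ) z)
  apply mul_right_cancel₀ hT
  set A := ∏ k, (lam ^ W k * phi ((roots arr) (P.s k)).dir)
  have hA : A = sgn (signExp (contourDarts F z (roots arr) γ) z) * ((-1) ^ P.crossings *
      ∏ k, (sgn (tOpp (((roots arr) (P.d k)).dir + 2)) *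
          phi (((roots arr) (P.d k)).dir + 2))) := by
    rw [← hE, ← mul_assoc, hs, one_mul]
  rw [hA] at hfac
  linear_combination (sgn (signExp (contourDarts F z (roots arr) γ) z)) * hfac -
    ((-1) ^ P.crossings * (∏ k, (((roots arr) (P.d k)).val / ((roots arr) (P.s k)).val *
      (lam ^ W k)⁻¹)) * ∏ k, (sgn (tOpp (((roots arr) (P.d k)).dir + 2)) *
          phi (((roots arr) (P.d k)).dir + 2))) * hs

end

/-! ### Alternating trajectories of two involutions -/

section

section Involutions

variable {α : Type*} {ι μ : α → α}

/-- The alternating trajectory of two involutions. -/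
def trail (ι μ : α → α) (x : α) (i : ℕ) : α := (μ ∘ ι)^[i] x

lemma trail_succ (x : α) (i : ℕ) : trail ι μ x (i + 1) = μ (ι (trail ι μ x i)) :=
  Function.iterate_succ_apply' _ _ _

/-- A trajectory that starts and, after `n` steps for the first time, ends at a fixed point
of `μ`. -/
structure IsTrail (ι μ : α → α) (x : α) (n : ℕ) : Prop where
  inv_left : Function.Involutive ι
  inv_right : Function.Involutive μ
  ne : ∀ y, ι y ≠ y
  departs : μ x = x
  returns : μ (ι (trail ι μ x n)) = ι (trail ι μ x n)
  min : ∀ k < n, μ (ι (trail ι μ x k)) ≠ ι (trail ι μ x k)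

/-- The composition of the involutions permutes a finite set, so the trajectory returns to `x` at
some time `r`. At time `r - 1` the partner under `ι` is mapped by `μ` to the fixed point `x`, hence
equals `x`, and a first such time exists. -/
lemma exists_isTrail [Finite α] (hι : Function.Involutive ι) (hμ : Function.Involutive μ)
    (hne : ∀ y, ι y ≠ y) {x : α} (hx : μ x = x) : ∃ n, IsTrail ι μ x n := by
  have hinj : Function.Injective (μ ∘ ι) := hμ.injective.comp hι.injective
  obtain ⟨r, hr, hrx⟩ := Function.Injective.mem_periodicPts hinj x
  have hex : ∃ k, μ (ι (trail ι μ x k)) = ι (trail ι μ x k) := by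
    refine ⟨r - 1, ?_⟩
    have h1 : μ (ι (trail ι μ x (r - 1))) = x := by
      rw [← trail_succ (ι := ι) (μ := μ), Nat.sub_add_cancel hr]; exact hrx
    have h2 : ι (trail ι μ x (r - 1)) = x := by
      rw [← hμ (ι _), h1, hx]
    rw [h2, hx]
  classical
  exact ⟨Nat.find hex, hι, hμ, hne, hx, Nat.find_spec hex, fun k hk => Nat.find_min hex hk⟩

variable {x : α} {n : ℕ}

lemma IsTrail.not_fixed (h : IsTrail ι μ x n) {i : ℕ} (hi : 0 < i) (hi' : i ≤ n) :
    μ (trail ι μ x i) ≠ trail ι μ x i := by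
  obtain ⟨k, rfl⟩ : ∃ k, i = k + 1 := ⟨i - 1, by omega⟩
  intro hf
  rw [trail_succ, h.inv_right] at hf
  exact h.min k (by omega) hf.symm

lemma IsTrail.iota_trail (h : IsTrail ι μ x n) (i : ℕ) :
    μ (trail ι μ x (i + 1)) = ι (trail ι μ x i) := by
  rw [trail_succ, h.inv_right]

lemma IsTrail.trail_cancel (h : IsTrail ι μ x n) {y : α} :
    ∀ {i j : ℕ}, i ≤ j → trail ι μ x i = trail ι μ y j → x = trail ι μ y (j - i) := by
  intro i j hij he
  have hinj : Function.Injective (μ ∘ ι)^[i] :=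
    (h.inv_right.injective.comp h.inv_left.injective).iterate i
  apply hinj
  rw [trail, ← Function.iterate_add_apply, Nat.add_sub_cancel' hij]
  exact he

lemma IsTrail.injOn (h : IsTrail ι μ x n) {i j : ℕ} (hij : i < j) (hj : j ≤ n) :
    trail ι μ x i ≠ trail ι μ x j := by
  intro he
  have := h.trail_cancel hij.le he
  exact h.not_fixed (i := j - i) (by omega) (by omega) (by rw [← this, h.departs])

/-- An equality between times `i` and `j` propagates inwards to `i + 1` and `j - 1`. It ends in a
fixed point of `ι`, or in a fixed point of `μ` reached before time `n`. -/
lemma IsTrail.ne_iota_aux (h : IsTrail ι μ x n) :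
    ∀ k i j : ℕ, j = i + k → j ≤ n → trail ι μ x i ≠ ι (trail ι μ x j) := by
  intro k
  induction k using Nat.strong_induction_on with
  | _ k ih =>
    intro i j hj hjn he
    rcases Nat.eq_zero_or_pos k with rfl | hk
    · obtain rfl : j = i := by omega
      exact h.ne _ he.symm
    · have h1 : trail ι μ x (i + 1) = ι (trail ι μ x (j - 1)) := by
        have h2 := h.iota_trail (j - 1)
        rw [Nat.sub_add_cancel (by omega)] at h2
        rw [trail_succ, he, h.inv_left, h2]
      rcases Nat.lt_or_ge 1 k with hk1 | hk1
      · exact ih (k - 2) (by omega) (i + 1) (j - 1) (by omega) (by omega) h1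
      · obtain rfl : k = 1 := by omega
        subst hj
        rw [Nat.add_sub_cancel] at h1
        refine h.min i (by omega) ?_
        rw [← trail_succ (ι := ι) (μ := μ)]
        exact h1

lemma IsTrail.ne_iota (h : IsTrail ι μ x n) {i j : ℕ} (hi : i ≤ n) (hj : j ≤ n) :
    trail ι μ x i ≠ ι (trail ι μ x j) := by
  rcases le_total i j with hij | hij
  · exact h.ne_iota_aux (j - i) i j (by omega) hj
  · intro he
    refine h.ne_iota_aux (i - j) j i (by omega) hi ?_
    rw [he, h.inv_left]

lemma IsTrail.trail_reverse (h : IsTrail ι μ x n) :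
    ∀ i ≤ n, trail ι μ (ι (trail ι μ x n)) i = ι (trail ι μ x (n - i)) := by
  intro i
  induction i with
  | zero => intro _; rfl
  | succ i ih =>
    intro hi
    rw [trail_succ, ih (by omega), h.inv_left]
    have := h.iota_trail (n - (i + 1))
    rwa [show n - (i + 1) + 1 = n - i by omega] at this

lemma IsTrail.reverse (h : IsTrail ι μ x n) : IsTrail ι μ (ι (trail ι μ x n)) n where
  inv_left := h.inv_left
  inv_right := h.inv_right
  ne := h.ne
  departs := h.returns
  returns := by
    rw [h.trail_reverse n le_rfl, Nat.sub_self, h.inv_left]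
    exact h.departs
  min k hk := by
    rw [h.trail_reverse k hk.le, h.inv_left]
    exact h.not_fixed (by omega) (by omega)

lemma IsTrail.unique (h : IsTrail ι μ x n) {k : ℕ} (h' : IsTrail ι μ x k) : n = k := by
  rcases Nat.lt_trichotomy n k with hl | hl | hl
  · exact absurd h.returns (h'.min n hl)
  · exact hl
  · exact absurd h'.returns (h.min k hl)

/-- After the common steps are cancelled, different starting points would put a fixed point of `μ`
strictly inside the other trajectory. -/
lemma IsTrail.eq_of_trail_eq (h : IsTrail ι μ x n) {y : α} {k : ℕ} (h' : IsTrail ι μ y k)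
    {i j : ℕ} (hi : i ≤ n) (hj : j ≤ k) (he : trail ι μ x i = trail ι μ y j) : x = y := by
  rcases le_total i j with hij | hij
  · have h1 := h.trail_cancel hij he
    rcases Nat.eq_zero_or_pos (j - i) with h0 | h0
    · rw [h1, h0]; rfl
    · exact absurd (by rw [← h1, h.departs]) (h'.not_fixed h0 (by omega))
  · have h1 := h'.trail_cancel hij he.symm
    rcases Nat.eq_zero_or_pos (i - j) with h0 | h0
    · rw [h1, h0]; rfl
    · exact absurd (by rw [← h1, h'.departs]) (h.not_fixed h0 (by omega))

/-- If two trajectories share a point, then they agree up to reversal. -/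
lemma IsTrail.eq_or_eq_end (h : IsTrail ι μ x n) {y : α} {k : ℕ} (h' : IsTrail ι μ y k)
    {i j : ℕ} (hi : i ≤ n) (hj : j ≤ k)
    (he : trail ι μ x i = trail ι μ y j ∨ trail ι μ x i = ι (trail ι μ y j)) :
    x = y ∨ x = ι (trail ι μ y k) := by
  rcases he with he | he
  · exact Or.inl (h.eq_of_trail_eq h' hi hj he)
  · refine Or.inr (h.eq_of_trail_eq h'.reverse (j := k - j) hi (by omega) ?_)
    rw [h'.trail_reverse _ (by omega), he, show k - (k - j) = j by omega]

end Involutions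

end

/-! ### Existence of the paths -/

/-- The pairing of the directions of a face: they turn if all four of them are present. -/
def pairDir (X : Finset Dir) (d : Dir) : Dir :=
  -- With two directions present the sum has one term, the other direction.
  if X = univ then ![1, 0, 3, 2] d else ∑ e ∈ X.erase d, e

lemma pairDir_spec (X : Finset Dir) (d : Dir) (hX : Even X.card) (hd : d ∈ X) :
    pairDir X d ∈ X ∧ pairDir X (pairDir X d) = d ∧ pairDir X d ≠ d ∧
      (X = univ → pairDir X d ≠ d + 2) := by
  revert X d
  decide

section

variable {F : Finset Pt} {n : ℕ} {z : Fin n → Pt} {ε : Fin n → Root} {γ : Finset Pt}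

/-- The directions of the darts of a configuration at a face. -/
def faceDirs (D : Finset Dart) (p : Pt) : Finset Dir := univ.filter fun d => (p, d) ∈ D

lemma mem_faceDirs {D : Finset Dart} {p : Pt} {d : Dir} : d ∈ faceDirs D p ↔ (p, d) ∈ D := by
  simp [faceDirs]

lemma even_faceDirs (hz : Function.Injective z) (hγ : γ ∈ contours F z ε) {x : Dart}
    (hx : x ∈ contourDarts F z ε γ) : Even (faceDirs (contourDarts F z ε γ) x.1).card := by
  have h := (mem_contourDarts.mp hx).1
  rw [faceDirs, card_contourDarts_face hz (mem_contours.mp hγ).2.2.1 h]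
  exact (mem_contours.mp hγ).2.2.2 _ h

lemma pairDir_faceDirs (hz : Function.Injective z) (hγ : γ ∈ contours F z ε)
    (x : contourDarts F z ε γ) {X : Finset Dir} (hX : X = faceDirs (contourDarts F z ε γ) x.1.1) :
    pairDir X x.1.2 ∈ X ∧ pairDir X (pairDir X x.1.2) = x.1.2 ∧ pairDir X x.1.2 ≠ x.1.2 ∧
      (X = univ → pairDir X x.1.2 ≠ x.1.2 + 2) := by
  subst hX
  exact pairDir_spec _ _ (even_faceDirs hz hγ x.2) (mem_faceDirs.mpr x.2)

/-- The involution of the darts that pairs the darts of each face. -/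
def faceInv (hz : Function.Injective z) (hγ : γ ∈ contours F z ε)
    (x : contourDarts F z ε γ) : contourDarts F z ε γ :=
  ⟨(x.1.1, pairDir (faceDirs (contourDarts F z ε γ) x.1.1) x.1.2),
    mem_faceDirs.mp (pairDir_faceDirs hz hγ x rfl).1⟩

lemma faceInv_involutive (hz : Function.Injective z) (hγ : γ ∈ contours F z ε) :
    Function.Involutive (faceInv hz hγ) := by
  intro x
  exact Subtype.ext (Prod.ext rfl (pairDir_faceDirs hz hγ x rfl).2.1)

lemma faceInv_ne (hz : Function.Injective z) (hγ : γ ∈ contours F z ε)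
    (x : contourDarts F z ε γ) : faceInv hz hγ x ≠ x := by
  intro h
  exact (pairDir_faceDirs hz hγ x rfl).2.2.1 (congrArg (fun y => y.1.2) h)

lemma opp_mem_contourDarts (hF : ∀ p ∈ F, Odd p.1 ∧ Odd p.2) (hγ : γ ∈ contours F z ε)
    {x : Dart} (hx : x ∈ contourDarts F z ε γ) (h : mid x ∈ γ) :
    opp x ∈ contourDarts F z ε γ :=
  mem_contourDarts.mpr ⟨(opp_fst_mem hF hγ (hF _ (mem_contourDarts.mp hx).1) h).2,
    Or.inl (by rwa [mid_opp])⟩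

/-- The involution of the darts that exchanges the two halves of each full dual edge. -/
def edgeInv (hF : ∀ p ∈ F, Odd p.1 ∧ Odd p.2) (hγ : γ ∈ contours F z ε)
    (x : contourDarts F z ε γ) : contourDarts F z ε γ :=
  if h : mid x.1 ∈ γ then ⟨opp x.1, opp_mem_contourDarts hF hγ x.2 h⟩ else x

lemma edgeInv_of_mem (hF : ∀ p ∈ F, Odd p.1 ∧ Odd p.2) (hγ : γ ∈ contours F z ε)
    {x : contourDarts F z ε γ} (h : mid x.1 ∈ γ) : (edgeInv hF hγ x).1 = opp x.1 := by
  rw [edgeInv, dif_pos h]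

lemma edgeInv_of_notMem (hF : ∀ p ∈ F, Odd p.1 ∧ Odd p.2) (hγ : γ ∈ contours F z ε)
    {x : contourDarts F z ε γ} (h : mid x.1 ∉ γ) : edgeInv hF hγ x = x := dif_neg h

lemma mid_edgeInv (hF : ∀ p ∈ F, Odd p.1 ∧ Odd p.2) (hγ : γ ∈ contours F z ε)
    (x : contourDarts F z ε γ) : mid (edgeInv hF hγ x).1 = mid x.1 := by
  by_cases h : mid x.1 ∈ γ
  · rw [edgeInv_of_mem hF hγ h, mid_opp]
  · rw [edgeInv_of_notMem hF hγ h]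

lemma edgeInv_involutive (hF : ∀ p ∈ F, Odd p.1 ∧ Odd p.2) (hγ : γ ∈ contours F z ε) :
    Function.Involutive (edgeInv hF hγ) := by
  intro x
  by_cases h : mid x.1 ∈ γ
  · apply Subtype.ext
    rw [edgeInv_of_mem hF hγ (by rwa [mid_edgeInv]), edgeInv_of_mem hF hγ h, opp_opp]
  · rw [edgeInv_of_notMem hF hγ h, edgeInv_of_notMem hF hγ h]

lemma edgeInv_eq_self_iff (hF : ∀ p ∈ F, Odd p.1 ∧ Odd p.2) (hγ : γ ∈ contours F z ε)
    (x : contourDarts F z ε γ) : edgeInv hF hγ x = x ↔ mid x.1 ∉ γ := by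
  refine ⟨fun h h' => ?_, edgeInv_of_notMem hF hγ⟩
  refine opp_ne x.1 ?_
  rw [← edgeInv_of_mem hF hγ h', h]

lemma eq_or_eq_edgeInv (hF : ∀ p ∈ F, Odd p.1 ∧ Odd p.2) (hz : Function.Injective z)
    (hγ : γ ∈ contours F z ε) {x y : contourDarts F z ε γ} (h : mid x.1 = mid y.1) :
    x = y ∨ x = edgeInv hF hγ y := by
  by_cases hy : mid y.1 ∈ γ
  · rcases eq_or_eq_opp (hF _ (mem_contourDarts.mp x.2).1) (hF _ (mem_contourDarts.mp y.2).1) h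
      with h' | h'
    · exact Or.inl (Subtype.ext h')
    · exact Or.inr (Subtype.ext (by rw [edgeInv_of_mem hF hγ hy, h']))
  · left
    rcases (mem_contourDarts.mp y.2).2 with h' | ⟨j, hj⟩
    · exact absurd h' hy
    · have hm : mid y.1 = z j := by rw [hj, mid_endDart]
      exact Subtype.ext ((eq_endDart hz hγ x.2 (h.trans hm)).trans hj.symm)

/-- The dart of the half-edge at `z j` as a dart of the configuration. -/
def endPt (hγ : γ ∈ contours F z ε) (j : Fin n) : contourDarts F z ε γ :=
  ⟨endDart z ε j, endDart_mem hγ j⟩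

lemma edgeInv_endPt (hF : ∀ p ∈ F, Odd p.1 ∧ Odd p.2) (hγ : γ ∈ contours F z ε) (j : Fin n) :
    edgeInv hF hγ (endPt hγ j) = endPt hγ j := by
  rw [edgeInv_eq_self_iff]
  simp only [endPt, mid_endDart]
  exact (mem_contours.mp hγ).2.2.1 j

lemma exists_endPt (hF : ∀ p ∈ F, Odd p.1 ∧ Odd p.2) (hγ : γ ∈ contours F z ε)
    {x : contourDarts F z ε γ} (h : edgeInv hF hγ x = x) : ∃ j, endPt hγ j = x := by
  rw [edgeInv_eq_self_iff] at h
  rcases (mem_contourDarts.mp x.2).2 with h' | ⟨j, hj⟩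
  · exact absurd h' h
  · exact ⟨j, Subtype.ext hj.symm⟩

lemma endPt_injective (hz : Function.Injective z) (hγ : γ ∈ contours F z ε) :
    Function.Injective (endPt hγ) := fun _ _ h =>
  endDart_injective hz (congrArg Subtype.val h)

lemma Fin.exists_castSucc_or_last {k : ℕ} (i : Fin (k + 1)) :
    (∃ j : Fin k, i = j.castSucc) ∨ i = Fin.last k := by
  induction i using Fin.lastCases with
  | last => exact Or.inr rfl
  | cast j => exact Or.inl ⟨j, rfl⟩

/-- A trajectory of the two involutions is a strand of the configuration. -/
theorem exists_strand (hF : ∀ p ∈ F, Odd p.1 ∧ Odd p.2) (hz : Function.Injective z)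
    (hγ : γ ∈ contours F z ε) {s t : Fin n} {k : ℕ}
    (h : IsTrail (faceInv hz hγ) (edgeInv hF hγ) (endPt hγ s) k)
    (ht : faceInv hz hγ (trail (faceInv hz hγ) (edgeInv hF hγ) (endPt hγ s) k) = endPt hγ t) :
    ∃ π : Strand z ε γ s t, ∀ q ∈ Set.range π.edge, ∃ i ≤ k,
      mid (trail (faceInv hz hγ) (edgeInv hF hγ) (endPt hγ s) i).1 = q ∨
      mid (faceInv hz hγ (trail (faceInv hz hγ) (edgeInv hF hγ) (endPt hγ s) i)).1 = q := by
  set ι := faceInv hz hγ with hι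
  set μ := edgeInv hF hγ with hμ
  set T := trail ι μ (endPt hγ s) with hT
  have hTs : ∀ i, T (i + 1) = μ (ι (T i)) := fun i => trail_succ _ _
  have hopp : ∀ i < k, (T (i + 1)).1 = opp (ι (T i)).1 := by
    intro i hi
    rw [hTs]
    refine edgeInv_of_mem hF hγ ?_
    by_contra hn
    exact h.min i hi (edgeInv_of_notMem hF hγ hn)
  have hmid : ∀ i, mid (T (i + 1)).1 = mid (ι (T i)).1 := by
    intro i
    rw [hTs]
    exact mid_edgeInv hF hγ _
  -- After the starting half-edge, the strand leaves each face through the partner `ι (T i)` of the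
  -- dart by which it came. Darts point away from their face, so the arrival direction is the
  -- reversed one, `+ 2`.
  let edge : Fin (k + 2) → Pt :=
    Fin.cons (mid (T 0).1) fun i : Fin (k + 1) => mid (ι (T i)).1
  let dir : Fin (k + 2) → Dir := Fin.cons ((T 0).1.2 + 2) fun i : Fin (k + 1) => (ι (T i)).1.2
  have hedge : ∀ i : Fin (k + 1), edge i.castSucc = mid (T i).1 := by
    intro i
    induction i using Fin.cases with
    | zero => rfl
    | succ i =>
      rw [← Fin.succ_castSucc]
      change mid (ι (T _)).1 = _
      rw [← hmid]
      rfl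
  have hdir : ∀ i : Fin (k + 1), dir i.castSucc = (T i).1.2 + 2 := by
    intro i
    induction i using Fin.cases with
    | zero => rfl
    | succ i =>
      rw [← Fin.succ_castSucc]
      change (ι (T i)).1.2 = (T (i + 1)).1.2 + 2
      rw [hopp i i.2]
      exact (add_two_add_two _).symm
  have hface : ∀ i : Fin (k + 1), edge i.castSucc + halfStep (dir i.castSucc) = (T i).1.1 := by
    intro i
    rw [hedge, hdir, halfStep_add_two, mid]
    abel
  have hlast : edge (Fin.last (k + 1)) = mid (ι (T k)).1 := rfl
  have hne : ∀ i j : Fin (k + 2), i < j → edge i ≠ edge j := by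
    intro i j hij he
    obtain ⟨i, rfl⟩ | rfl := Fin.exists_castSucc_or_last i
    · rw [hedge] at he
      obtain ⟨j, rfl⟩ | rfl := Fin.exists_castSucc_or_last j
      · rw [hedge] at he
        have hij' : i.1 < j.1 := hij
        rcases eq_or_eq_edgeInv hF hz hγ he with h' | h'
        · exact h.injOn hij' (by omega) h'
        · obtain ⟨l, hl⟩ : ∃ l, j.1 = l + 1 := ⟨j.1 - 1, by omega⟩
          rw [hl] at h'
          exact h.ne_iota (by omega) (by omega) (h'.trans (h.iota_trail l))
      · rw [hlast] at he
        rcases eq_or_eq_edgeInv hF hz hγ he with h' | h'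
        · exact h.ne_iota (by omega) le_rfl h'
        · exact h.ne_iota (by omega) le_rfl (h'.trans h.returns)
    · exact absurd hij (Fin.le_last j).not_gt
  refine ⟨⟨k, edge, dir, ?_, ?_, ?_, ?_, ?_, ?_, ?_, ?_⟩, ?_⟩
  · exact mid_endDart _
  · exact add_two_add_two _
  · rw [hlast, ht]
    exact mid_endDart _
  · change (ι (T k)).1.2 = _
    rw [ht]
    rfl
  · intro i
    rw [hface]
    rfl
  · intro i hi hi'
    obtain ⟨i, rfl⟩ | rfl := Fin.exists_castSucc_or_last i
    · rw [hedge]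
      by_contra hn
      have hi0 : 0 < i.1 := by
        rw [Nat.pos_iff_ne_zero]
        intro h0
        exact hi (Fin.ext h0)
      exact h.not_fixed hi0 (by omega) (edgeInv_of_notMem hF hγ hn)
    · exact absurd rfl hi'
  · intro i j he
    rcases lt_trichotomy i j with hl | hl | hl
    · exact absurd he (hne i j hl)
    · exact hl
    · exact absurd he.symm (hne j i hl)
  · intro i h4
    rw [hface, ← card_contourDarts_face hz (mem_contours.mp hγ).2.2.1 (mem_contourDarts.mp (T i).2).1] at h4
    rw [hdir]
    exact (pairDir_faceDirs hz hγ (T i) rfl).2.2.2 (Finset.eq_univ_of_card _ h4)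
  · rintro q ⟨i, rfl⟩
    obtain ⟨i, rfl⟩ | rfl := Fin.exists_castSucc_or_last i
    · exact ⟨i, Nat.lt_succ_iff.mp i.2, Or.inl (hedge i).symm⟩
    · exact ⟨k, le_rfl, Or.inr hlast.symm⟩

end

/-- Every configuration is a union of loops and strands that link the marked points. -/
theorem nonempty_pathSystem {F : Finset Pt} {m : ℕ} {z : Fin (2 * m) → Pt}
    {ε : Fin (2 * m) → Root} {γ : Finset Pt} (hF : ∀ p ∈ F, Odd p.1 ∧ Odd p.2)
    (hz : Function.Injective z) (hγ : γ ∈ contours F z ε) : Nonempty (PathSystem z ε γ) := by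
  set ι := faceInv hz hγ with hι
  set μ := edgeInv hF hγ with hμ
  choose k hk using fun j => exists_isTrail (faceInv_involutive hz hγ)
    (edgeInv_involutive hF hγ) (faceInv_ne hz hγ) (edgeInv_endPt hF hγ j)
  choose σ hσ using fun j => exists_endPt hF hγ (hk j).returns
  -- The reversed trajectory of `j` is the trajectory of `σ j`, which therefore ends at `j`.
  have hσσ : ∀ j, σ (σ j) = j := by
    intro j
    apply endPt_injective hz hγ
    have h1 := (hk j).reverse
    rw [← hσ j] at h1
    have h2 := (hk (σ j)).unique h1
    rw [hσ (σ j), h2, hσ j, (hk j).trail_reverse _ le_rfl, Nat.sub_self, (hk j).inv_left]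
    rfl
  have hne : ∀ j, σ j ≠ j := by
    intro j h
    refine (hk j).ne_iota (Nat.zero_le _) (le_refl (k j)) ?_
    rw [← hσ j, h]
    rfl
  choose π hπ using fun j => exists_strand hF hz hγ (hk j) (hσ j).symm
  have hdisj : ∀ i j, i ≠ j → i ≠ σ j →
      Disjoint (Set.range (π i).edge) (Set.range (π j).edge) := by
    intro i j hij hij'
    rw [Set.disjoint_left]
    intro q hqi hqj
    obtain ⟨u, hu, hu'⟩ := hπ i q hqi
    obtain ⟨v, hv, hv'⟩ := hπ j q hqj
    -- The darts of a trajectory and their partners contain every dart that shares a midpoint with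
    -- one of them.
    have hcl : ∀ (l : Fin (2 * m)) (w : ℕ), w ≤ k l → ∀ x : contourDarts F z ε γ,
        (mid (trail ι μ (endPt hγ l) w).1 = mid x.1 ∨
          mid (ι (trail ι μ (endPt hγ l) w)).1 = mid x.1) →
        ∃ w' ≤ k l, x = trail ι μ (endPt hγ l) w' ∨ x = ι (trail ι μ (endPt hγ l) w') := by
      intro l w hw x hx
      rcases hx with hx | hx
      · rcases eq_or_eq_edgeInv hF hz hγ hx.symm with h | h
        · exact ⟨w, hw, Or.inl h⟩
        · rcases Nat.eq_zero_or_pos w with rfl | hpos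
          · exact ⟨0, hw, Or.inl (h.trans (hk l).departs)⟩
          · obtain ⟨w, rfl⟩ : ∃ w', w = w' + 1 := ⟨w - 1, by omega⟩
            rw [(hk l).iota_trail] at h
            exact ⟨w, by omega, Or.inr h⟩
      · rcases eq_or_eq_edgeInv hF hz hγ hx.symm with h | h
        · exact ⟨w, hw, Or.inr h⟩
        · rcases Nat.lt_or_ge w (k l) with hlt | hge
          · exact ⟨w + 1, hlt, Or.inl (h.trans (trail_succ _ _).symm)⟩
          · obtain rfl : w = k l := by omega
            exact ⟨k l, le_rfl, Or.inr (h.trans (hk l).returns)⟩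
    have hend : ∃ u' ≤ k i, ∃ v' ≤ k j,
        trail ι μ (endPt hγ i) u' = trail ι μ (endPt hγ j) v' ∨
        trail ι μ (endPt hγ i) u' = ι (trail ι μ (endPt hγ j) v') := by
      rcases hu' with hu' | hu'
      · obtain ⟨v', hv', h⟩ := hcl j v hv (trail ι μ (endPt hγ i) u) (by rw [hu']; exact hv')
        exact ⟨u, hu, v', hv', h⟩
      · obtain ⟨v', hv', h⟩ := hcl j v hv (ι (trail ι μ (endPt hγ i) u)) (by
          rw [hu']; exact hv')
        refine ⟨u, hu, v', hv', ?_⟩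
        rcases h with h | h
        · right
          exact ((hk i).inv_left _).symm.trans (congrArg ι h)
        · left
          exact (hk i).inv_left.injective h
    obtain ⟨u', hu', v', hv', h⟩ := hend
    rcases (hk i).eq_or_eq_end (hk j) hu' hv' h with h | h
    · exact hij (endPt_injective hz hγ h)
    · rw [← hσ j] at h
      exact hij' (endPt_injective hz hγ h)
  -- Each pair is represented by its smaller index, as the orientation of the paths requires.
  let A : Finset (Fin (2 * m)) := univ.filter fun j => j < σ j
  have hA : A.card = m := by
    have h1 : (univ.filter fun j => ¬ j < σ j).card = A.card := by
      refine Finset.card_bij' (fun j _ => σ j) (fun j _ => σ j) ?_ ?_ ?_ ?_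
      · intro j hj
        simp only [mem_filter, mem_univ, true_and, A, hσσ] at hj ⊢
        exact lt_of_le_of_ne (not_lt.mp hj) (hne j)
      · intro j hj
        simp only [mem_filter, mem_univ, true_and, A, hσσ] at hj ⊢
        exact hj.not_gt
      · intro j _; exact hσσ j
      · intro j _; exact hσσ j
    have h2 := Finset.card_filter_add_card_filter_not (s := univ) fun j => j < σ j
    rw [h1, Finset.card_univ, Fintype.card_fin] at h2
    have h3 : A.card + A.card = 2 * m := h2
    omega
  let e : Fin m ≃ A := (A.equivFinOfCardEq hA).symm
  have he : ∀ l, ((e l : Fin (2 * m))) < σ (e l) := fun l => (mem_filter.mp (e l).2).2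
  have hsd : ∀ i j, (e i : Fin (2 * m)) ≠ σ (e j) := by
    intro i j h
    have h1 := he i
    have h2 := he j
    rw [← h] at h2
    rw [h, hσσ, ← h] at h1
    exact absurd h1 h2.not_gt
  refine ⟨⟨fun l => (e l : Fin (2 * m)), fun l => σ (e l), he, ?_, fun l => π (e l), ?_⟩⟩
  · rw [Fintype.bijective_iff_injective_and_card]
    constructor
    · refine Function.Injective.sumElim ?_ ?_ hsd
      · intro i j h
        exact e.injective (Subtype.ext h)
      · intro i j h
        refine e.injective (Subtype.ext ?_)
        have := congrArg σ h
        simpa only [hσσ] using this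
    · simp [two_mul]
  · intro i j hij
    exact hdisj _ _ (fun h => hij (e.injective (Subtype.ext h))) (hsd i j)

/-! ### Time-ordered products as products over rows -/

section

section TimeOrder

variable {M : Type*} [Monoid M]

/-- The product `f (t - 1) * ⋯ * f 1 * f 0`. -/
def timeProd (f : ℕ → M) : ℕ → M
  | 0 => 1
  | t + 1 => f t * timeProd f t

lemma timeProd_eq_one {f : ℕ → M} {t : ℕ} (h : ∀ j < t, f j = 1) : timeProd f t = 1 := by
  induction t with
  | zero => rfl
  | succ t ih => rw [timeProd, h t (by omega), ih fun j hj => h j (by omega), one_mul]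

lemma prod_reverse_ofFn {n : ℕ} (f : ℕ → M) :
    (List.ofFn fun j : Fin n => f j).reverse.prod = timeProd f n := by
  induction n with
  | zero => simp [timeProd]
  | succ n ih =>
    rw [List.ofFn_succ', List.concat_eq_append, List.reverse_append, List.prod_append]
    simp only [Fin.val_castSucc, ih]
    simp [timeProd]

/-- The operators `V` alternating with the operators `g 0, g 1, …, g Y` of the rows. -/
def layered (V : M) (g : ℕ → M) : ℕ → M
  | 0 => g 0
  | Y + 1 => g (Y + 1) * V * layered V g Y

lemma layered_congr {V : M} {g g' : ℕ → M} {Y : ℕ} (h : ∀ i ≤ Y, g i = g' i) :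
    layered V g Y = layered V g' Y := by
  induction Y with
  | zero => exact h 0 le_rfl
  | succ Y ih => rw [layered, layered, h _ le_rfl, ih fun i hi => h i (by omega)]

lemma layered_add {V : M} {g : ℕ → M} {Y : ℕ} (h : ∀ i, Y < i → g i = 1) (k : ℕ) :
    layered V g (Y + k) = V ^ k * layered V g Y := by
  induction k with
  | zero => simp
  | succ k ih =>
    rw [← add_assoc, layered, h _ (by omega), ih, pow_succ', one_mul, mul_assoc]

/-- The product of the operators in row `Y` among the first `t`. -/
def rowProd (y : ℕ → ℕ) (A : ℕ → M) (Y t : ℕ) : M :=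
  timeProd (fun j => if y j = Y then A j else 1) t

lemma rowProd_succ (y : ℕ → ℕ) (A : ℕ → M) (Y t : ℕ) :
    rowProd y A Y (t + 1) = (if y t = Y then A t else 1) * rowProd y A Y t := rfl

/-- The powers of `V` and `W` between consecutive operators combine to the passage between their
rows. In the induction the new operator acts in the highest row used so far; above it there are only
powers of `V`. -/
theorem pow_mul_timeProd {V W : M} (hVW : V * W = 1) (hWV : W * V = 1) (y : ℕ → ℕ)
    (A : ℕ → M) (N : ℕ) (t : ℕ) (hN : ∀ j < t, y j ≤ N)
    (hmono : ∀ i j, i < j → j < t → y i ≤ y j) :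
    V ^ N * timeProd (fun j => W ^ y j * A j * V ^ y j) t =
      layered V (fun Y => rowProd y A Y t) N := by
  have hcomm : Commute V W := hVW.trans hWV.symm
  have hpow : ∀ k, V ^ k * W ^ k = 1 := fun k => by rw [← hcomm.mul_pow, hVW, one_pow]
  have hpow' : ∀ k, W ^ k * V ^ k = 1 := fun k => by rw [← hcomm.symm.mul_pow, hWV, one_pow]
  induction t with
  | zero =>
    have := layered_add (V := V) (g := fun Y => rowProd y A Y 0) (Y := 0) (fun i _ => rfl) N
    rw [zero_add] at this
    rw [this]
    simp [layered, rowProd, timeProd]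
  | succ t ih =>
    have ih := ih (fun j hj => hN j (by omega)) fun i j hij hj => hmono i j hij (by omega)
    obtain ⟨k, hk⟩ := Nat.exists_eq_add_of_le (hN t (by omega))
    have h1 : ∀ i, y t < i → rowProd y A i t = 1 := fun i hi =>
      timeProd_eq_one fun j hj => if_neg (by have := hmono j t hj (by omega); omega)
    have h2 : ∀ i, y t < i → rowProd y A i (t + 1) = 1 := fun i hi => by
      rw [rowProd_succ, if_neg hi.ne, one_mul, h1 i hi]
    have h3 : layered V (fun Y => rowProd y A Y (t + 1)) (y t) =
        A t * layered V (fun Y => rowProd y A Y t) (y t) := by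
      rcases Nat.eq_zero_or_pos (y t) with h0 | h0
      · rw [h0, layered, layered, rowProd_succ, if_pos h0]
      · obtain ⟨Y, hY⟩ : ∃ Y, y t = Y + 1 := ⟨y t - 1, by omega⟩
        rw [hY, layered, layered, rowProd_succ, if_pos hY,
          layered_congr (g' := fun Y => rowProd y A Y t)]
        · simp only [mul_assoc]
        · intro i hi
          rw [rowProd_succ, if_neg (by omega), one_mul]
    have h4 : V ^ y t * timeProd (fun j => W ^ y j * A j * V ^ y j) t =
        layered V (fun Y => rowProd y A Y t) (y t) := by
      rw [hk, layered_add h1, add_comm, pow_add, mul_assoc] at ih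
      have := congrArg (W ^ k * ·) ih
      simpa only [← mul_assoc, hpow', one_mul] using this
    rw [timeProd, hk, layered_add h2, h3, ← h4, add_comm, pow_add]
    have := hpow (y t)
    calc V ^ k * V ^ y t * (W ^ y t * A t * V ^ y t *
          timeProd (fun j => W ^ y j * A j * V ^ y j) t)
        = V ^ k * (V ^ y t * W ^ y t) * A t * V ^ y t *
          timeProd (fun j => W ^ y j * A j * V ^ y j) t := by simp only [mul_assoc]
      _ = _ := by rw [this]; simp only [mul_assoc, mul_one]

end TimeOrder

/-- The entries of a layered product of monomial matrices, as a sum over histories. -/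
theorem layered_apply {S : Type*} [Fintype S] [DecidableEq S] (V : Matrix S S ℂ)
    (g : ℕ → Matrix S S ℂ) (f : ℕ → S → S) (w : ℕ → S → ℂ)
    (hg : ∀ Y τ σ, g Y τ σ = if τ = f Y σ then w Y σ else 0) (N : ℕ) (τ σ : S) :
    layered V g N τ σ = ∑ h : Fin (N + 1) → S,
      if h 0 = σ ∧ f N (h (Fin.last N)) = τ then
        (∏ i : Fin N, V (h i.succ) (f i (h i.castSucc))) * ∏ i : Fin (N + 1), w i (h i)
      else 0 := by
  induction N generalizing τ with
  | zero =>
    rw [layered, hg, ← (Equiv.funUnique (Fin 1) S).symm.sum_comp]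
    simp only [Fin.last_zero, univ_eq_empty, prod_empty, one_mul]
    rw [Finset.sum_eq_single σ]
    · simp [eq_comm]
    · intro ρ _ hρ
      simp [hρ]
    · simp
  | succ N ih =>
    rw [layered, Matrix.mul_assoc, Matrix.mul_apply]
    rw [← (Fin.snocEquiv fun _ : Fin (N + 2) => S).sum_comp, Fintype.sum_prod_type]
    refine Finset.sum_congr rfl fun ρ _ => ?_
    rw [hg, Matrix.mul_apply]
    simp_rw [ih]
    simp only [Fin.snocEquiv, Equiv.coe_fn_mk]
    have h0 : ∀ h : Fin (N + 1) → S, (Fin.snoc h ρ : Fin (N + 2) → S) 0 = h 0 := fun h => by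
      rw [← Fin.castSucc_zero, Fin.snoc_castSucc]
    simp only [Finset.mul_sum]
    rw [Finset.sum_comm]
    refine Finset.sum_congr rfl fun h _ => ?_
    simp only [h0, Fin.prod_univ_castSucc (n := N + 1), Fin.snoc_last, Fin.snoc_castSucc,
      Fin.val_castSucc, Fin.val_last]
    have hV : ∏ i : Fin (N + 1), V ((Fin.snoc h ρ : Fin (N + 2) → S) i.succ) (f i (h i)) =
        (∏ i : Fin N, V (h i.succ) (f i (h i.castSucc))) * V ρ (f N (h (Fin.last N))) := by
      rw [Fin.prod_univ_castSucc]
      simp only [Fin.succ_castSucc, Fin.snoc_castSucc, Fin.succ_last, Fin.snoc_last,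
        Fin.val_castSucc, Fin.val_last]
    rw [hV, Finset.sum_eq_single (f N (h (Fin.last N)))]
    · by_cases hτ : τ = f (N + 1) ρ
      · by_cases hσ : h 0 = σ
        · simp only [hτ, hσ, true_and, if_true]
          ring
        · simp [hσ]
      · simp [hτ, Ne.symm hτ]
    · intro ρ' _ hρ'
      simp [hρ'.symm]
    · simp

end

/-! ### Matrix entries of the fermions and of the transfer matrix -/

section

variable {a b : ℤ}

/-- The row operator that gives rise to the fermion of an arrow. -/
def arrowRow : Arrow → DualSite a b → RowOp a b
  | Arrow.up, k => (1 / 2 : ℂ) • (psiBarRow k - psiRow k)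
  | Arrow.down, k => (Complex.I / 2) • (psiRow k + psiBarRow k)

lemma psiArrow_eq {N : ℕ} (β : ℝ) (r : Arrow) (z : HEdge a b N) :
    psiArrow β r z = (transferMatrix a b β)⁻¹ ^ (z.2 : ℕ) * arrowRow r z.1 *
      transferMatrix a b β ^ (z.2 : ℕ) := by
  cases r <;> simp only [psiArrow, psi, psiBar, evolve, arrowRow, Matrix.mul_add, Matrix.add_mul,
    Matrix.mul_sub, Matrix.sub_mul, Matrix.mul_smul, Matrix.smul_mul]

/-- The product of the two spins at an edge that the fermion of an arrow acts upon. -/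
def arrowUnit : Arrow → ℤˣ
  | Arrow.up => 1
  | Arrow.down => -1

/-- The coefficient of the fermion of an arrow. -/
def amp (r : Arrow) (k : DualSite a b) (σ : RowConfig a b) : ℂ :=
  if σ k.left * σ k.right = arrowUnit r then arrowSign r * lam⁻¹ * spinVal (σ k.right) else 0

lemma sqrt_two_mul_lam : (Real.sqrt 2 : ℂ) * lam = 1 + Complex.I := by
  have h2 : (Real.sqrt 2 : ℂ) * (Real.sqrt 2 : ℂ) = 2 := by
    rw [← Complex.ofReal_mul, Real.mul_self_sqrt (by norm_num)]; norm_num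
  have h : lam = Real.sqrt 2 / 2 + Real.sqrt 2 / 2 * Complex.I := by
    rw [lam, mul_comm, show ((Real.pi : ℂ) / 4) = ((Real.pi / 4 : ℝ) : ℂ) by push_cast; ring,
      Complex.exp_mul_I, ← Complex.ofReal_cos, ← Complex.ofReal_sin, Real.cos_pi_div_four,
      Real.sin_pi_div_four]
    push_cast
    ring
  rw [h]
  linear_combination (1 + Complex.I) / 2 * h2

/-- In these combinations `p` and `q` enter with equal weights up to sign: the entry is a constant
times the sum (`up`) or difference (`down`) of the right and left spins. It therefore vanishes
unless these are equal, respectively opposite. -/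
lemma arrowRow_apply (r : Arrow) (k : DualSite a b) (τ σ : RowConfig a b) :
    arrowRow r k τ σ = if τ = flipLeft k σ then amp r k σ else 0 := by
  have hs : (Real.sqrt 2 : ℂ) ≠ 0 := by
    simp
  have h2 : (Real.sqrt 2 : ℂ) * (Real.sqrt 2 : ℂ) = 2 := by
    rw [← Complex.ofReal_mul, Real.mul_self_sqrt (by norm_num)]; norm_num
  have hI := Complex.I_sq
  have hl : lam⁻¹ = (1 - Complex.I) / (Real.sqrt 2 : ℂ) := by
    rw [eq_div_iff hs, inv_mul_eq_div, div_eq_iff lam_ne_zero]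
    apply mul_left_cancel₀ hs
    linear_combination (-(1 - Complex.I)) * sqrt_two_mul_lam + h2 + hI
  have h1 : (-1 : ℤˣ) ≠ 1 := by decide
  have h1' : (1 : ℤˣ) ≠ -1 := by decide
  by_cases h : τ = flipLeft k σ
  · rcases Int.units_eq_one_or (σ k.left) with hL | hL <;>
    rcases Int.units_eq_one_or (σ k.right) with hR | hR <;>
    cases r <;>
    simp [arrowRow, psiBarRow, psiRow, opP, opQ, h, amp, hL, hR, arrowUnit, arrowSign, spinVal,
      h1, h1', hl] <;> field_simp <;>
    first
    | linear_combination hI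
    | linear_combination (-1 : ℂ) * hI
    | linear_combination (Complex.I - 2) * hI
    | linear_combination (2 - Complex.I) * hI
  · cases r <;> simp [arrowRow, psiBarRow, psiRow, opP, opQ, h]

/-- The operator that flips all spins to the left of each of the given points of a row. -/
def flipAll (k : ℕ → DualSite a b) (y : ℕ → ℕ) (Y t : ℕ) (σ : RowConfig a b) : RowConfig a b :=
  fun x => (∏ j ∈ (range t).filter (fun j => y j = Y),
    if (x : ℤ) ≤ (k j : ℤ) then (-1 : ℤˣ) else 1) * σ x

lemma flipAll_succ (k : ℕ → DualSite a b) (y : ℕ → ℕ) (Y t : ℕ) (σ : RowConfig a b) :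
    flipAll k y Y (t + 1) σ =
      if y t = Y then flipLeft (k t) (flipAll k y Y t σ) else flipAll k y Y t σ := by
  funext x
  split_ifs with h
  · simp only [flipAll, flipLeft, Finset.range_add_one, Finset.filter_insert, if_pos h]
    rw [Finset.prod_insert (by simp)]
    split_ifs <;> simp
  · simp only [flipAll, Finset.range_add_one, Finset.filter_insert, if_neg h]

lemma rowProd_apply (k : ℕ → DualSite a b) (r : ℕ → Arrow) (y : ℕ → ℕ) (Y t : ℕ)
    (τ σ : RowConfig a b) :
    rowProd y (fun j => arrowRow (r j) (k j)) Y t τ σ =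
      if τ = flipAll k y Y t σ then
        ∏ j ∈ (range t).filter (fun j => y j = Y), amp (r j) (k j) (flipAll k y Y j σ)
      else 0 := by
  induction t generalizing τ with
  | zero =>
    have h : flipAll k y Y 0 σ = σ := by
      funext x; simp [flipAll]
    rw [h]
    simp [rowProd, timeProd, Matrix.one_apply]
  | succ t ih =>
    rw [rowProd_succ, flipAll_succ]
    by_cases h : y t = Y
    · rw [if_pos h, if_pos h, Matrix.mul_apply]
      simp_rw [ih, arrowRow_apply]
      rw [Finset.sum_eq_single (flipAll k y Y t σ)]
      · simp only [if_true, Finset.range_add_one, Finset.filter_insert, if_pos h]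
        rw [Finset.prod_insert (by simp)]
        split_ifs <;> simp
      · intro ρ _ hρ
        simp [hρ]
      · simp
    · rw [if_neg h, if_neg h, one_mul, ih]
      simp only [Finset.range_add_one, Finset.filter_insert, if_neg h]

/-- The Boltzmann weight `q` of two opposite spins. -/
def wt (q : ℝ) (u : ℤˣ) : ℝ := if u = 1 then 1 else q

lemma exp_mul_spinValR (c : ℝ) (u v : ℤˣ) :
    Real.exp (c * (spinValR u * spinValR v)) = Real.exp c * wt (Real.exp (-(2 * c))) (u * v) := by
  have h1 : (-1 : ℤˣ) ≠ 1 := by decide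
  rcases Int.units_eq_one_or u with rfl | rfl <;> rcases Int.units_eq_one_or v with rfl | rfl <;>
    simp [spinValR, wt, h1, ← Real.exp_add] <;> ring

/-- The weight of equal spins is taken out. A disagreement then costs `Real.exp (-β)` in each
horizontal square root and its square vertically: one factor per dart of the domain wall. -/
lemma transferMatrix_apply (β : ℝ) (σ ρ : RowConfig a b) :
    transferMatrix a b β σ ρ =
      if ∀ x : Site a b, ((x : ℤ) = a ∨ (x : ℤ) = b) → σ x = ρ x then
        ((Real.exp (β / 2) ^ Fintype.card (DualSite a b) *
          Real.exp β ^ Fintype.card (Site a b) *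
          Real.exp (β / 2) ^ Fintype.card (DualSite a b) : ℝ) : ℂ) *
        (((∏ k : DualSite a b, wt (Real.exp (-β)) (σ k.left * σ k.right)) *
          (∏ x : Site a b, wt (Real.exp (-β) ^ 2) (σ x * ρ x)) *
          ∏ k : DualSite a b, wt (Real.exp (-β)) (ρ k.left * ρ k.right) : ℝ) : ℂ)
      else 0 := by
  have e1 : Real.exp (-(2 * (β / 2))) = Real.exp (-β) := by congr 1; ring
  have e2 : Real.exp (-(2 * β)) = Real.exp (-β) ^ 2 := by
    rw [← Real.exp_nat_mul]; congr 1; push_cast; ring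
  rw [transferMatrix, VhorHalf, Matrix.mul_diagonal, Matrix.diagonal_mul, Vvert, Matrix.of_apply]
  split_ifs with h
  · rw [← Complex.ofReal_mul, ← Complex.ofReal_mul, ← Complex.ofReal_mul]
    congr 1
    simp only [Finset.mul_sum, Real.exp_sum, exp_mul_spinValR, e1, e2, Finset.prod_mul_distrib,
      Finset.prod_const, Finset.card_univ]
    ring
  · simp

lemma prod_matrix_mul {ι S : Type*} [Fintype ι] [DecidableEq ι] [Fintype S] [DecidableEq S]
    (u v : ι → S → S → ℂ) (h : ∀ x s r, ∑ t, u x s t * v x t r = if s = r then 1 else 0) :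
    (Matrix.of fun σ ρ : ι → S => ∏ x, u x (σ x) (ρ x)) *
      (Matrix.of fun σ ρ : ι → S => ∏ x, v x (σ x) (ρ x)) = 1 := by
  ext σ ρ
  rw [Matrix.mul_apply]
  simp only [Matrix.of_apply, ← Finset.prod_mul_distrib]
  rw [← Fintype.prod_sum (fun x t => u x (σ x) t * v x t (ρ x)), Matrix.one_apply]
  simp only [h]
  by_cases hσ : σ = ρ
  · simp [hσ]
  · rw [if_neg hσ]
    obtain ⟨x, hx⟩ := Function.ne_iff.mp hσ
    exact Finset.prod_eq_zero (mem_univ x) (if_neg hx)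

/-- The matrix is a tensor product over the sites: diagonal blocks `A` at the frozen ends, blocks
with entries `A` and `B` inside. Each is inverted explicitly, using `A * B = 1` at the ends and,
inside, `A * A ≠ B * B`, which holds as `β` is positive. -/
lemma isUnit_det_Vvert (a b : ℤ) {β : ℝ} (hβ : 0 < β) : IsUnit (Vvert a b β).det := by
  set A : ℂ := (Real.exp β : ℂ) with hA
  set B : ℂ := (Real.exp (-β) : ℂ) with hB
  have hAB : A * B = 1 := by
    rw [hA, hB, ← Complex.ofReal_mul, ← Real.exp_add, add_neg_cancel, Real.exp_zero,
      Complex.ofReal_one]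
  have hne : A * A - B * B ≠ 0 := by
    rw [hA, hB, ← Complex.ofReal_mul, ← Complex.ofReal_mul, ← Complex.ofReal_sub,
      ← Real.exp_add, ← Real.exp_add]
    rw [Complex.ofReal_ne_zero]
    have : Real.exp (-β + -β) < Real.exp (β + β) := Real.exp_lt_exp.mpr (by linarith)
    linarith
  obtain ⟨C, hC⟩ : ∃ C, (A * A - B * B) * C = 1 := ⟨_, mul_inv_cancel₀ hne⟩
  let e : Site a b → Prop := fun x => (x : ℤ) = a ∨ (x : ℤ) = b
  let u : Site a b → ℤˣ → ℤˣ → ℂ := fun x s t =>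
    if s = t then A else if e x then 0 else B
  let v : Site a b → ℤˣ → ℤˣ → ℂ := fun x s t =>
    if e x then (if s = t then B else 0) else (if s = t then A else -B) * C
  have hu : Vvert a b β = Matrix.of fun σ ρ : Site a b → ℤˣ => ∏ x, u x (σ x) (ρ x) := by
    ext σ ρ
    rw [Vvert, Matrix.of_apply, Matrix.of_apply]
    split_ifs with h
    · rw [Finset.mul_sum, Real.exp_sum, Complex.ofReal_prod]
      refine Finset.prod_congr rfl fun x _ => ?_
      simp only [u]
      have h1 : (-1 : ℤˣ) ≠ 1 := by decide
      have h1' : (1 : ℤˣ) ≠ -1 := by decide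
      by_cases hx : e x
      · rw [h x hx, if_pos rfl, hA]
        rcases Int.units_eq_one_or (ρ x) with hs | hs <;> simp [hs, spinValR]
      · rw [if_neg hx]
        rcases Int.units_eq_one_or (σ x) with hs | hs <;>
          rcases Int.units_eq_one_or (ρ x) with hs' | hs' <;>
          simp [hs, hs', spinValR, hA, hB, h1, h1']
    · push Not at h
      obtain ⟨x, hx, hne⟩ := h
      symm
      refine Finset.prod_eq_zero (mem_univ x) ?_
      simp only [u]
      rw [if_neg hne, if_pos hx]
  have huv := prod_matrix_mul u v (by
    intro x s r
    have hun : (univ : Finset ℤˣ) = {1, -1} := rfl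
    have h1 : (1 : ℤˣ) ≠ -1 := by decide
    rw [hun, Finset.sum_pair h1]
    simp only [u, v]
    by_cases hx : e x
    · rcases Int.units_eq_one_or s with rfl | rfl <;>
        rcases Int.units_eq_one_or r with rfl | rfl <;> simp [hx, h1, h1.symm, hAB]
    · rcases Int.units_eq_one_or s with rfl | rfl <;>
        rcases Int.units_eq_one_or r with rfl | rfl <;> simp [hx, h1, h1.symm] <;>
        first
        | ring1
        | linear_combination hC)
  rw [← hu] at huv
  exact Matrix.isUnit_det_of_right_inverse huv

lemma isUnit_det_VhorHalf (a b : ℤ) (β : ℝ) : IsUnit (VhorHalf a b β).det := by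
  rw [VhorHalf, Matrix.det_diagonal, isUnit_iff_ne_zero, Finset.prod_ne_zero_iff]
  intro σ _
  exact Complex.ofReal_ne_zero.mpr (Real.exp_ne_zero _)

lemma isUnit_det_transferMatrix (a b : ℤ) {β : ℝ} (hβ : 0 < β) :
    IsUnit (transferMatrix a b β).det := by
  rw [transferMatrix, Matrix.det_mul, Matrix.det_mul]
  exact ((isUnit_det_VhorHalf a b β).mul (isUnit_det_Vvert a b hβ)).mul
    (isUnit_det_VhorHalf a b β)

end

/-! ### The sign of a time-ordering -/

section

/-- The sign, as an integer unit, of a residue modulo two. -/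
def sgnU (x : ZMod 2) : ℤˣ := if x = 0 then 1 else -1

lemma sgn_eq (x : ZMod 2) : sgn x = spinVal (sgnU x) := by
  unfold sgn sgnU spinVal
  split_ifs <;> simp

lemma sgnU_add (x y : ZMod 2) : sgnU (x + y) = sgnU x * sgnU y := by
  revert x y; decide

lemma sgnU_sum {ι : Type*} (s : Finset ι) (f : ι → ZMod 2) :
    sgnU (∑ i ∈ s, f i) = ∏ i ∈ s, sgnU (f i) := by
  classical
  induction s using Finset.induction_on with
  | empty => rfl
  | insert i s hi ih => rw [Finset.sum_insert hi, Finset.prod_insert hi, sgnU_add, ih]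

lemma spinVal_prod {ι : Type*} (s : Finset ι) (f : ι → ℤˣ) :
    spinVal (∏ i ∈ s, f i) = ∏ i ∈ s, spinVal (f i) := by
  simp [spinVal, Units.coe_prod]

lemma spinVal_mul (u v : ℤˣ) : spinVal (u * v) = spinVal u * spinVal v := by simp [spinVal]

lemma sum_sum_eq_Ioi {n : ℕ} (f : Fin n → Fin n → ZMod 2) (h : ∀ i, f i i = 0) :
    ∑ i, ∑ j, f i j = ∑ i, ∑ j ∈ Ioi i, (f i j + f j i) := by
  have h1 : ∀ i j, f i j = (if i < j then f i j else 0) + if j < i then f i j else 0 := by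
    intro i j
    rcases lt_trichotomy i j with hij | rfl | hij
    · simp [hij, hij.not_gt]
    · simp [h]
    · simp [hij, hij.not_gt]
  have h2 : ∀ (i : Fin n) (g : Fin n → ZMod 2),
      ∑ j ∈ Ioi i, g j = ∑ j, if i < j then g j else 0 := by
    intro i g
    rw [← Finset.sum_filter]
    refine Finset.sum_congr ?_ fun _ _ => rfl
    ext j; simp
  simp only [h2]
  calc ∑ i, ∑ j, f i j = ∑ i, ∑ j, (if i < j then f i j else 0) +
        ∑ i, ∑ j, (if j < i then f i j else 0) := by
        rw [← Finset.sum_add_distrib]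
        refine Finset.sum_congr rfl fun i _ => ?_
        rw [← Finset.sum_add_distrib]
        exact Finset.sum_congr rfl fun j _ => h1 i j
    _ = ∑ i, ∑ j, (if i < j then f i j else 0) +
        ∑ i, ∑ j, (if i < j then f j i else 0) := by
        congr 1
        exact Finset.sum_comm
    _ = _ := by
        rw [← Finset.sum_add_distrib]
        refine Finset.sum_congr rfl fun i _ => ?_
        rw [← Finset.sum_add_distrib]
        refine Finset.sum_congr rfl fun j _ => ?_
        split_ifs <;> simp

variable {a b : ℤ} {N n : ℕ}

lemma pt_injective {z : Fin n → HEdge a b N} (hz : Function.Injective z) :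
    Function.Injective (pts z) := by
  intro i j h
  apply hz
  simp only [HEdge.pt, Prod.mk.injEq] at h
  refine Prod.ext (Subtype.ext ?_) (Fin.ext ?_) <;> omega

/-- The sign of a time-ordering in terms of the keys of the points. -/
lemma sign_mul_prod_ties {z : Fin n → HEdge a b N} (hz : Function.Injective z)
    (τ : Equiv.Perm (Fin n)) (hτ : Monotone fun j => (z (τ j)).2) :
    Equiv.Perm.sign τ * ∏ i, ∏ j ∈ Ioi i,
      (if (z (τ j)).2 = (z (τ i)).2 ∧ ((z (τ i)).1 : ℤ) < (z (τ j)).1 then (-1 : ℤˣ) else 1) =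
      sgnU (keyInv (pts z)) := by
  have h1 : keyInv (pts z) = ∑ i, ∑ j, if τ i < τ j then
      key (pts z (τ j)) (pts z (τ i)) else 0 := by
    rw [keyInv, ← Equiv.sum_comp τ]
    refine Finset.sum_congr rfl fun i _ => ?_
    rw [← Equiv.sum_comp τ]
  rw [h1, sum_sum_eq_Ioi _ (by simp), sgnU_sum, Equiv.Perm.sign_eq_prod_prod_Ioi,
    ← Finset.prod_mul_distrib]
  refine Finset.prod_congr rfl fun i _ => ?_
  rw [sgnU_sum, ← Finset.prod_mul_distrib]
  refine Finset.prod_congr rfl fun j hj => ?_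
  have hij : i < j := by simpa using hj
  have hrow : (z (τ i)).2 ≤ (z (τ j)).2 := hτ hij.le
  have hne : pts z (τ i) ≠ pts z (τ j) := fun h => hij.ne (τ.injective (pt_injective hz h))
  have hk : sgnU (key (pts z (τ j)) (pts z (τ i))) =
      if (z (τ j)).2 = (z (τ i)).2 ∧ ((z (τ i)).1 : ℤ) < (z (τ j)).1 then (-1 : ℤˣ) else 1 := by
    have : (key (pts z (τ j)) (pts z (τ i))) =
        if (z (τ j)).2 = (z (τ i)).2 ∧ ((z (τ i)).1 : ℤ) < (z (τ j)).1 then 1 else 0 := by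
      rw [Fin.le_def] at hrow
      refine if_congr ?_ rfl rfl
      simp only [pts, HEdge.pt, Fin.ext_iff]
      omega
    rw [this]
    split_ifs <;> rfl
  rw [← hk]
  rcases lt_trichotomy (τ i) (τ j) with h | h | h
  · simp [h, h.not_gt]
  · exact absurd (τ.injective h) hij.ne
  -- For a pair inverted by `τ` the key is taken in the opposite order, and `key_add_key` supplies
  -- the factor `-1` of the sign of `τ`.
  · have h2 := key_add_key hne
    simp only [h, h.not_gt, if_true, if_false, zero_add]
    rw [← eq_sub_iff_add_eq] at h2
    rw [h2]
    generalize key (pts z (τ j)) (pts z (τ i)) = x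
    revert x
    decide

end

/-! ### Correlations as sums over histories -/

section

open scoped Matrix

variable {a b : ℤ} {N n : ℕ}

/-- The row configuration after the action of all the fermions in row `Y`. -/
def rowFlip (z : Fin n → HEdge a b N) (Y : ℕ) (σ : RowConfig a b) : RowConfig a b := fun x =>
  (∏ j, if ((z j).2 : ℕ) = Y ∧ (x : ℤ) ≤ (z j).1 then (-1 : ℤˣ) else 1) * σ x

/-- The histories that contribute to a correlation: `h y` is the configuration of row `y`
before the action of the fermions of this row. -/
structure Valid (z : Fin n → HEdge a b N) (arr : Fin n → Arrow)
    (h : Fin (N + 1) → RowConfig a b) : Prop where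
  first : h 0 = 1
  last : rowFlip z N (h (Fin.last N)) = 1
  ends : ∀ (i : Fin N) (x : Site a b), ((x : ℤ) = a ∨ (x : ℤ) = b) →
    h i.succ x = rowFlip z i (h i.castSucc) x
  arrow : ∀ j, h (z j).2 (z j).1.left * h (z j).2 (z j).1.right = arrowUnit (arr j)

/-- The weight of the interactions between a row and the next. -/
def rowWeight (q : ℝ) (σ ρ : RowConfig a b) : ℝ :=
  (∏ k : DualSite a b, wt q (σ k.left * σ k.right)) * (∏ x : Site a b, wt (q ^ 2) (σ x * ρ x)) *
    ∏ k : DualSite a b, wt q (ρ k.left * ρ k.right)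

/-- The weight of a row of equal spins. -/
def groundWeight (a b : ℤ) (β : ℝ) : ℝ :=
  Real.exp (β / 2) ^ Fintype.card (DualSite a b) * Real.exp β ^ Fintype.card (Site a b) *
    Real.exp (β / 2) ^ Fintype.card (DualSite a b)

lemma groundWeight_pos (a b : ℤ) (β : ℝ) : 0 < groundWeight a b β := by
  unfold groundWeight; positivity

/-- The sign that relates a time-ordering to the order from right to left within rows. -/
def tieSign (z : Fin n → HEdge a b N) (τ : Equiv.Perm (Fin n)) : ℤˣ :=
  ∏ i, ∏ j ∈ Ioi i,
    (if (z (τ j)).2 = (z (τ i)).2 ∧ ((z (τ i)).1 : ℤ) < (z (τ j)).1 then (-1 : ℤˣ) else 1)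

section Flips

variable {k : ℕ → DualSite a b} {y : ℕ → ℕ} {z : Fin n → HEdge a b N} {τ : Equiv.Perm (Fin n)}

lemma flipAll_apply (hk : ∀ j : Fin n, k j = (z (τ j)).1) (hy : ∀ j : Fin n, y j = (z (τ j)).2)
    (Y t : ℕ) (ht : t ≤ n) (σ : RowConfig a b) (x : Site a b) :
    flipAll k y Y t σ x = (∏ j : Fin n, if (j : ℕ) < t ∧ ((z (τ j)).2 : ℕ) = Y ∧
      (x : ℤ) ≤ (z (τ j)).1 then (-1 : ℤˣ) else 1) * σ x := by
  rw [flipAll]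
  congr 1
  have h1 : (range t).filter (fun j => y j = Y) =
      (range n).filter (fun j => j < t ∧ y j = Y) := by
    ext j
    simp only [mem_filter, mem_range]
    omega
  rw [h1, Finset.prod_filter, Finset.prod_range]
  refine Finset.prod_congr rfl fun j _ => ?_
  rw [hk, hy]
  by_cases h1 : (j : ℕ) < t <;> by_cases h2 : ((z (τ j)).2 : ℕ) = Y <;> simp [h1, h2]

lemma flipAll_eq_rowFlip (hk : ∀ j : Fin n, k j = (z (τ j)).1)
    (hy : ∀ j : Fin n, y j = (z (τ j)).2) (Y : ℕ) (σ : RowConfig a b) :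
    flipAll k y Y n σ = rowFlip z Y σ := by
  funext x
  rw [flipAll_apply hk hy Y n le_rfl, rowFlip]
  simp only [Fin.is_lt, true_and]
  rw [Equiv.prod_comp τ fun j => if ((z j).2 : ℕ) = Y ∧ (x : ℤ) ≤ (z j).1 then (-1 : ℤˣ) else 1]

/-- The earlier insertions in the row sit at other dual sites, so each of them flips both spins at
`k i` or neither. Hence the constraint of an arrow can be read off before any fermion of the row
acts. -/
lemma flipAll_mul (hz : Function.Injective z) (hk : ∀ j : Fin n, k j = (z (τ j)).1)
    (hy : ∀ j : Fin n, y j = (z (τ j)).2) (i : Fin n) (σ : RowConfig a b) :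
    flipAll k y (y i) i σ (k i).left * flipAll k y (y i) i σ (k i).right =
      σ (k i).left * σ (k i).right := by
  rw [flipAll_apply hk hy _ _ i.2.le, flipAll_apply hk hy _ _ i.2.le]
  have key : ∀ p q v w : ℤˣ, p = q → p * v * (q * w) = v * w := by decide
  refine key _ _ _ _ ?_
  refine Finset.prod_congr rfl fun j _ => ?_
  refine if_congr ?_ rfl rfl
  simp only [DualSite.left, DualSite.right, hk, hy]
  refine and_congr_right fun hj => and_congr_right fun hj' => ?_
  have hne : ((z (τ i)).1 : ℤ) ≠ (z (τ j)).1 := by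
    intro h
    have h2 := τ.injective (hz (Prod.ext (Subtype.ext h) (Fin.ext hj'.symm)))
    rw [h2] at hj
    exact lt_irrefl _ hj
  omega

/-- A fermion sees only the earlier flips of its row. Passing to all flips of the row adds those by
later insertions strictly to its right, and these make up `tieSign`; its own flip does not reach its
right neighbour. -/
lemma prod_flipAll (hk : ∀ j : Fin n, k j = (z (τ j)).1) (hy : ∀ j : Fin n, y j = (z (τ j)).2)
    (h : Fin (N + 1) → RowConfig a b) :
    ∏ i : Fin n, flipAll k y (y i) i (h (z (τ i)).2) (k i).right =
      tieSign z τ * ∏ j, rowFlip z (z j).2 (h (z j).2) (z j).1.right := by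
  rw [← Equiv.prod_comp τ (fun j => rowFlip z (z j).2 (h (z j).2) (z j).1.right), tieSign,
    ← Finset.prod_mul_distrib]
  refine Finset.prod_congr rfl fun i _ => ?_
  rw [flipAll_apply hk hy _ _ i.2.le, rowFlip, ← mul_assoc, ← Equiv.prod_comp τ
    (fun j => if ((z j).2 : ℕ) = (z (τ i)).2 ∧ ((z (τ i)).1.right : ℤ) ≤ (z j).1 then
      (-1 : ℤˣ) else 1)]
  rw [hk]
  congr 1
  have h1 : ∀ g : Fin n → ℤˣ, ∏ j ∈ Ioi i, g j = ∏ j, if i < j then g j else 1 := by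
    intro g
    rw [← Finset.prod_filter]
    refine Finset.prod_congr ?_ fun _ _ => rfl
    ext j; simp
  rw [h1, ← Finset.prod_mul_distrib]
  refine Finset.prod_congr rfl fun j _ => ?_
  simp only [hy, DualSite.right, Fin.ext_iff]
  rcases lt_trichotomy i j with hij | rfl | hij
  · have h2 : ¬ (j : ℕ) < i := by rw [Fin.lt_def] at hij; omega
    by_cases hr : ((z (τ j)).2 : ℕ) = (z (τ i)).2
    · by_cases hs : ((z (τ i)).1 : ℤ) < (z (τ j)).1
      · simp [hij, h2, hr, hs]
      · simp [hij, h2, hs]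
    · simp [h2, hr]
  · simp
  · have h2 : ¬ i < j := hij.not_gt
    rw [Fin.lt_def] at hij
    simp [h2, hij]

end Flips

lemma plus_dotProduct (M : RowOp a b) : plusState a b ⬝ᵥ (M *ᵥ plusState a b) = M 1 1 := by
  rw [plusState, Matrix.mulVec_single_one, single_one_dotProduct]
  rfl

open Classical in
/-- The numerator of a correlation as a sum over histories. -/
theorem numerator_eq (hab : a < b) {β : ℝ} (hβ : 0 < β) {z : Fin n → HEdge a b N}
    (hz : Function.Injective z) (arr : Fin n → Arrow) (τ : Equiv.Perm (Fin n))
    (hτ : Monotone fun j => (z (τ j)).2) :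
    plusState a b ⬝ᵥ ((transferMatrix a b β ^ N *
        (List.ofFn fun j => psiArrow β (arr (τ j)) (z (τ j))).reverse.prod) *ᵥ plusState a b) =
      ∑ h ∈ univ.filter (Valid z arr),
        (groundWeight a b β : ℂ) ^ N *
        ((∏ i : Fin N, rowWeight (Real.exp (-β)) (h i.succ) (rowFlip z i (h i.castSucc)) : ℝ) : ℂ) *
        (∏ j, (arrowSign (arr j) * lam⁻¹)) *
        spinVal (tieSign z τ * ∏ j, rowFlip z (z j).2 (h (z j).2) (z j).1.right) := by
  -- The values from `n` on are never used; `a` labels a dual site because `a < b`.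
  let k : ℕ → DualSite a b := fun t =>
    if h : t < n then (z (τ ⟨t, h⟩)).1 else ⟨a, Finset.mem_Ico.mpr ⟨le_rfl, hab⟩⟩
  let y : ℕ → ℕ := fun t => if h : t < n then (z (τ ⟨t, h⟩)).2 else 0
  let r : ℕ → Arrow := fun t => if h : t < n then arr (τ ⟨t, h⟩) else Arrow.up
  have hk : ∀ j : Fin n, k j = (z (τ j)).1 := fun j => dif_pos j.2
  have hy : ∀ j : Fin n, y j = (z (τ j)).2 := fun j => dif_pos j.2
  have hr : ∀ j : Fin n, r j = arr (τ j) := fun j => dif_pos j.2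
  set V := transferMatrix a b β with hV
  have hu := isUnit_det_transferMatrix a b hβ
  have hlist : (List.ofFn fun j => psiArrow β (arr (τ j)) (z (τ j))).reverse.prod =
      timeProd (fun t => V⁻¹ ^ y t * arrowRow (r t) (k t) * V ^ y t) n := by
    rw [← prod_reverse_ofFn]
    congr 3
    funext j
    rw [psiArrow_eq, hk, hy, hr]
  rw [plus_dotProduct, hlist, pow_mul_timeProd (Matrix.mul_nonsing_inv V hu)
    (Matrix.nonsing_inv_mul V hu) y (fun t => arrowRow (r t) (k t)) N n ?_ ?_]
  rotate_left
  · intro j hj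
    rw [hy ⟨j, hj⟩]
    exact Fin.is_le _
  · intro i j hij hj
    rw [hy ⟨i, hij.trans hj⟩, hy ⟨j, hj⟩]
    exact hτ (Fin.mk_le_mk.mpr hij.le)
  rw [layered_apply V _ (fun Y => flipAll k y Y n) _
    (fun Y ρ σ => rowProd_apply k r y Y n ρ σ), Finset.sum_filter]
  refine Finset.sum_congr rfl fun h _ => ?_
  simp only [flipAll_eq_rowFlip hk hy]
  -- The amplitudes are regrouped by insertion instead of by row.
  have hamp : ∏ i : Fin (N + 1), ∏ j ∈ (range n).filter (fun j => y j = i),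
      amp (r j) (k j) (flipAll k y i j (h i)) =
      ∏ i : Fin n, amp (arr (τ i)) (k i) (flipAll k y (y i) i (h (z (τ i)).2)) := by
    rw [← Finset.prod_fiberwise univ (fun i : Fin n => (z (τ i)).2)]
    refine Finset.prod_congr rfl fun i _ => ?_
    rw [Finset.prod_filter, Finset.prod_range, Finset.prod_filter]
    refine Finset.prod_congr rfl fun j _ => ?_
    rw [hy, hr]
    by_cases hji : (z (τ j)).2 = i
    · rw [if_pos hji, if_pos (congrArg Fin.val hji), hji]
    · rw [if_neg hji, if_neg fun hh => hji (Fin.ext hh)]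
  rw [hamp]
  have hamp' : ∀ i : Fin n, amp (arr (τ i)) (k i) (flipAll k y (y i) i (h (z (τ i)).2)) =
      if h (z (τ i)).2 (z (τ i)).1.left * h (z (τ i)).2 (z (τ i)).1.right = arrowUnit (arr (τ i))
      then arrowSign (arr (τ i)) * lam⁻¹ *
        spinVal (flipAll k y (y i) i (h (z (τ i)).2) (k i).right) else 0 := by
    intro i
    rw [amp, flipAll_mul hz hk hy, hk]
  simp only [hamp', hV, transferMatrix_apply]
  by_cases hv : Valid z arr h
  · rw [if_pos hv, if_pos ⟨hv.first, hv.last⟩]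
    have e1 : ∀ i : Fin n, h (z (τ i)).2 (z (τ i)).1.left * h (z (τ i)).2 (z (τ i)).1.right =
        arrowUnit (arr (τ i)) := fun i => hv.arrow (τ i)
    simp only [e1, if_true]
    have e2 : ∀ i : Fin N, (∀ x : Site a b, ((x : ℤ) = a ∨ (x : ℤ) = b) →
        h i.succ x = rowFlip z i (h i.castSucc) x) := hv.ends
    rw [Finset.prod_congr rfl fun i _ => if_pos (e2 i)]
    rw [Finset.prod_mul_distrib, Finset.prod_mul_distrib, ← spinVal_prod, prod_flipAll hk hy,
      Equiv.prod_comp τ (fun j => arrowSign (arr j) * lam⁻¹), Finset.prod_const,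
      Complex.ofReal_prod, Finset.card_univ, Fintype.card_fin]
    simp only [groundWeight, rowWeight]
    ring
  · rw [if_neg hv]
    by_cases h1 : h 0 = 1 ∧ rowFlip z N (h (Fin.last N)) = 1
    · rw [if_pos h1]
      by_cases h2 : ∀ (i : Fin N) (x : Site a b), ((x : ℤ) = a ∨ (x : ℤ) = b) →
          h i.succ x = rowFlip z i (h i.castSucc) x
      · have h3 : ∃ j, h (z j).2 (z j).1.left * h (z j).2 (z j).1.right ≠ arrowUnit (arr j) := by
          by_contra hc
          push Not at hc
          exact hv ⟨h1.1, h1.2, h2, hc⟩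
        obtain ⟨j, hj⟩ := h3
        rw [mul_eq_zero]
        right
        refine Finset.prod_eq_zero (mem_univ (τ.symm j)) ?_
        simp only [Equiv.apply_symm_apply]
        exact if_neg hj
      · obtain ⟨i, hi⟩ := not_forall.mp h2
        rw [mul_eq_zero]
        left
        exact Finset.prod_eq_zero (mem_univ i) (if_neg hi)
    · exact if_neg h1

end

/-! ### From configurations to histories -/

section

/-- The face with lower left corner `(k, y)`. -/
def face (k y : ℤ) : Pt := (2 * k + 1, 2 * y + 1)

lemma face_mem_boxFaces {a b : ℤ} {N : ℕ} {k y : ℤ} :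
    face k y ∈ boxFaces a b N ↔ (a ≤ k ∧ k < b) ∧ 0 ≤ y ∧ y < N := by
  simp only [boxFaces, face, mem_image, mem_product, mem_Ico, Prod.exists, Prod.mk.injEq]
  constructor
  · rintro ⟨k', y', h, h1, h2⟩
    omega
  · intro h
    exact ⟨k, y, h, rfl, rfl⟩

lemma exists_face {a b : ℤ} {N : ℕ} {p : Pt} (h : p ∈ boxFaces a b N) :
    ∃ (k : DualSite a b) (i : Fin N), p = face k i := by
  simp only [boxFaces, mem_image, mem_product, Prod.exists] at h
  obtain ⟨k, y, ⟨hk, hy⟩, rfl⟩ := h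
  rw [mem_Ico] at hy
  refine ⟨⟨k, hk⟩, ⟨y.toNat, by omega⟩, ?_⟩
  simp only [face, Prod.mk.injEq, true_and]
  omega

lemma odd_boxFaces {a b : ℤ} {N : ℕ} : ∀ p ∈ boxFaces a b N, Odd p.1 ∧ Odd p.2 := by
  intro p hp
  obtain ⟨k, i, rfl⟩ := exists_face hp
  exact ⟨odd_two_mul_add_one _, odd_two_mul_add_one _⟩

/-- The sign that records whether a dart is present. -/
def dartSign (D : Finset Dart) (x : Dart) : ℤˣ := if x ∈ D then -1 else 1

lemma dartSign_eq_neg_one {D : Finset Dart} {x : Dart} : dartSign D x = -1 ↔ x ∈ D := by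
  unfold dartSign
  split_ifs with h
  · simp [h]
  · simp only [h, iff_false]
    decide

lemma dartSign_eq_ite {D : Finset Dart} {x : Dart} {P : Prop} [Decidable P] (h : x ∈ D ↔ P) :
    dartSign D x = if P then -1 else 1 := if_congr h rfl rfl

lemma dartSign_of_notMem {D : Finset Dart} {x : Dart} (h : x ∉ D) : dartSign D x = 1 := if_neg h

lemma prod_neg_one_eq_one_iff (f : Dir → ℤˣ) :
    ∏ d, f d = 1 ↔ Even (univ.filter fun d => f d = -1).card := by
  have h1 : ∏ d, f d = (-1) ^ (univ.filter fun d => f d = -1).card := by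
    rw [← Finset.prod_const, Finset.prod_filter]
    refine Finset.prod_congr rfl fun d _ => ?_
    rcases Int.units_eq_one_or (f d) with h | h <;> rw [h] <;> decide
  rw [h1, ← Units.val_inj, Units.val_pow_eq_pow_val]
  simp only [Units.val_neg, Units.val_one]
  exact neg_one_pow_eq_one_iff_even (by decide)

lemma prod_Ico_mul_succ (g : ℤ → ℤˣ) {x b : ℤ} (h : x ≤ b) :
    ∏ k ∈ Ico x b, g k * g (k + 1) = g x * g b := by
  induction b, h using Int.leInduction with
  | base => simp
  | succ b hb ih =>
    have : Ico x (b + 1) = insert b (Ico x b) := by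
      ext k; simp only [mem_Ico, mem_insert]; omega
    rw [this, Finset.prod_insert (by simp), ih]
    generalize g x = u
    generalize g b = v
    generalize g (b + 1) = w
    revert u v w
    decide

lemma prod_Ico_eq_mul (g : ℤ → ℤˣ) {x b : ℤ} (h : x < b) :
    ∏ k ∈ Ico x b, g k = g x * ∏ k ∈ Ico (x + 1) b, g k := by
  have : Ico x b = insert x (Ico (x + 1) b) := by
    ext k; simp only [mem_Ico, mem_insert]; omega
  rw [this, Finset.prod_insert (by simp)]

lemma units_mul_eq_iff (u v w : ℤˣ) : u * v = w ↔ u = w * v := by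
  revert u v w; decide

lemma units_mul_self (u : ℤˣ) : u * u = 1 := by
  revert u; decide

variable {a b : ℤ} {N n : ℕ}

/-- The configuration of a row before the action of the fermions, read off from the darts. -/
def histAt (b : ℤ) (D : Finset Dart) (y x : ℤ) : ℤˣ := ∏ k ∈ Ico x b, dartSign D (face k (y - 1), 1)

/-- The configuration of a row after the action of the fermions, read off from the darts. -/
def postAt (b : ℤ) (D : Finset Dart) (y x : ℤ) : ℤˣ := ∏ k ∈ Ico x b, dartSign D (face k y, 3)

/-- The history of a configuration. -/
def histOf (a b : ℤ) (N : ℕ) (D : Finset Dart) : Fin (N + 1) → RowConfig a b :=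
  fun i x => histAt b D i x

/-- The signs of the darts of a face, in terms of a history. -/
def edgeVal (z : Fin n → HEdge a b N) (h : Fin (N + 1) → RowConfig a b) (i : Fin N)
    (k : DualSite a b) : Dir → ℤˣ :=
  ![rowFlip z i (h i.castSucc) k.right * h i.succ k.right,
    h i.succ k.left * h i.succ k.right,
    rowFlip z i (h i.castSucc) k.left * h i.succ k.left,
    rowFlip z i (h i.castSucc) k.left * rowFlip z i (h i.castSucc) k.right]

lemma prod_edgeVal (z : Fin n → HEdge a b N) (h : Fin (N + 1) → RowConfig a b) (i : Fin N)
    (k : DualSite a b) : ∏ d, edgeVal z h i k d = 1 := by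
  rw [Fin.prod_univ_four]
  have : ∀ u v w x : ℤˣ, u * v * (w * v) * (x * w) * (x * u) = 1 := by decide
  exact this _ _ _ _

lemma mid_face_zero (k y : ℤ) : mid (face k y, 0) = (2 * (k + 1), 2 * y + 1) := by
  simp only [mid, face, halfStep, Prod.mk.injEq, Prod.mk_add_mk, Matrix.cons_val_zero]
  omega

lemma mid_face_one (k y : ℤ) : mid (face k y, 1) = (2 * k + 1, 2 * (y + 1)) := by
  simp only [mid, face, halfStep, Prod.mk.injEq, Prod.mk_add_mk, Matrix.cons_val_one,
    Matrix.cons_val_zero]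
  omega

lemma mid_face_two (k y : ℤ) : mid (face k y, 2) = (2 * k, 2 * y + 1) := by
  simp [mid, face, halfStep]

lemma mid_face_three (k y : ℤ) : mid (face k y, 3) = (2 * k + 1, 2 * y) := by
  simp [mid, face, halfStep]

lemma opp_face_zero (k y : ℤ) : opp (face k y, 0) = (face (k + 1) y, 2) := by
  simp [opp, face, halfStep]; ring

lemma opp_face_one (k y : ℤ) : opp (face k y, 1) = (face k (y + 1), 3) := by
  simp [opp, face, halfStep]
  ring

lemma opp_face_two (k y : ℤ) : opp (face k y, 2) = (face (k - 1) y, 0) := by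
  simp [opp, face, halfStep]
  ring

lemma opp_face_three (k y : ℤ) : opp (face k y, 3) = (face k (y - 1), 1) := by
  simp [opp, face, halfStep]
  ring

lemma endDart_up {z : Fin n → HEdge a b N} {arr : Fin n → Arrow} {j : Fin n}
    (h : arr j = Arrow.up) : endDart (pts z) (roots arr) j = (face (z j).1 ((z j).2 : ℕ), 3) := by
  simp only [endDart, roots, h, arrowRoot, pts, HEdge.pt, face, halfStep]
  simp

lemma endDart_down {z : Fin n → HEdge a b N} {arr : Fin n → Arrow} {j : Fin n}
    (h : arr j = Arrow.down) :
    endDart (pts z) (roots arr) j = (face (z j).1 (((z j).2 : ℕ) - 1), 1) := by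
  simp only [endDart, roots, h, arrowRoot, pts, HEdge.pt, face, halfStep]
  simp
  ring

section Forward

variable {z : Fin n → HEdge a b N} {arr : Fin n → Arrow} {γ : Finset Pt}

lemma endDart_snd (z : Fin n → HEdge a b N) (arr : Fin n → Arrow) (j : Fin n) :
    (endDart (pts z) (roots arr) j).2 = 1 ∨ (endDart (pts z) (roots arr) j).2 = 3 := by
  cases h : arr j
  · rw [endDart_up h]; exact Or.inr rfl
  · rw [endDart_down h]; exact Or.inl rfl

lemma mem_contourDarts_of_horizontal (hγ : γ ∈ contours (boxFaces a b N) (pts z) (roots arr))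
    {k y : ℤ} {d : Dir} (hd : d = 0 ∨ d = 2) :
    (face k y, d) ∈ contourDarts (boxFaces a b N) (pts z) (roots arr) γ ↔
      mid (face k y, d) ∈ γ := by
  rw [mem_contourDarts]
  constructor
  · rintro ⟨-, h | ⟨j, hj⟩⟩
    · exact h
    · have h1 := endDart_snd z arr j
      rw [← hj] at h1
      simp only at h1
      rcases hd with rfl | rfl <;> rcases h1 with h1 | h1 <;> exact absurd h1 (by decide)
  · intro h
    exact ⟨(opp_fst_mem odd_boxFaces hγ (x := (face k y, d))
      ⟨odd_two_mul_add_one _, odd_two_mul_add_one _⟩ h).1, Or.inl h⟩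

lemma dartSign_horizontal (hγ : γ ∈ contours (boxFaces a b N) (pts z) (roots arr)) (k y : ℤ) :
    dartSign (contourDarts (boxFaces a b N) (pts z) (roots arr) γ) (face k y, 0) =
      dartSign (contourDarts (boxFaces a b N) (pts z) (roots arr) γ) (face (k + 1) y, 2) := by
  unfold dartSign
  simp only [mem_contourDarts_of_horizontal hγ (Or.inl rfl),
    mem_contourDarts_of_horizontal hγ (Or.inr rfl), mid_face_zero, mid_face_two]

/-- At `a` the dual edge would lead out of the box; at `b` the face itself lies outside. -/
lemma dartSign_side (hγ : γ ∈ contours (boxFaces a b N) (pts z) (roots arr)) {k y : ℤ}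
    (hk : k = a ∨ k = b) :
    dartSign (contourDarts (boxFaces a b N) (pts z) (roots arr) γ) (face k y, 2) = 1 := by
  refine dartSign_of_notMem fun h => ?_
  have h1 := (mem_contourDarts.mp h).1
  rw [mem_contourDarts_of_horizontal hγ (Or.inr rfl)] at h
  have h2 := (opp_fst_mem odd_boxFaces hγ (x := (face k y, 2))
    ⟨odd_two_mul_add_one _, odd_two_mul_add_one _⟩ h).2
  rw [opp_face_two] at h2
  rw [face_mem_boxFaces] at h1 h2
  omega

/-- At a marked edge exactly one half is present; at any other edge, both halves or none. -/
lemma dartSign_pre_mul_post (hz : Function.Injective z)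
    (hγ : γ ∈ contours (boxFaces a b N) (pts z) (roots arr)) (k : ℤ) (y : ℕ) :
    dartSign (contourDarts (boxFaces a b N) (pts z) (roots arr) γ) (face k (y - 1), 1) *
      dartSign (contourDarts (boxFaces a b N) (pts z) (roots arr) γ) (face k y, 3) =
      ∏ j, if ((z j).2 : ℕ) = y ∧ ((z j).1 : ℤ) = k then (-1 : ℤˣ) else 1 := by
  have hm : mid (face k (y - 1), 1) = mid (face k y, 3) := by
    rw [mid_face_one, mid_face_three]; simp
  by_cases hex : ∃ j, ((z j).2 : ℕ) = y ∧ ((z j).1 : ℤ) = k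
  · obtain ⟨j, rfl, rfl⟩ := hex
    rw [Finset.prod_eq_single j]
    · rw [if_pos ⟨rfl, rfl⟩]
      have hmj : mid (face (z j).1 ((z j).2 : ℕ), 3) = pts z j := by
        rw [mid_face_three]; rfl
      have hmem : ∀ x : Dart, mid x = pts z j →
          (x ∈ contourDarts (boxFaces a b N) (pts z) (roots arr) γ ↔
            x = endDart (pts z) (roots arr) j) := fun x hx =>
        ⟨fun h => eq_endDart (pt_injective hz) hγ h hx, fun h => h ▸ endDart_mem hγ j⟩
      rw [dartSign_eq_ite (hmem _ hmj), dartSign_eq_ite (hmem _ (hm.trans hmj))]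
      cases h : arr j
      · rw [endDart_up h]
        simp
      · rw [endDart_down h]
        simp
    · intro i _ hi
      refine if_neg fun h => hi ?_
      exact hz (Prod.ext (Subtype.ext h.2) (Fin.ext h.1))
    · simp
  · rw [Finset.prod_eq_one fun j _ => if_neg fun h => hex ⟨j, h⟩]
    have hmem : ∀ x : Dart, mid x = mid (face k y, 3) → Odd x.1.1 ∧ Odd x.1.2 →
        (x ∈ contourDarts (boxFaces a b N) (pts z) (roots arr) γ ↔ mid (face k y, 3) ∈ γ) := by
      intro x hx ho
      rw [mem_contourDarts]
      constructor
      · rintro ⟨-, h | ⟨j, rfl⟩⟩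
        · rwa [← hx]
        · exfalso
          rw [mid_endDart, mid_face_three] at hx
          simp only [HEdge.pt, Prod.mk.injEq] at hx
          exact hex ⟨j, by omega, by omega⟩
      · intro h
        rw [← hx] at h
        exact ⟨(opp_fst_mem odd_boxFaces hγ ho h).1, Or.inl h⟩
    rw [dartSign_eq_ite (hmem _ rfl ⟨odd_two_mul_add_one _, odd_two_mul_add_one _⟩),
      dartSign_eq_ite (hmem _ hm ⟨odd_two_mul_add_one _, odd_two_mul_add_one _⟩)]
    exact units_mul_self _

lemma prod_dartSign_face (hz : Function.Injective z)
    (hγ : γ ∈ contours (boxFaces a b N) (pts z) (roots arr)) {p : Pt} (hp : p ∈ boxFaces a b N) :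
    ∏ d, dartSign (contourDarts (boxFaces a b N) (pts z) (roots arr) γ) (p, d) = 1 := by
  rw [prod_neg_one_eq_one_iff]
  simp only [dartSign_eq_neg_one]
  rw [card_contourDarts_face (pt_injective hz) (mem_contours.mp hγ).2.2.1 hp]
  exact (mem_contours.mp hγ).2.2.2 p hp

/-- At each face the two vertical signs multiply to the two horizontal ones. Along the faces to the
right of `x` the horizontal signs telescope, and nothing remains at `b`. -/
lemma postAt_mul_histAt (hz : Function.Injective z)
    (hγ : γ ∈ contours (boxFaces a b N) (pts z) (roots arr)) {x : ℤ} (hx : a ≤ x) (hx' : x ≤ b)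
    (i : Fin N) :
    postAt b (contourDarts (boxFaces a b N) (pts z) (roots arr) γ) i x *
      histAt b (contourDarts (boxFaces a b N) (pts z) (roots arr) γ) (i + 1) x =
      dartSign (contourDarts (boxFaces a b N) (pts z) (roots arr) γ) (face x i, 2) := by
  set D := contourDarts (boxFaces a b N) (pts z) (roots arr) γ with hD
  have h1 := prod_Ico_mul_succ (fun k => dartSign D (face k i, 2)) hx'
  simp only [hD, dartSign_side hγ (k := b) (Or.inr rfl), mul_one] at h1
  rw [← hD] at h1
  rw [← h1, postAt, histAt, ← Finset.prod_mul_distrib]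
  refine Finset.prod_congr rfl fun k hk => ?_
  rw [mem_Ico] at hk
  have h2 := prod_dartSign_face hz hγ (p := face k i)
    (face_mem_boxFaces.mpr ⟨by omega, by omega⟩)
  rw [Fin.prod_univ_four, dartSign_horizontal hγ, ← hD] at h2
  rw [add_sub_cancel_right]
  have : ∀ u v w x : ℤˣ, u * v * w * x = 1 → x * v = w * u := by decide
  exact this _ _ _ _ h2

/-- Going from the darts below a row to those above it changes one sign for each insertion in the
row, which affects precisely the spins to the left of the insertion. -/
lemma rowFlip_histOf (hz : Function.Injective z)
    (hγ : γ ∈ contours (boxFaces a b N) (pts z) (roots arr)) (i : Fin (N + 1)) (x : Site a b) :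
    rowFlip z i
      (histOf a b N (contourDarts (boxFaces a b N) (pts z) (roots arr) γ) i) x =
      postAt b (contourDarts (boxFaces a b N) (pts z) (roots arr) γ) i x := by
  set D := contourDarts (boxFaces a b N) (pts z) (roots arr) γ with hD
  have h1 : (∏ j, if ((z j).2 : ℕ) = i ∧ (x : ℤ) ≤ (z j).1 then (-1 : ℤˣ) else 1) =
      ∏ k ∈ Ico (x : ℤ) b, dartSign D (face k ((i : ℕ) - 1), 1) * dartSign D (face k (i : ℕ), 3) := by
    rw [Finset.prod_congr rfl fun k _ => dartSign_pre_mul_post hz hγ k i, Finset.prod_comm]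
    refine Finset.prod_congr rfl fun j _ => ?_
    by_cases hj : ((z j).2 : ℕ) = i
    · simp only [hj, true_and]
      rw [Finset.prod_ite_eq]
      have := (mem_Ico.mp (z j).1.2).2
      simp only [mem_Ico, this, and_true]
    · simp [hj]
  rw [rowFlip, h1, Finset.prod_mul_distrib]
  simp only [histOf, histAt, postAt]
  have : ∀ u v : ℤˣ, u * v * u = v := by decide
  exact this _ _

lemma histAt_mul_histAt {D : Finset Dart} {y x : ℤ} (hx : x < b) :
    histAt b D y x * histAt b D y (x + 1) = dartSign D (face x (y - 1), 1) := by
  rw [histAt, prod_Ico_eq_mul _ hx, ← histAt, mul_assoc, units_mul_self, mul_one]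

lemma postAt_mul_postAt {D : Finset Dart} {y x : ℤ} (hx : x < b) :
    postAt b D y x * postAt b D y (x + 1) = dartSign D (face x y, 3) := by
  rw [postAt, prod_Ico_eq_mul _ hx, ← postAt, mul_assoc, units_mul_self, mul_one]

lemma dartSign_eq_edgeVal (hz : Function.Injective z)
    (hγ : γ ∈ contours (boxFaces a b N) (pts z) (roots arr)) (i : Fin N) (k : DualSite a b)
    (d : Dir) :
    dartSign (contourDarts (boxFaces a b N) (pts z) (roots arr) γ) (face k i, d) =
      edgeVal z (histOf a b N (contourDarts (boxFaces a b N) (pts z) (roots arr) γ)) i k d := by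
  set D := contourDarts (boxFaces a b N) (pts z) (roots arr) γ with hD
  obtain ⟨hk1, hk2⟩ := mem_Ico.mp k.2
  have hP : ∀ x : Site a b, rowFlip z i (histOf a b N D i.castSucc) x = postAt b D i x :=
    fun x => rowFlip_histOf hz hγ i.castSucc x
  have hH : ∀ x : Site a b, histOf a b N D i.succ x = histAt b D (i + 1) x := fun x => by
    simp [histOf]
  fin_cases d <;> simp only [edgeVal, hP, hH]
  · refine Eq.trans ?_ (postAt_mul_histAt hz hγ (by simp [DualSite.right]; omega)
      (by simp [DualSite.right]; omega) i).symm
    exact dartSign_horizontal hγ _ _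
  · refine Eq.trans ?_ (histAt_mul_histAt hk2).symm
    rw [add_sub_cancel_right]
    rfl
  · exact (postAt_mul_histAt hz hγ hk1 hk2.le i).symm
  · exact (postAt_mul_postAt hk2).symm

/-- There are no darts below row `0` or above row `N`, so the first and last configurations are
plus; no dual edge crosses the sides, so the end spins are frozen. An arrow tells which half of the
marked edge is present: the lower one for `down`, the upper one for `up`. -/
theorem valid_histOf (hz : Function.Injective z)
    (hγ : γ ∈ contours (boxFaces a b N) (pts z) (roots arr)) :
    Valid z arr (histOf a b N (contourDarts (boxFaces a b N) (pts z) (roots arr) γ)) where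
  first := by
    funext x
    change histAt b _ _ _ = 1
    refine Finset.prod_eq_one fun k _ => dartSign_of_notMem fun h => ?_
    have h := (mem_contourDarts.mp h).1
    rw [face_mem_boxFaces] at h
    simp at h
  last := by
    funext x
    have h1 := rowFlip_histOf hz hγ (Fin.last N) x
    simp only [Fin.val_last] at h1
    rw [h1]
    change postAt b _ _ _ = 1
    refine Finset.prod_eq_one fun k _ => dartSign_of_notMem fun h => ?_
    have h := (mem_contourDarts.mp h).1
    rw [face_mem_boxFaces] at h
    omega
  ends i x hx := by
    have h1 := rowFlip_histOf hz hγ i.castSucc x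
    simp only [Fin.val_castSucc] at h1
    rw [h1]
    obtain ⟨hx1, hx2⟩ := mem_Icc.mp x.2
    have h2 := postAt_mul_histAt hz hγ hx1 hx2 i
    rw [dartSign_side hγ hx, units_mul_eq_iff, one_mul] at h2
    rw [h2]
    simp [histOf]
  arrow j := by
    have hm : mid (face (z j).1 (((z j).2 : ℕ) - 1), 1) = pts z j := by
      rw [mid_face_one]; simp [HEdge.pt]
    have h1 : histOf a b N (contourDarts (boxFaces a b N) (pts z) (roots arr) γ) (z j).2
        (z j).1.left * histOf a b N (contourDarts (boxFaces a b N) (pts z) (roots arr) γ) (z j).2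
        (z j).1.right = _ := histAt_mul_histAt (mem_Ico.mp (z j).1.2).2
    rw [h1]
    cases h : arr j
    · refine dartSign_of_notMem fun hmem => ?_
      have := eq_endDart (pt_injective hz) hγ hmem hm
      rw [endDart_up h] at this
      exact absurd (congrArg Prod.snd this) (show (1 : Fin 4) ≠ 3 by decide)
    · refine dartSign_eq_neg_one.mpr ?_
      have h2 := endDart_mem hγ j
      rw [endDart_down h] at h2
      exact h2

/-- A configuration is determined by its history. -/
theorem histOf_injOn (hz : Function.Injective z) {γ' : Finset Pt}
    (hγ : γ ∈ contours (boxFaces a b N) (pts z) (roots arr))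
    (hγ' : γ' ∈ contours (boxFaces a b N) (pts z) (roots arr))
    (h : histOf a b N (contourDarts (boxFaces a b N) (pts z) (roots arr) γ) =
      histOf a b N (contourDarts (boxFaces a b N) (pts z) (roots arr) γ')) : γ ⊆ γ' := by
  intro q hq
  obtain ⟨⟨p, d⟩, hx, -, rfl⟩ := mem_dualEdges.mp ((mem_contours.mp hγ).1 hq)
  obtain ⟨k, i, rfl⟩ := exists_face hx
  have h1 : (face k i, d) ∈ contourDarts (boxFaces a b N) (pts z) (roots arr) γ :=
    mem_contourDarts.mpr ⟨hx, Or.inl hq⟩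
  rw [← dartSign_eq_neg_one, dartSign_eq_edgeVal hz hγ, h, ← dartSign_eq_edgeVal hz hγ',
    dartSign_eq_neg_one, mem_contourDarts] at h1
  rcases h1.2 with h2 | ⟨j, hj⟩
  · exact h2
  · rw [hj, mid_endDart] at hq
    exact absurd hq ((mem_contours.mp hγ).2.2.1 j)

end Forward

end

/-! ### From histories to configurations -/

section

section Backward

variable {a b : ℤ} {N n : ℕ} {z : Fin n → HEdge a b N} {arr : Fin n → Arrow}
  {h : Fin (N + 1) → RowConfig a b}

lemma face_injective {k k' y y' : ℤ} (h : face k y = face k' y') : k = k' ∧ y = y' := by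
  simp only [face, Prod.mk.injEq] at h
  omega

lemma rowFlip_mul_rowFlip (z : Fin n → HEdge a b N) (Y : ℕ) (σ : RowConfig a b)
    (k : DualSite a b) : rowFlip z Y σ k.left * rowFlip z Y σ k.right =
      (∏ j, if ((z j).2 : ℕ) = Y ∧ (z j).1 = k then (-1 : ℤˣ) else 1) *
        (σ k.left * σ k.right) := by
  have h1 : ∀ u v s t w : ℤˣ, u * v = w → u * s * (v * t) = w * (s * t) := by decide
  refine h1 _ _ _ _ _ ?_
  rw [← Finset.prod_mul_distrib]
  refine Finset.prod_congr rfl fun j _ => ?_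
  have hl : ((k.left : Site a b) : ℤ) = k := rfl
  have hr : ((k.right : Site a b) : ℤ) = k + 1 := rfl
  simp only [hl, hr, Subtype.ext_iff]
  by_cases hj : ((z j).2 : ℕ) = Y
  · rcases lt_trichotomy ((z j).1 : ℤ) k with hk | hk | hk
    · have h2 : ¬ (k : ℤ) ≤ (z j).1 := by omega
      have h3 : ¬ (k : ℤ) + 1 ≤ (z j).1 := by omega
      simp [h2, h3, hk.ne]
    · have h3 : ¬ (k : ℤ) + 1 ≤ (z j).1 := by omega
      simp [hj, hk]
    · have h3 : (k : ℤ) + 1 ≤ (z j).1 := by omega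
      simp [hj, h3, hk.le, hk.ne']
  · simp [hj]

lemma rowFlip_mul_of_forall_ne {Y : ℕ} (σ : RowConfig a b) {k : DualSite a b}
    (hne : ∀ j, pts z j ≠ (2 * (k : ℤ) + 1, 2 * (Y : ℤ))) :
    rowFlip z Y σ k.left * rowFlip z Y σ k.right = σ k.left * σ k.right := by
  rw [rowFlip_mul_rowFlip, Finset.prod_eq_one, one_mul]
  rintro j -
  refine if_neg ?_
  rintro ⟨rfl, rfl⟩
  exact hne j rfl

lemma rowFlip_mul_self (hz : Function.Injective z) (j : Fin n) (σ : RowConfig a b) :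
    rowFlip z (z j).2 σ (z j).1.left * rowFlip z (z j).2 σ (z j).1.right =
      -(σ (z j).1.left * σ (z j).1.right) := by
  rw [rowFlip_mul_rowFlip, Finset.prod_eq_single j, if_pos ⟨rfl, rfl⟩, neg_one_mul]
  · intro i _ hi
    exact if_neg fun hh => hi (hz (Prod.ext hh.2 (Fin.ext hh.1)))
  · simp

lemma edgeVal_zero (z : Fin n → HEdge a b N) (h : Fin (N + 1) → RowConfig a b) (i : Fin N)
    (k : DualSite a b) : edgeVal z h i k 0 =
      rowFlip z i (h i.castSucc) k.right * h i.succ k.right := rfl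

lemma edgeVal_one (z : Fin n → HEdge a b N) (h : Fin (N + 1) → RowConfig a b) (i : Fin N)
    (k : DualSite a b) : edgeVal z h i k 1 = h i.succ k.left * h i.succ k.right := rfl

lemma edgeVal_two (z : Fin n → HEdge a b N) (h : Fin (N + 1) → RowConfig a b) (i : Fin N)
    (k : DualSite a b) : edgeVal z h i k 2 =
      rowFlip z i (h i.castSucc) k.left * h i.succ k.left := rfl

lemma edgeVal_three (z : Fin n → HEdge a b N) (h : Fin (N + 1) → RowConfig a b) (i : Fin N)
    (k : DualSite a b) : edgeVal z h i k 3 =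
      rowFlip z i (h i.castSucc) k.left * rowFlip z i (h i.castSucc) k.right := rfl

lemma left_eq_right {k k' : DualSite a b} (h : (k' : ℤ) = k + 1) : k'.left = k.right :=
  Subtype.ext h

/-- Away from the insertions, a domain wall seen from a face is also seen from the face across. That
face lies in the box, since the frozen ends and the plus rows exclude walls on its boundary. -/
lemma edgeVal_opp (hv : Valid z arr h) {i : Fin N} {k : DualSite a b} {d : Dir}
    (hne : ∀ j, pts z j ≠ mid (face k i, d)) (hd : edgeVal z h i k d = -1) :
    ∃ (i' : Fin N) (k' : DualSite a b),
      opp (face k i, d) = (face k' i', d + 2) ∧ edgeVal z h i' k' (d + 2) = -1 := by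
  have hk := mem_Ico.mp k.2
  have hu : (1 : ℤˣ) ≠ -1 := by decide
  obtain rfl | rfl | rfl | rfl : d = 0 ∨ d = 1 ∨ d = 2 ∨ d = 3 := by
    fin_cases d <;> simp
  · rw [edgeVal_zero] at hd
    rcases eq_or_ne ((k : ℤ) + 1) b with hb | hb
    · rw [hv.ends i k.right (Or.inr hb), units_mul_self] at hd
      exact absurd hd hu
    · refine ⟨i, ⟨k + 1, mem_Ico.mpr (by omega)⟩, opp_face_zero _ _, ?_⟩
      rw [show (0 : Dir) + 2 = 2 from rfl, edgeVal_two, left_eq_right (k := k) rfl, hd]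
  · rw [edgeVal_one] at hd
    have h1 : ∀ Y : ℕ, Y = i + 1 → rowFlip z Y (h i.succ) k.left * rowFlip z Y (h i.succ) k.right =
        -1 := by
      rintro Y rfl
      rw [rowFlip_mul_of_forall_ne _ fun j => by
        have := hne j; rw [mid_face_one] at this; exact_mod_cast this, hd]
    rcases eq_or_ne ((i : ℕ) + 1) N with hN | hN
    · have h2 := h1 N hN.symm
      rw [show i.succ = Fin.last N from Fin.ext hN, hv.last] at h2
      exact absurd h2 hu
    · refine ⟨⟨i + 1, by omega⟩, k, ?_, ?_⟩
      · rw [opp_face_one, show (1 : Dir) + 2 = 3 from rfl]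
        simp
      · rw [show (1 : Dir) + 2 = 3 from rfl, edgeVal_three]
        exact h1 _ rfl
  · rw [edgeVal_two] at hd
    rcases eq_or_ne (k : ℤ) a with ha | ha
    · rw [hv.ends i k.left (Or.inl ha), units_mul_self] at hd
      exact absurd hd hu
    · refine ⟨i, ⟨k - 1, mem_Ico.mpr (by omega)⟩, opp_face_two _ _, ?_⟩
      rw [show (2 : Dir) + 2 = 0 from rfl, edgeVal_zero,
        ← left_eq_right (k' := k) (sub_add_cancel _ _).symm, hd]
  · rw [edgeVal_three, rowFlip_mul_of_forall_ne _ fun j => by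
      have := hne j; rwa [mid_face_three] at this] at hd
    rcases eq_or_ne (i : ℕ) 0 with hi | hi
    · rw [show i.castSucc = 0 from Fin.ext hi, hv.first] at hd
      exact absurd hd hu
    · refine ⟨⟨i - 1, by omega⟩, k, ?_, ?_⟩
      · rw [opp_face_three, show (3 : Dir) + 2 = 1 from rfl]
        congr 2
        push_cast
        omega
      · rw [show (3 : Dir) + 2 = 1 from rfl, edgeVal_one, ← hd]
        have : Fin.succ ⟨(i : ℕ) - 1, by omega⟩ = i.castSucc := Fin.ext (by simp; omega)
        rw [this]

lemma arrowUnit_eq_neg_one {r : Arrow} : arrowUnit r = -1 ↔ r = Arrow.down := by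
  cases r <;> simp [arrowUnit]

lemma edgeVal_of_mid_eq (hz : Function.Injective z) (hv : Valid z arr h) {i : Fin N}
    {k : DualSite a b} {d : Dir} {j : Fin n} (hj : mid (face k i, d) = pts z j) :
    edgeVal z h i k d = -1 ↔ (face k i, d) = endDart (pts z) (roots arr) j := by
  fin_cases d
  · simp only [Fin.zero_eta, mid_face_zero, HEdge.pt, Prod.mk.injEq] at hj
    omega
  · simp only [Fin.mk_one, mid_face_one, HEdge.pt, Prod.mk.injEq] at hj
    have h1 : (z j).1 = k := Subtype.ext (by omega)
    have h2 : (z j).2 = i.succ := Fin.ext (by simp; omega)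
    have h3 := hv.arrow j
    rw [h1, h2] at h3
    change _ * _ = (-1 : ℤˣ) ↔ _
    rw [h3, arrowUnit_eq_neg_one]
    cases h4 : arr j
    · rw [endDart_up h4]
      simp
    · rw [endDart_down h4, h1, h2]
      simp
  · simp only [Fin.reduceFinMk, mid_face_two, HEdge.pt, Prod.mk.injEq] at hj
    omega
  · simp only [Fin.reduceFinMk, mid_face_three, HEdge.pt, Prod.mk.injEq] at hj
    have h1 : (z j).1 = k := Subtype.ext (by omega)
    have h2 : (z j).2 = i.castSucc := Fin.ext (by simp; omega)
    have h3 := hv.arrow j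
    have h5 := rowFlip_mul_self hz j (h (z j).2)
    rw [h3, h1, h2] at h5
    change rowFlip z i (h i.castSucc) k.left * _ = (-1 : ℤˣ) ↔ _
    rw [show ((i : ℕ)) = (i.castSucc : Fin (N + 1)) from rfl, h5, neg_inj]
    cases h4 : arr j
    · rw [endDart_up h4, h1, h2]
      simp [arrowUnit]
    · rw [endDart_down h4]
      simp [arrowUnit]

/-- An `up` insertion in the last row would leave two opposite spins after acting, and a `down`
insertion in row `0` needs two opposite spins before; both contradict the plus boundary. -/
lemma endDart_fst_mem (hz : Function.Injective z) (hv : Valid z arr h) (j : Fin n) :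
    (endDart (pts z) (roots arr) j).1 ∈ boxFaces a b N := by
  have hk := mem_Ico.mp (z j).1.2
  have hy := (z j).2.is_le
  have h3 := hv.arrow j
  cases h4 : arr j
  · rw [endDart_up h4, face_mem_boxFaces]
    refine ⟨hk, by omega, ?_⟩
    by_contra hc
    have h2 : (z j).2 = Fin.last N := Fin.ext (by rw [Fin.val_last]; omega)
    have h5 := rowFlip_mul_self hz j (h (z j).2)
    rw [h3, h2, Fin.val_last, hv.last, h4] at h5
    exact absurd h5 (by simp [arrowUnit])
  · rw [endDart_down h4, face_mem_boxFaces]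
    refine ⟨hk, ?_, by omega⟩
    by_contra hc
    have h2 : (z j).2 = 0 := Fin.ext (by rw [Fin.val_zero]; omega)
    rw [h2, hv.first, h4] at h3
    exact absurd h3 (by simp [arrowUnit])

open Classical in
/-- The configuration of domain walls of a history. -/
def contourOf (z : Fin n → HEdge a b N) (h : Fin (N + 1) → RowConfig a b) : Finset Pt :=
  (dualEdges (boxFaces a b N)).filter fun q => (∀ j, pts z j ≠ q) ∧
    ∃ (i : Fin N) (k : DualSite a b) (d : Dir), mid (face k i, d) = q ∧ edgeVal z h i k d = -1

/-- `contourOf` asks for one face that sees the wall; by `edgeVal_opp` the choice of face is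
irrelevant. At an insertion the arrow decides which half is present. -/
lemma mem_contourDarts_contourOf (hz : Function.Injective z) (hv : Valid z arr h) {i : Fin N}
    {k : DualSite a b} {d : Dir} :
    (face k i, d) ∈ contourDarts (boxFaces a b N) (pts z) (roots arr) (contourOf z h) ↔
      edgeVal z h i k d = -1 := by
  have hmem : ∀ (i : Fin N) (k : DualSite a b), face k i ∈ boxFaces a b N := fun i k =>
    face_mem_boxFaces.mpr ⟨mem_Ico.mp k.2, by omega, by omega⟩
  have hodd : ∀ (k i : ℤ) (d : Dir), Odd ((face k i, d) : Dart).1.1 ∧ Odd (face k i, d).1.2 :=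
    fun k i d => ⟨odd_two_mul_add_one _, odd_two_mul_add_one _⟩
  rw [mem_contourDarts]
  constructor
  · rintro ⟨-, h1 | ⟨j, hj⟩⟩
    · obtain ⟨-, hne, i', k', d', hm, he⟩ := mem_filter.mp h1
      rcases eq_or_eq_opp (hodd k i d) (hodd k' i' d') hm.symm with h2 | h2
      · rw [Prod.mk.injEq] at h2
        obtain ⟨h2, rfl⟩ := h2
        obtain ⟨h2, h3⟩ := face_injective h2
        rwa [Subtype.ext h2, show i = i' from Fin.ext (by omega)]
      · rw [← hm] at hne
        obtain ⟨i'', k'', h3, h4⟩ := edgeVal_opp hv hne he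
        rw [h3, Prod.mk.injEq] at h2
        obtain ⟨h2, rfl⟩ := h2
        obtain ⟨h2, h3⟩ := face_injective h2
        rwa [Subtype.ext h2, show i = i'' from Fin.ext (by omega)]
    · exact (edgeVal_of_mid_eq hz hv (by rw [hj, mid_endDart])).mpr hj
  · intro he
    refine ⟨hmem i k, ?_⟩
    by_cases hj : ∃ j, mid (face k i, d) = pts z j
    · obtain ⟨j, hj⟩ := hj
      exact Or.inr ⟨j, (edgeVal_of_mid_eq hz hv hj).mp he⟩
    · push Not at hj
      have hne := fun j => (hj j).symm
      refine Or.inl (mem_filter.mpr ⟨mem_dualEdges.mpr ⟨_, hmem i k, ?_, rfl⟩, hne, i, k, d, rfl, he⟩)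
      obtain ⟨i', k', h3, -⟩ := edgeVal_opp hv hne he
      rw [h3]
      exact hmem i' k'

theorem contourOf_mem (hz : Function.Injective z) (hv : Valid z arr h) :
    contourOf z h ∈ contours (boxFaces a b N) (pts z) (roots arr) := by
  have hne : ∀ j, pts z j ∉ contourOf z h := fun j hj => (mem_filter.mp hj).2.1 j rfl
  refine mem_contours.mpr ⟨filter_subset _ _, endDart_fst_mem hz hv, hne, fun p hp => ?_⟩
  rw [← card_contourDarts_face (pt_injective hz) hne hp]
  obtain ⟨k, i, rfl⟩ := exists_face hp
  simp only [mem_contourDarts_contourOf hz hv]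
  -- Around a face every corner spin occurs in two factors, so the number of walls is even.
  exact (prod_neg_one_eq_one_iff _).mp (prod_edgeVal z h i k)

/-- Every history that contributes to a correlation comes from a configuration. -/
theorem histOf_contourOf (hab : a < b) (hz : Function.Injective z) (hv : Valid z arr h) :
    histOf a b N (contourDarts (boxFaces a b N) (pts z) (roots arr) (contourOf z h)) = h := by
  have hγ := contourOf_mem hz hv
  set D := contourDarts (boxFaces a b N) (pts z) (roots arr) (contourOf z h) with hD
  have he : ∀ i k d, edgeVal z (histOf a b N D) i k d = edgeVal z h i k d := by
    intro i k d
    rw [hD, ← dartSign_eq_edgeVal hz hγ]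
    have h1 := mem_contourDarts_contourOf hz hv (i := i) (k := k) (d := d)
    rw [← dartSign_eq_neg_one] at h1
    rcases Int.units_eq_one_or (edgeVal z h i k d) with h2 | h2
    · rw [h2] at h1 ⊢
      exact (Int.units_eq_one_or _).resolve_right fun h3 => absurd (h1.mp h3) (by decide)
    · rw [h2, h1, h2]
  funext i
  induction i using Fin.induction with
  | zero => exact (valid_histOf hz hγ).first.trans hv.first.symm
  | succ i ih =>
    funext x
    obtain ⟨x, hx⟩ := x
    obtain ⟨hx1, hx2⟩ := mem_Icc.mp hx
    -- The spin at `b` has no face to its right and is recovered from the east dart of the last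
    -- face.
    rcases eq_or_lt_of_le hx2 with rfl | hlt
    · have h1 := he i ⟨x - 1, mem_Ico.mpr (by omega)⟩ 0
      have h2 : DualSite.right ⟨x - 1, mem_Ico.mpr (by omega)⟩ = ⟨x, hx⟩ :=
        Subtype.ext (sub_add_cancel _ _)
      change _ * _ = _ * _ at h1
      rw [ih, h2] at h1
      exact mul_left_cancel h1
    · have h1 := he i ⟨x, mem_Ico.mpr ⟨hx1, hlt⟩⟩ 2
      change _ * _ = _ * _ at h1
      rw [ih] at h1
      exact mul_left_cancel h1

end Backward

end

/-! ### Weights and signs of histories -/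

section

section Weights

variable {a b : ℤ} {N n : ℕ} {z : Fin n → HEdge a b N} {arr : Fin n → Arrow} {γ : Finset Pt}

lemma wt_sq (q : ℝ) (u : ℤˣ) : wt (q ^ 2) u = wt q u ^ 2 := by
  unfold wt; split_ifs <;> simp

lemma wt_dartSign (q : ℝ) (D : Finset Dart) (x : Dart) :
    wt q (dartSign D x) = q ^ (if x ∈ D then 1 else 0) := by
  unfold wt dartSign
  split_ifs with h1 h2 h2
  · exact absurd h2 (by decide)
  · simp
  · simp
  · exact absurd rfl h2

/-- The squared factor of a site is shared between the faces to its left and right; the two end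
sites contribute nothing. -/
lemma prod_Icc_sq {g : ℤ → ℝ} {a b : ℤ} (hab : a ≤ b) (ha : g a = 1) (hb : g b = 1) :
    ∏ x ∈ Icc a b, g x ^ 2 = ∏ k ∈ Ico a b, g k * g (k + 1) := by
  have h1 : ∏ x ∈ Icc a b, g x = ∏ k ∈ Ico a b, g k := by
    rw [show Icc a b = insert b (Ico a b) by ext; simp only [mem_Icc, mem_insert, mem_Ico]; omega,
      prod_insert (by simp), hb, one_mul]
  have h2 : ∏ x ∈ Icc a b, g x = ∏ k ∈ Ico a b, g (k + 1) := by
    rw [show Icc a b = insert a ((Ico a b).image (· + 1)) by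
      ext x
      simp only [mem_Icc, mem_insert, mem_image, mem_Ico]
      constructor
      · intro h
        rcases eq_or_ne x a with h' | h'
        · exact Or.inl h'
        · exact Or.inr ⟨x - 1, by omega, by omega⟩
      · rintro (rfl | ⟨k, hk, rfl⟩) <;> omega,
      prod_insert (by simp only [mem_image, mem_Ico]; rintro ⟨k, hk, hk'⟩; omega), ha, one_mul,
      prod_image (by intro x _ y _ h; simpa using h)]
  rw [prod_mul_distrib, prod_pow, sq]
  nth_rw 1 [h1]
  rw [h2]

/-- The interactions between two rows count the darts of the faces between them. -/
lemma rowWeight_histOf (hab : a < b) (hz : Function.Injective z)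
    (hγ : γ ∈ contours (boxFaces a b N) (pts z) (roots arr)) (q : ℝ) (i : Fin N) :
    rowWeight q
      (histOf a b N (contourDarts (boxFaces a b N) (pts z) (roots arr) γ) i.succ)
      (rowFlip z i
        (histOf a b N (contourDarts (boxFaces a b N) (pts z) (roots arr) γ) i.castSucc)) =
      ∏ k ∈ Ico a b, ∏ d,
        wt q (dartSign (contourDarts (boxFaces a b N) (pts z) (roots arr) γ) (face k i, d)) := by
  have he := dartSign_eq_edgeVal hz hγ i
  have hP := fun x => rowFlip_histOf hz hγ i.castSucc x
  have hside := fun k hk => dartSign_side hγ (k := k) (y := i) hk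
  have hh := fun k => dartSign_horizontal hγ k i
  have hPH := fun x hx hx' => postAt_mul_histAt hz hγ (x := x) hx hx' i
  set D := contourDarts (boxFaces a b N) (pts z) (roots arr) γ with hD
  have hs : ∀ x : Site a b, histOf a b N D i.succ x * rowFlip z i (histOf a b N D i.castSucc) x =
      dartSign D (face x i, 2) := by
    intro x
    obtain ⟨hx1, hx2⟩ := mem_Icc.mp x.2
    rw [← hPH x hx1 hx2, mul_comm]
    exact congrArg₂ _ (hP x) (by simp [histOf])
  rw [rowWeight]
  simp only [hs, wt_sq, ← edgeVal_one z, ← edgeVal_three, ← he]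
  rw [Finset.prod_coe_sort (Icc a b) fun x => wt q (dartSign D (face x i, 2)) ^ 2,
    prod_Icc_sq hab.le (by rw [hside a (Or.inl rfl), wt, if_pos rfl])
      (by rw [hside b (Or.inr rfl), wt, if_pos rfl]),
    Finset.prod_coe_sort (Ico a b) fun k => wt q (dartSign D (face k i, 1)),
    Finset.prod_coe_sort (Ico a b) fun k => wt q (dartSign D (face k i, 3)),
    ← Finset.prod_mul_distrib, ← Finset.prod_mul_distrib]
  refine Finset.prod_congr rfl fun k _ => ?_
  rw [Fin.prod_univ_four, hh]
  ring

lemma prod_boxFaces {M : Type*} [CommMonoid M] (f : Pt → M) :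
    ∏ p ∈ boxFaces a b N, f p = ∏ i : Fin N, ∏ k ∈ Ico a b, f (face k i) := by
  have h1 : Ico (0 : ℤ) N = (univ : Finset (Fin N)).image fun i : Fin N => ((i : ℕ) : ℤ) := by
    ext y
    simp only [mem_Ico, mem_image, mem_univ, true_and]
    constructor
    · intro h
      exact ⟨⟨y.toNat, by omega⟩, by simp; omega⟩
    · rintro ⟨i, rfl⟩
      omega
  rw [boxFaces, prod_image, prod_product, prod_comm, h1, prod_image]
  · rfl
  · intro i _ j _ h
    exact Fin.ext (by simpa using h)
  · rintro ⟨x1, x2⟩ _ ⟨y1, y2⟩ _ h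
    simp only [Prod.mk.injEq] at h ⊢
    omega

theorem prod_rowWeight_histOf (hab : a < b) (hz : Function.Injective z)
    (hγ : γ ∈ contours (boxFaces a b N) (pts z) (roots arr)) (q : ℝ) :
    ∏ i : Fin N, rowWeight q
      (histOf a b N (contourDarts (boxFaces a b N) (pts z) (roots arr) γ) i.succ)
      (rowFlip z i
        (histOf a b N (contourDarts (boxFaces a b N) (pts z) (roots arr) γ) i.castSucc)) =
      q ^ (2 * γ.card + n) := by
  rw [← card_contourDarts odd_boxFaces (pt_injective hz) hγ, card_eq_sum_ones, sum_contourDarts,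
    ← prod_pow_eq_pow_sum, prod_boxFaces]
  refine Finset.prod_congr rfl fun i _ => ?_
  rw [rowWeight_histOf hab hz hγ]
  refine Finset.prod_congr rfl fun k _ => ?_
  rw [← prod_pow_eq_pow_sum]
  exact Finset.prod_congr rfl fun d _ => wt_dartSign _ _ _

/-- The spin to the right of an insertion is the parity of the crossings with a ray. -/
lemma sgnU_sum_ray (hz : Function.Injective z)
    (hγ : γ ∈ contours (boxFaces a b N) (pts z) (roots arr)) (j : Fin n) :
    sgnU (∑ x ∈ contourDarts (boxFaces a b N) (pts z) (roots arr) γ, ray (pts z j) x) =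
      rowFlip z (z j).2 (histOf a b N (contourDarts (boxFaces a b N) (pts z) (roots arr) γ) (z j).2)
        (z j).1.right := by
  rw [rowFlip_histOf hz hγ]
  have hbox : ∀ x ∈ contourDarts (boxFaces a b N) (pts z) (roots arr) γ, x.1 ∈ boxFaces a b N :=
    fun x hx => (mem_contourDarts.mp hx).1
  set D := contourDarts (boxFaces a b N) (pts z) (roots arr) γ
  have h1 : ∏ k ∈ Ico ((z j).1.right : ℤ) b, dartSign D (face k ((z j).2 : ℕ), 3) =
      ∏ x ∈ (Ico ((z j).1.right : ℤ) b).image fun k => (face k ((z j).2 : ℕ), (3 : Dir)),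
        if x ∈ D then (-1 : ℤˣ) else 1 := by
    rw [prod_image]
    · rfl
    · intro x _ y _ hxy
      exact (face_injective (congrArg Prod.fst hxy)).1
  rw [sgnU_sum, postAt, h1, ← prod_filter]
  have h2 : ∀ x, sgnU (ray (pts z j) x) = if (pts z j).1 < x.1.1 ∧
      (x.2 = 1 ∧ x.1.2 = (pts z j).2 ∨ x.2 = 3 ∧ x.1.2 = (pts z j).2 + 1) then -1 else 1 := by
    intro x
    unfold ray
    split_ifs <;> rfl
  simp only [h2]
  rw [← prod_filter]
  refine Finset.prod_congr ?_ fun _ _ => rfl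
  ext ⟨p, d⟩
  simp only [mem_filter, mem_image, mem_Ico, HEdge.pt, Prod.mk.injEq, DualSite.right]
  constructor
  · rintro ⟨hx, h⟩
    refine ⟨?_, hx⟩
    obtain ⟨k, i, rfl⟩ := exists_face (hbox _ hx)
    simp only [face] at h
    have hk := mem_Ico.mp k.2
    -- Faces have odd height and insertions even height, so no dart that points north from its face
    -- can start at the height of the ray; only south darts count.
    rcases h.2 with h' | ⟨rfl, h'⟩
    · have := h'.2
      omega
    · refine ⟨k, by omega, ?_, rfl⟩
      rw [face, face, ← h']
  · rintro ⟨⟨k, hk, rfl, rfl⟩, hx⟩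
    refine ⟨hx, ?_⟩
    simp only [face]
    exact ⟨by omega, Or.inr ⟨trivial, trivial⟩⟩

/-- The sign of a history is the sign of its configuration. -/
theorem sign_mul_sign_histOf (hz : Function.Injective z)
    (hγ : γ ∈ contours (boxFaces a b N) (pts z) (roots arr)) (τ : Equiv.Perm (Fin n))
    (hτ : Monotone fun j => (z (τ j)).2) :
    Equiv.Perm.sign τ * (tieSign z τ * ∏ j, rowFlip z (z j).2
      (histOf a b N (contourDarts (boxFaces a b N) (pts z) (roots arr) γ) (z j).2)
        (z j).1.right) =
      sgnU (signExp (contourDarts (boxFaces a b N) (pts z) (roots arr) γ) (pts z)) := by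
  rw [← mul_assoc, tieSign, sign_mul_prod_ties hz τ hτ, signExp, sgnU_add, sgnU_sum]
  congr 1
  exact Finset.prod_congr rfl fun j _ => (sgnU_sum_ray hz hγ j).symm

end Weights

end

open scoped Matrix

/-! ### The correlation formula -/

section Correlations

variable {a b : ℤ} {N n : ℕ} {β : ℝ}

open Classical in
/-- The numerator of a correlation as a sum over configurations. -/
theorem sign_mul_numerator (hab : a < b) (hβ : 0 < β) {z : Fin n → HEdge a b N}
    (hz : Function.Injective z) (arr : Fin n → Arrow) (τ : Equiv.Perm (Fin n))
    (hτ : Monotone fun j => (z (τ j)).2) :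
    ((Equiv.Perm.sign τ : ℤ) : ℂ) * (plusState a b ⬝ᵥ ((transferMatrix a b β ^ N *
        (List.ofFn fun j => psiArrow β (arr (τ j)) (z (τ j))).reverse.prod) *ᵥ plusState a b)) =
      (groundWeight a b β : ℂ) ^ N *
        ∑ γ ∈ contours (boxFaces a b N) (pts z) (roots arr),
          (Real.exp (-β) : ℂ) ^ (2 * γ.card + n) * (∏ j, (arrowSign (arr j) * lam⁻¹)) *
          sgn (signExp (contourDarts (boxFaces a b N) (pts z) (roots arr) γ) (pts z)) := by
  rw [numerator_eq hab hβ hz arr τ hτ, mul_sum, mul_sum]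
  symm
  refine Finset.sum_bij
    (fun γ _ => histOf a b N (contourDarts (boxFaces a b N) (pts z) (roots arr) γ)) ?_ ?_ ?_ ?_
  · exact fun γ hγ => mem_filter.mpr ⟨mem_univ _, valid_histOf hz hγ⟩
  · exact fun γ hγ γ' hγ' h =>
      (histOf_injOn hz hγ hγ' h).antisymm (histOf_injOn hz hγ' hγ h.symm)
  · intro h hh
    have hv := (mem_filter.mp hh).2
    exact ⟨contourOf z h, contourOf_mem hz hv, histOf_contourOf hab hz hv⟩
  · intro γ hγ
    rw [prod_rowWeight_histOf hab hz hγ, sgn_eq, ← sign_mul_sign_histOf hz hγ τ hτ, spinVal_mul,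
      Complex.ofReal_pow]
    simp only [spinVal]
    ring

lemma exp_neg_pow (β : ℝ) (c m : ℕ) :
    (Real.exp (-β) : ℂ) ^ (2 * c + 2 * m) = (Real.exp (-2 * β) : ℂ) ^ (c + m) := by
  have h : Real.exp (-β) ^ 2 = Real.exp (-2 * β) := by
    rw [← Real.exp_nat_mul]
    push_cast
    ring_nf
  rw [← mul_add, pow_mul, ← Complex.ofReal_pow, h]

/-- This is the numerator without insertions, whose sign exponent is zero. -/
theorem denominator_eq (hab : a < b) (hβ : 0 < β) :
    plusState a b ⬝ᵥ (transferMatrix a b β ^ N *ᵥ plusState a b) =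
      (groundWeight a b β : ℂ) ^ N * (loopPartition (boxFaces a b N) (Real.exp (-2 * β)) : ℂ) := by
  have h1 := sign_mul_numerator (N := N) hab hβ (z := Fin.elim0) (fun x => x.elim0) Fin.elim0 1
    (fun x => x.elim0)
  have hp : pts (Fin.elim0 : Fin 0 → HEdge a b N) = Fin.elim0 := Subsingleton.elim _ _
  have hr : roots (Fin.elim0 : Fin 0 → Arrow) = Fin.elim0 := funext fun x => x.elim0
  rw [hp, hr] at h1
  simp only [Equiv.Perm.sign_one, Units.val_one, Int.cast_one, one_mul, List.ofFn_zero,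
    List.reverse_nil, List.prod_nil, mul_one, univ_eq_empty, prod_empty] at h1
  rw [h1, loopPartition, Complex.ofReal_sum]
  congr 1
  refine Finset.sum_congr rfl fun γ _ => ?_
  have h2 : signExp (contourDarts (boxFaces a b N) (Fin.elim0 : Fin 0 → Pt) Fin.elim0 γ)
      Fin.elim0 = 0 := by simp [signExp, keyInv]
  have h3 : sgn 0 = 1 := by simp [sgn]
  rw [h2, h3, mul_one, exp_neg_pow β γ.card 0, Complex.ofReal_pow, add_zero]

lemma phaseOf_eq {m : ℕ} {z : Fin (2 * m) → HEdge a b N} (hz : Function.Injective z)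
    (arr : Fin (2 * m) → Arrow) {γ : Finset Pt}
    (hγ : γ ∈ contours (boxFaces a b N) (pts z) (roots arr)) :
    phaseOf (pts z) (roots arr) γ =
      sgn (signExp (contourDarts (boxFaces a b N) (pts z) (roots arr) γ) (pts z)) *
        Complex.I ^ m * ∏ j, arrowSign (arr j) := by
  have h := nonempty_pathSystem odd_boxFaces (pt_injective hz) hγ
  rw [phaseOf, dif_pos h]
  exact h.some.phase_eq odd_boxFaces (pt_injective hz) hγ

/-- The source of the sign `(-1) ^ m`: by `lam_sq`, the power `lam⁻¹ ^ (2 * m)` is `(-I) ^ m`, while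
the phase of a configuration carries `I ^ m`. -/
lemma prod_arrowSign_mul {m : ℕ} (arr : Fin (2 * m) → Arrow) :
    ∏ j, (arrowSign (arr j) * lam⁻¹) = (-1) ^ m * (Complex.I ^ m * ∏ j, arrowSign (arr j)) := by
  rw [prod_mul_distrib, prod_const, card_univ, Fintype.card_fin, pow_mul, inv_pow, lam_sq,
    Complex.inv_I, neg_pow]
  ring

/-- The correlation of fermions is the multipoint observable up to a sign. -/
theorem sign_mul_correlation (hab : a < b) (hβ : 0 < β) {m : ℕ} {z : Fin (2 * m) → HEdge a b N}
    (hz : Function.Injective z) (arr : Fin (2 * m) → Arrow) (τ : Equiv.Perm (Fin (2 * m)))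
    (hτ : Monotone fun j => (z (τ j)).2) :
    ((Equiv.Perm.sign τ : ℤ) : ℂ) *
        correlation N β (List.ofFn fun j => psiArrow β (arr (τ j)) (z (τ j))).reverse.prod =
      (-1) ^ m * observable (boxFaces a b N) (Real.exp (-2 * β)) (pts z) (roots arr) := by
  have hC : (groundWeight a b β : ℂ) ^ N ≠ 0 :=
    pow_ne_zero _ (Complex.ofReal_ne_zero.mpr (groundWeight_pos a b β).ne')
  rw [correlation, ← mul_div_assoc, sign_mul_numerator hab hβ hz arr τ hτ, denominator_eq hab hβ,
    mul_div_mul_left _ _ hC, observable, ← mul_div_assoc, mul_sum]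
  congr 1
  refine Finset.sum_congr rfl fun γ hγ => ?_
  rw [phaseOf_eq hz arr hγ, prod_arrowSign_mul, exp_neg_pow]
  ring

end Correlations

end IsingFermion

end

theorem mainTheorem7 (a b : ℤ) (hab : a < b) (N : ℕ) (β : ℝ) (hβ : 0 < β) (m : ℕ)
    (z : Fin (2 * m) → HEdge a b N) (hz : Function.Injective z) (arr : Fin (2 * m) → Arrow)
    (τ : Equiv.Perm (Fin (2 * m))) (hτ : Monotone fun j => (z (τ j)).2) :
    (∀ γ ∈ contours (boxFaces a b N) (pts z) (roots arr),
      Nonempty (PathSystem (pts z) (roots arr) γ) ∧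
        ∀ P Q : PathSystem (pts z) (roots arr) γ, P.phase = Q.phase) ∧
    ((Equiv.Perm.sign τ : ℤ) : ℂ) *
        correlation N β (List.ofFn fun j => psiArrow β (arr (τ j)) (z (τ j))).reverse.prod =
      (-1) ^ m *
        observable (boxFaces a b N) (Real.exp (-2 * β)) (pts z) (roots arr) := by
  refine ⟨fun γ hγ => ⟨nonempty_pathSystem odd_boxFaces (pt_injective hz) hγ, fun P Q => ?_⟩,
    sign_mul_correlation hab hβ hz arr τ hτ⟩
  rw [P.phase_eq odd_boxFaces (pt_injective hz) hγ, Q.phase_eq odd_boxFaces (pt_injective hz) hγ]
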